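/- **Setting.** Let $K$ be a field of characteristic $0$ with algebraic closure $\bar K$, let $\mathbb L$ be an intermediate field, $K\subseteq\mathbb L\subseteq\bar K$, and let $b\ge 2$ and $r\ge 0$ be integers. Let $\ell_0,\dots,\ell_r\in K[x]$ have no common factor, with $\ell_0\ne0$ and $\ell_r\neq 0$. Let $M$ be the Mahler operator $y(x)\mapsto y(x^b)$ and consider $$\text{(L)}\quad \ell_rM^ry+\dots+\ell_1My+\ell_0y=0,\qquad \text{(R)}\quad \ell_r\,u\,Mu\cdots M^{r-1}u+\dots+\ell_2\,u\,Mu+\ell_1u+\ell_0=0 .$$ For a field $F\supseteq K$ let $F((x^{1/*}))=\bigcup_{q\ge1}F((x^{1/q}))$ be the field of Puiseux series and $F(x^{1/*})=\bigcup_{q\geq 1}F(x^{1/q})$ the field of ramified rational functions. Let $\mathfrak D_F=\bigoplus_{\lambda\in F\setminus\{0\}}e_\lambda F((x^{1/*}))$ be the ring with $e_\lambda e_{\lambda'}=e_{\lambda\lambda'}$, $e_1=1$, with $M$ extended to it by $Me_\lambda=\lambda e_\lambda$. The lower Newton polygon of $L=\sum_k \ell_kM^k$, $\ell_k=\sum_j\ell_{k,j}x^j$,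 is the lower convex hull of the points $(b^k,j)$ with $\ell_{k,j}\ne0$. An edge with end points of abscissae $b^{k_1}<b^{k_2}$ has characteristic polynomial $\sum \ell_{k,j}X^{k-k_1}$, the sum being over the points $(b^k,j)$ on the edge. Let $\Lambda\subseteq\bar K$ be the set of the roots of these polynomials, and let $\Lambda'$ be the set of the $\lambda\in\Lambda$ such that (L) has a nonzero solution in $e_\lambda\bar K((x^{1/*}))$. An edge is $\lambda$-admissible if $\lambda$ is a root of its characteristic polynomial, and $q_\lambda$ is the least common multiple of those denominators of slopes of $\lambda$-admissible edges that are coprime with $b$. An element $y\in\mathfrak D_{\mathbb L}$ is hypergeometric if $My=uy$ for some $u\in\mathbb L(x^{1/*})$; two elements are similar if one is the product of the other with a nonzero element of $\mathbb L(x^{1/*})$. Below, "class" means a similarity class of nonzero hypergeometric solutions of (L) in $\mathfrak D_{\mathbb L}$. **Theorem.** (0) For each class $H$ there is a unique tuple $(\lambda,g,(p_1,\dots,p_s))$ with $\lambda\in\mathbb L\setminus\{0\}$, $g\in\mathbb L(x)$, $g(0)=1$, $s>0$, and $p_j\in\mathbb L[x,x^{-1}]$, such that the generalized series $e_\lambda\,p_j(x^{1/q_\lambda})\prod_{k\ge0}1/g(x^{b^k/q_\lambda})$,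 $1\le j\le s$, form an $\mathbb L$-basis of $H\cup\{0\}$, the family $(p_1,\dots,p_s)$ is in reduced echelon form with respect to ascending degree, and $p_1,\dots,p_s$ are coprime in $\mathbb L[x,x^{-1}]$. Distinct classes have distinct pairs $(\lambda,g)$. Denote by $H_{\lambda,g}$ the class with pair $(\lambda,g)$, and by $\mathfrak R_{\lambda,g}$ its image under $y\mapsto My/y$ (the elements of $H_{\lambda,g}$ are invertible). (1) The set $I$ of the pairs $(\lambda,g)$ so obtained is finite, each $(\lambda,g)\in I$ satisfies $\lambda\in\mathbb L\cap\Lambda'$ and $g(0)=1$, and the set of solutions of (R) in $\mathbb L(x^{1/*})$ is the disjoint union $$\coprod_{(\lambda,g)\in I}\mathfrak R_{\lambda,g}.$$ Moreover, for each $\lambda\in\mathbb L\cap\Lambda'$, the set of nonzero hypergeometric solutions of (L) in $e_\lambda\mathbb L((x^{1/*}))$ is the disjoint union of the $H_{\lambda,g}$ with $(\lambda,g)\in I$. (2) For each $(\lambda,g)\in I$, with tuple $(\lambda,g,(p_1,\dots,p_s))$, the map $$(c_1:\dots:c_s)\longmapsto u(x)=\lambda\,\frac{\sum_{j=1}^sc_jp_j(x^{b/q_\lambda})}{\sum_{j=1}^sc_jp_j(x^{1/q_\lambda})}\,g(x^{1/q_\lambda})$$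 is well defined (its denominators are nonzero) and is a bijection from $\mathbb P^{s-1}(\mathbb L)$ to $\mathfrak R_{\lambda,g}$. (3) Writing $s_{\lambda,g}$ for the integer $s$ of the tuple, $\sum_{(\lambda,g)\in I}(s_{\lambda,g}-1)\le r-\#I$. -/

import Mathlib

namespace Mahler

noncomputable section

/-! ### Puiseux series and the substitutions `x ↦ x^(m/q)` -/

/-- The substitution `y(x) ↦ y(x^(m/q))` on Hahn series with rational exponents. -/
def hahnSubst (F : Type*) [Field F] (m q : ℕ+) : HahnSeries ℚ F →+* HahnSeries ℚ F :=
  HahnSeries.embDomainRingHom (AddMonoidHom.mulLeft ((m : ℚ) / (q : ℚ)))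
    (fun x y h => by
      have hpos : (0 : ℚ) < (m : ℚ) / (q : ℚ) := div_pos (by exact_mod_cast m.pos)
        (by exact_mod_cast q.pos)
      exact mul_left_cancel₀ hpos.ne' h)
    (fun x y => by
      have hpos : (0 : ℚ) < (m : ℚ) / (q : ℚ) := div_pos (by exact_mod_cast m.pos)
        (by exact_mod_cast q.pos)
      exact mul_le_mul_iff_of_pos_left hpos)

/-- A Laurent series in `x`, seen as a Hahn series with rational exponents. -/
def laurentToHahn (F : Type*) [Field F] : LaurentSeries F →+* HahnSeries ℚ F :=
  HahnSeries.embDomainRingHom (Int.castAddHom ℚ) Int.cast_injective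
    (fun _ _ => Int.cast_le)

/-- All exponents of `y` lie in `(1/q)ℤ`. -/
def HasRamification {F : Type*} [Field F] (q : ℕ+) (y : HahnSeries ℚ F) : Prop :=
  ∀ a ∈ y.support, ∃ n : ℤ, a = (n : ℚ) / (q : ℚ)

theorem hahnSubst_support {F : Type*} [Field F] (m q : ℕ+) (y : HahnSeries ℚ F) {a : ℚ}
    (ha : a ∈ (hahnSubst F m q y).support) : ∃ c ∈ y.support, a = (m : ℚ) / (q : ℚ) * c := by
  obtain ⟨c, hc, h⟩ := HahnSeries.support_embDomain_subset ha
  exact ⟨c, hc, h.symm⟩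

theorem laurentToHahn_support {F : Type*} [Field F] (y : LaurentSeries F) {a : ℚ}
    (ha : a ∈ (laurentToHahn F y).support) : ∃ n : ℤ, a = n := by
  obtain ⟨c, hc, h⟩ := HahnSeries.support_embDomain_subset ha
  exact ⟨c, h.symm⟩

theorem HasRamification.mono {F : Type*} [Field F] {q : ℕ+} (q' : ℕ+) {y : HahnSeries ℚ F}
    (h : HasRamification q y) : HasRamification (q * q') y := by
  intro a ha
  obtain ⟨n, rfl⟩ := h a ha
  have h1 : (q : ℚ) ≠ 0 := by exact_mod_cast q.ne_zero
  have h2 : (q' : ℚ) ≠ 0 := by exact_mod_cast q'.ne_zero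
  refine ⟨n * q', ?_⟩
  push_cast
  field_simp

theorem HasRamification.add {F : Type*} [Field F] {q : ℕ+} {y z : HahnSeries ℚ F}
    (hy : HasRamification q y) (hz : HasRamification q z) : HasRamification q (y + z) := by
  intro a ha
  rcases HahnSeries.support_add_subset y z ha with h | h
  exacts [hy a h, hz a h]

theorem HasRamification.mul {F : Type*} [Field F] {q : ℕ+} {y z : HahnSeries ℚ F}
    (hy : HasRamification q y) (hz : HasRamification q z) : HasRamification q (y * z) := by
  intro a ha
  obtain ⟨c, hc, d, hd, rfl⟩ := Set.mem_add.1 (HahnSeries.support_mul_subset ha)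
  obtain ⟨n, rfl⟩ := hy c hc
  obtain ⟨n', rfl⟩ := hz d hd
  exact ⟨n + n', by push_cast; ring⟩

theorem HasRamification.exists_laurent {F : Type*} [Field F] {q : ℕ+} {y : HahnSeries ℚ F}
    (hy : HasRamification q y) :
    ∃ f : LaurentSeries F, hahnSubst F 1 q (laurentToHahn F f) = y := by
  have hq : (0 : ℚ) < (q : ℚ) := by exact_mod_cast q.pos
  let f : LaurentSeries F :=
    { coeff := fun n => y.coeff ((n : ℚ) / (q : ℚ))
      isPWO_support' := by
        intro u
        obtain ⟨i, j, hij, h⟩ := y.isPWO_support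
          (fun k => ⟨((u k : ℤ) : ℚ) / (q : ℚ), (u k).2⟩)
        refine ⟨i, j, hij, ?_⟩
        have := (div_le_div_iff_of_pos_right hq).1 (show ((u i : ℤ) : ℚ) / (q : ℚ) ≤ ((u j : ℤ) : ℚ) / (q : ℚ) from h)
        exact_mod_cast this }
  have key : ∀ n : ℤ, (hahnSubst F 1 q (laurentToHahn F f)).coeff ((n : ℚ) / (q : ℚ))
      = y.coeff ((n : ℚ) / (q : ℚ)) := by
    intro n
    have e : (n : ℚ) / (q : ℚ) = AddMonoidHom.mulLeft (((1 : ℕ+) : ℚ) / (q : ℚ)) (n : ℚ) := by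
      simp [AddMonoidHom.mulLeft]; ring
    have h1 : (hahnSubst F 1 q (laurentToHahn F f)).coeff
        (AddMonoidHom.mulLeft (((1 : ℕ+) : ℚ) / (q : ℚ)) (n : ℚ))
        = (laurentToHahn F f).coeff (n : ℚ) := HahnSeries.embDomain_mk_coeff _ _
    have h2 : (laurentToHahn F f).coeff (n : ℚ) = f.coeff n :=
      HahnSeries.embDomain_mk_coeff (f := (Int.castAddHom ℚ)) Int.cast_injective
        (fun _ _ => Int.cast_le)
    rw [e, h1, h2, ← e]
  refine ⟨f, HahnSeries.ext (funext fun a => ?_)⟩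
  by_cases ha : ∃ n : ℤ, a = (n : ℚ) / (q : ℚ)
  · obtain ⟨n, rfl⟩ := ha
    exact key n
  · have h1 : y.coeff a = 0 := by
      by_contra h
      exact ha (hy a h)
    rw [h1]
    by_contra h
    obtain ⟨c, hc, rfl⟩ := hahnSubst_support 1 q _ h
    obtain ⟨n, rfl⟩ := laurentToHahn_support f hc
    exact ha ⟨n, by push_cast; ring⟩

theorem hasRamification_laurent {F : Type*} [Field F] (q : ℕ+) (f : LaurentSeries F) :
    HasRamification q (hahnSubst F 1 q (laurentToHahn F f)) := by
  intro a ha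
  obtain ⟨c, hc, rfl⟩ := hahnSubst_support 1 q _ ha
  obtain ⟨n, rfl⟩ := laurentToHahn_support f hc
  exact ⟨n, by push_cast; ring⟩

theorem HasRamification.inv {F : Type*} [Field F] {q : ℕ+} {y : HahnSeries ℚ F}
    (hy : HasRamification q y) : HasRamification q y⁻¹ := by
  obtain ⟨f, rfl⟩ := hy.exists_laurent
  rw [← map_inv₀, ← map_inv₀]
  exact hasRamification_laurent q _

theorem hasRamification_C {F : Type*} [Field F] (c : F) :
    HasRamification 1 (HahnSeries.C c : HahnSeries ℚ F) := by
  intro a ha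
  rw [HahnSeries.C_apply] at ha
  have := HahnSeries.support_single_subset ha
  exact ⟨0, by simpa using this⟩

/-- The field of Puiseux series over `F`: the union over `q ≥ 1` of the fields `F((x^(1/q)))`,
inside the field of Hahn series with rational exponents. -/
def puiseux (F : Type*) [Field F] : Subfield (HahnSeries ℚ F) where
  carrier := {y | ∃ q : ℕ+, HasRamification q y}
  mul_mem' := by
    rintro y z ⟨q, hy⟩ ⟨q', hz⟩
    refine ⟨q * q', (hy.mono q').mul ?_⟩
    rw [mul_comm]
    exact hz.mono q
  one_mem' := ⟨1, hasRamification_C 1⟩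
  add_mem' := by
    rintro y z ⟨q, hy⟩ ⟨q', hz⟩
    refine ⟨q * q', (hy.mono q').add ?_⟩
    rw [mul_comm]
    exact hz.mono q
  zero_mem' := ⟨1, fun a ha => by simp at ha⟩
  neg_mem' := by
    rintro y ⟨q, hy⟩
    exact ⟨q, fun a ha => hy a (by rwa [HahnSeries.support_neg] at ha)⟩
  inv_mem' := by
    rintro y ⟨q, hy⟩
    exact ⟨q, hy.inv⟩

/-- The type of Puiseux series over `F`. -/
abbrev Puiseux (F : Type*) [Field F] : Type _ := ↥(puiseux F)

/-- The inclusion of the constants in the field of Puiseux series. -/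
def constP (F : Type*) [Field F] : F →+* Puiseux F :=
  (HahnSeries.C : F →+* HahnSeries ℚ F).codRestrict (puiseux F)
    (fun c => ⟨1, hasRamification_C c⟩)

instance instAlgebraPuiseux (F : Type*) [Field F] : Algebra F (Puiseux F) := (constP F).toAlgebra

/-- The substitution `y(x) ↦ y(x^(m/q))` on Puiseux series. -/
def subst (F : Type*) [Field F] (m q : ℕ+) : Puiseux F →+* Puiseux F :=
  ((hahnSubst F m q).comp (puiseux F).subtype).codRestrict (puiseux F) (by
    rintro ⟨y, q', hy⟩
    refine ⟨q * q', fun a ha => ?_⟩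
    obtain ⟨c, hc, rfl⟩ := hahnSubst_support m q _ ha
    obtain ⟨n, hn⟩ := hy c hc
    rw [hn]
    have h1 : (q : ℚ) ≠ 0 := by exact_mod_cast q.ne_zero
    have h2 : (q' : ℚ) ≠ 0 := by exact_mod_cast q'.ne_zero
    refine ⟨m * n, ?_⟩
    push_cast
    field_simp)

/-- The inclusion of Laurent series in Puiseux series. -/
def ofLaurent (F : Type*) [Field F] : LaurentSeries F →+* Puiseux F :=
  (laurentToHahn F).codRestrict (puiseux F) (by
    intro f
    refine ⟨1, fun a ha => ?_⟩
    obtain ⟨n, rfl⟩ := laurentToHahn_support f ha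
    exact ⟨n, by simp⟩)

open scoped RatFunc in
/-- `f(x^(m/q))` for a rational function `f`, expanded as a Laurent series in `x^(1/q)`. -/
def ratAt {F : Type*} [Field F] (m q : ℕ+) (f : RatFunc F) : Puiseux F :=
  subst F m q (ofLaurent F (algebraMap (RatFunc F) (LaurentSeries F) f))

/-- `f(x^(m/q))` for a formal power series `f`. -/
def powerSeriesAt {F : Type*} [Field F] (m q : ℕ+) (f : PowerSeries F) : Puiseux F :=
  subst F m q (ofLaurent F (HahnSeries.ofPowerSeries ℤ F f))

/-- `p(x^(m/q))` for a Laurent polynomial `p`. -/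
def laurentPolyAt {F : Type*} [Field F] (m q : ℕ+) (p : LaurentPolynomial F) : Puiseux F :=
  subst F m q (ofLaurent F (HahnSeries.ofFinsupp p.coeff))

/-- A polynomial with coefficients in `K`, as a Puiseux series over an extension `F` of `K`. -/
def polyCoeff {K : Type*} (F : Type*) [Field K] [Field F] [Algebra K F] (P : Polynomial K) :
    Puiseux F :=
  ratAt 1 1 (algebraMap (Polynomial F) (RatFunc F) (P.map (algebraMap K F)))

/-- The field of ramified rational functions over `F` (as a set of Puiseux series): the union over
`q ≥ 1` of the fields `F(x^(1/q))`. -/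
def ramRat (F : Type*) [Field F] : Set (Puiseux F) :=
  {u | ∃ (q : ℕ+) (f : RatFunc F), u = ratAt 1 q f}

/-! ### The difference ring of generalized series -/

/-- The algebra over the field of Puiseux series with basis `(e_lam)`, for `lam` a nonzero element
of `F`, and `e_lam * e_lam' = e_(lam * lam')`. The element `e_lam * p` is
`MonoidAlgebra.single lam p`. -/
abbrev DRing (F : Type*) [Field F] : Type _ := MonoidAlgebra (Puiseux F) Fˣ

/-- The Mahler operator `y(x) ↦ y(x^b)` on Puiseux series. -/
def mahlerP (F : Type*) [Field F] (b : ℕ+) : Puiseux F →+* Puiseux F := subst F b 1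

/-- The map `lam ↦ lam * e_lam`. -/
def eigenHom (F : Type*) [Field F] : Fˣ →* DRing F where
  toFun lam := MonoidAlgebra.single lam (algebraMap F (Puiseux F) (lam : F))
  map_one' := by simp [MonoidAlgebra.one_def]
  map_mul' lam lam' := by simp [MonoidAlgebra.single_mul_single]

/-- The Mahler operator on the difference ring: the ring endomorphism that extends the Mahler
operator of Puiseux series and satisfies `M e_lam = lam * e_lam`. -/
def mahler (F : Type*) [Field F] (b : ℕ+) : DRing F →+* DRing F :=
  MonoidAlgebra.liftNCRingHom (MonoidAlgebra.singleOneRingHom.comp (mahlerP F b)) (eigenHom F)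
    (fun _ _ => Commute.all _ _)

theorem mahler_single (F : Type*) [Field F] (b : ℕ+) (lam : Fˣ) (p : Puiseux F) :
    mahler F b (MonoidAlgebra.single lam p)
      = MonoidAlgebra.single lam (algebraMap F (Puiseux F) (lam : F) * mahlerP F b p) := by
  simp [mahler, eigenHom, MonoidAlgebra.single_mul_single, mul_comm]

/-! ### The linear equation and the Riccati equation -/

section Equations

variable {K : Type*} [Field K] (F : Type*) [Field F] [Algebra K F]
  (b : ℕ+) (r : ℕ) (l : ℕ → Polynomial K)

/-- `L y = l_r M^r y + ... + l_1 M y + l_0 y`. -/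
def applyL (y : DRing F) : DRing F :=
  ∑ k ∈ Finset.range (r + 1), polyCoeff F (l k) • (mahler F b)^[k] y

/-- The solutions `u` among the ramified rational functions over `F` of the Riccati equation
`l_r u (M u) ... (M^(r-1) u) + ... + l_2 u (M u) + l_1 u + l_0 = 0`. -/
def riccatiSolutions : Set (Puiseux F) :=
  {u | u ∈ ramRat F ∧
    ∑ k ∈ Finset.range (r + 1),
      polyCoeff F (l k) * ∏ i ∈ Finset.range k, (mahlerP F b)^[i] u = 0}

/-- Hypergeometric elements with respect to the field of ramified rational functions. -/
def IsHypergeometric (y : DRing F) : Prop :=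
  ∃ u ∈ ramRat F, mahler F b y = u • y

/-- The nonzero hypergeometric solutions of the linear equation. -/
def hypSolutions : Set (DRing F) :=
  {y | y ≠ 0 ∧ IsHypergeometric F b y ∧ applyL F b r l y = 0}

/-- Similarity with respect to the field of ramified rational functions. -/
def Similar (y z : DRing F) : Prop :=
  ∃ f ∈ ramRat F, f ≠ 0 ∧ y = f • z

/-- The nontrivial similarity classes of hypergeometric solutions of the linear equation
(they do not contain `0`). -/
def simClasses : Set (Set (DRing F)) :=
  {H | ∃ y ∈ hypSolutions F b r l, H = {z | z ∈ hypSolutions F b r l ∧ Similar F z y}}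

/-- The image of a set of generalized series under `y ↦ M y / y`. -/
def quotImage (H : Set (DRing F)) : Set (Puiseux F) :=
  {u | ∃ y ∈ H, IsUnit y ∧ mahler F b y = u • y}

end Equations

/-! ### The lower Newton polygon -/

section Newton

variable {K : Type*} [Field K] (b : ℕ+) (r : ℕ) (l : ℕ → Polynomial K)

/-- The slope of the line through the lowest points of abscissae `b^k₁` and `b^k₂`, among the
points `(b^k, j)` such that the coefficient of `x^j` in `l_k` is nonzero. -/
def edgeSlope (k₁ k₂ : ℕ) : ℚ :=
  (((l k₂).natTrailingDegree : ℚ) - ((l k₁).natTrailingDegree : ℚ))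
    / ((b : ℚ) ^ k₂ - (b : ℚ) ^ k₁)

/-- The ordinate at abscissa `b^k` of this line. -/
def lineAt (k₁ k₂ k : ℕ) : ℚ :=
  ((l k₁).natTrailingDegree : ℚ) + edgeSlope b l k₁ k₂ * ((b : ℚ) ^ k - (b : ℚ) ^ k₁)

/-- The lower convex hull of the points `(b^k, j)`, `k ≤ r`, such that the coefficient of `x^j` in
`l_k` is nonzero has an edge whose end points have abscissae `b^k₁ < b^k₂`. -/
def IsEdge (k₁ k₂ : ℕ) : Prop :=
  k₁ < k₂ ∧ k₂ ≤ r ∧ l k₁ ≠ 0 ∧ l k₂ ≠ 0 ∧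
    (∀ k ≤ r, ∀ j, (l k).coeff j ≠ 0 → lineAt b l k₁ k₂ k ≤ (j : ℚ)) ∧
    (∀ k ≤ r, ∀ j, (l k).coeff j ≠ 0 → (j : ℚ) = lineAt b l k₁ k₂ k → k₁ ≤ k ∧ k ≤ k₂)

open Classical in
/-- The characteristic polynomial of an edge: the sum over the points `(b^k, j)` of the edge of
`l_{k,j} X^(k - k₁)`. -/
def edgePoly (k₁ k₂ : ℕ) : Polynomial K :=
  ∑ k ∈ Finset.Icc k₁ k₂,
    Polynomial.C (∑ j ∈ (l k).support with (((j : ℕ) : ℚ) = lineAt b l k₁ k₂ k), (l k).coeff j)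
      * Polynomial.X ^ (k - k₁)

/-- The edge is `lam`-admissible: `lam` is a root of its characteristic polynomial. -/
def IsAdmissible {F : Type*} [Field F] [Algebra K F] (lam : F) (k₁ k₂ : ℕ) : Prop :=
  IsEdge b r l k₁ k₂ ∧ Polynomial.aeval lam (edgePoly b l k₁ k₂) = 0

/-- The set of the roots in `F` of the characteristic polynomials. -/
def Lam (F : Type*) [Field F] [Algebra K F] : Set F :=
  {lam | ∃ k₁ k₂, IsAdmissible b r l lam k₁ k₂}

/-- The set of the `lam` in `Lam` such that the linear equation has a nonzero solution of the form
`e_lam * p` with `p` a Puiseux series over `F`. -/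
def Lam' (F : Type*) [Field F] [Algebra K F] : Set F :=
  {lam | lam ∈ Lam b r l F ∧ ∃ e : Fˣ, (e : F) = lam ∧
    ∃ p : Puiseux F, p ≠ 0 ∧ applyL F b r l (MonoidAlgebra.single e p) = 0}

open Classical in
/-- The ramification bound with respect to `lam`: the least common multiple of those denominators
of slopes of `lam`-admissible edges that are coprime with `b`. -/
def ramBound {F : Type*} [Field F] [Algebra K F] (lam : F) : ℕ+ :=
  ⟨((Finset.range (r + 1) ×ˢ Finset.range (r + 1)).filter
      (fun k => IsAdmissible b r l lam k.1 k.2 ∧ Nat.Coprime (edgeSlope b l k.1 k.2).den b)).lcm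
      (fun k => (edgeSlope b l k.1 k.2).den),
    Nat.pos_of_ne_zero (by
      rw [Ne, Finset.lcm_eq_zero_iff]
      rintro ⟨k, -, hk⟩
      exact (edgeSlope b l k.1 k.2).den_ne_zero hk)⟩

end Newton

/-! ### Infinite products -/

/-- The power series expansion of `1/g`, for a rational function `g` with `g(0) = 1`. -/
def invSeries {F : Type*} [Field F] (g : RatFunc F) : PowerSeries F :=
  (g.denom : PowerSeries F) * (g.num : PowerSeries F)⁻¹

/-- The partial product of the `1/g(x^(b^k))` over `k < N`. -/
def partialProd {F : Type*} [Field F] (b : ℕ+) (g : RatFunc F) (N : ℕ) : PowerSeries F :=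
  ∏ k ∈ Finset.range N, PowerSeries.expand ((b ^ k : ℕ+) : ℕ) (b ^ k).ne_zero (invSeries g)

/-- The infinite product of the `1/g(x^(b^k))` over `k ≥ 0`, for a rational function `g` with
`g(0) = 1`. The coefficient of `x^n` in the partial products is constant from `n + 1` factors on,
see `coeff_partialProd`. -/
def infProd {F : Type*} [Field F] (b : ℕ+) (g : RatFunc F) : PowerSeries F :=
  PowerSeries.mk fun n => PowerSeries.coeff n (partialProd b g (n + 1))

theorem constantCoeff_invSeries {F : Type*} [Field F] {g : RatFunc F}
    (hg : RatFunc.eval (RingHom.id F) 0 g = 1) :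
    PowerSeries.constantCoeff (invSeries g) = 1 := by
  have h : g.num.coeff 0 / g.denom.coeff 0 = 1 := by
    simpa [RatFunc.eval, Polynomial.coeff_zero_eq_eval_zero] using hg
  have hd : g.denom.coeff 0 ≠ 0 := by
    intro h0
    simp [h0] at h
  have hn : g.num.coeff 0 = g.denom.coeff 0 := by
    field_simp at h
    exact h
  simp [invSeries, hn, hd]

theorem coeff_partialProd {F : Type*} [Field F] {b : ℕ+} (hb : 2 ≤ b) {g : RatFunc F}
    (hg : RatFunc.eval (RingHom.id F) 0 g = 1) {n N : ℕ} (hN : n < N) :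
    PowerSeries.coeff n (partialProd b g N) = PowerSeries.coeff n (infProd b g) := by
  induction N, Nat.succ_le_of_lt hN using Nat.le_induction with
  | base => simp [infProd]
  | succ N hle ih =>
    rw [← ih hle, partialProd, Finset.prod_range_succ, ← partialProd]
    have hlt : n < b ^ N := lt_trans hle (Nat.lt_pow_self (by exact_mod_cast hb))
    rw [PowerSeries.coeff_mul]
    have hz : ∀ j ≤ n, PowerSeries.coeff j
        (PowerSeries.expand ((b ^ N : ℕ+) : ℕ) (b ^ N).ne_zero (invSeries g))
          = if j = 0 then 1 else 0 := by
      intro j hj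
      rw [PowerSeries.coeff_expand]
      split_ifs with h1 h2 h2
      · subst h2
        simpa using constantCoeff_invSeries hg
      · have := Nat.le_of_dvd (Nat.pos_of_ne_zero h2) h1
        simp only [PNat.pow_coe] at this
        omega
      · subst h2
        simp at h1
      · rfl
    rw [Finset.sum_eq_single (n, 0)]
    · rw [hz 0 (Nat.zero_le _)]
      simp
    · rintro ⟨i, j⟩ hij hne
      have hij' : i + j = n := by simpa using hij
      rw [hz j (by omega), if_neg, mul_zero]
      rintro rfl
      exact hne (by simp at hij'; simp [hij'])
    · intro h
      simp at h

/-! ### The tuple attached to a similarity class -/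

/-- A tuple `(lam, g, (p_1, ..., p_s))`. -/
structure ClassData (F : Type*) [Field F] where
  lam : Fˣ
  g : RatFunc F
  s : ℕ
  p : Fin s → LaurentPolynomial F

/-- Reduced echelon form with respect to ascending degree: the minimal degrees `v i` of the `p i`
are increasing, the coefficient of `x^(v i)` is `1` in `p i` and `0` in the other `p j`. -/
def IsReducedEchelon {F : Type*} [Field F] {s : ℕ} (p : Fin s → LaurentPolynomial F) : Prop :=
  ∃ v : Fin s → ℤ, StrictMono v ∧ ∀ i,
    (∀ n < v i, (p i).coeff n = 0) ∧ (p i).coeff (v i) = 1 ∧ ∀ j ≠ i, (p j).coeff (v i) = 0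

section Tuple

variable {K : Type*} [Field K] {F : Type*} [Field F] [Algebra K F]
  (b : ℕ+) (r : ℕ) (l : ℕ → Polynomial K)

/-- The generalized series `e_lam * p_j(x^(1/q)) * ∏_{k ≥ 0} 1/g(x^(b^k/q))`, where `q` is the
ramification bound with respect to `lam`. -/
def ClassData.series (d : ClassData F) (j : Fin d.s) : DRing F :=
  MonoidAlgebra.single d.lam
    (laurentPolyAt 1 (ramBound b r l (d.lam : F)) (d.p j)
      * powerSeriesAt 1 (ramBound b r l (d.lam : F)) (infProd b d.g))

/-- The tuple is the normal form of the class `H`: `s > 0`, `g(0) = 1`, the above series form a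
basis of the vector space obtained by adjoining `0` to `H`, the family `(p_j)` is in reduced
echelon form, and the `p_j` are coprime. -/
structure ClassData.Represents (d : ClassData F) (H : Set (DRing F)) : Prop where
  s_pos : 0 < d.s
  g_zero : RatFunc.eval (RingHom.id F) 0 d.g = 1
  linearIndependent : LinearIndependent F (d.series b r l)
  span_eq : (Submodule.span F (Set.range (d.series b r l)) : Set (DRing F)) = insert 0 H
  echelon : IsReducedEchelon d.p
  coprime : ∀ c : LaurentPolynomial F, (∀ j, c ∣ d.p j) → IsUnit c

/-- The pairs `(lam, g)` extracted from the tuples of all similarity classes. -/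
def classIndices (F : Type*) [Field F] [Algebra K F] : Set (Fˣ × RatFunc F) :=
  {i | ∃ H ∈ simClasses F b r l, ∃ d : ClassData F, d.Represents b r l H ∧ (d.lam, d.g) = i}

/-- The elements of the similarity class(es) whose tuple starts with the given pair `(lam, g)`. -/
def classOf (i : Fˣ × RatFunc F) : Set (DRing F) :=
  {y | ∃ H ∈ simClasses F b r l, y ∈ H ∧
    ∃ d : ClassData F, d.Represents b r l H ∧ (d.lam, d.g) = i}

/-- `∑_j c_j p_j(x^(m/q))`, where `q` is the ramification bound with respect to `lam`. -/
def ClassData.combination (d : ClassData F) (m : ℕ+) (c : Fin d.s → F) : Puiseux F :=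
  ∑ j, c j • laurentPolyAt m (ramBound b r l (d.lam : F)) (d.p j)

end Tuple

end

end Mahler

namespace Mahler

noncomputable section

section Coefficients

variable {F : Type*} [Field F]

/-! ### Coefficients of Puiseux series -/

/-! The theorem rests on a dictionary between solutions `u` of the Riccati equation and
hypergeometric solutions `y` of (L) up to constants, via `My = uy`. If `My = uy`, then `L y` is `y`
times the left side of (R) at `u` (`twistedOp_eq_riccati_mul`). A nonzero ramified rational `u = c
x^a f` with `f(0) = 1` equals `My/y` for `y = e_c x^(a/(b-1)) ∏ 1/M^k f` (`exists_mahlerP_eq`).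
Since `M` multiplies orders by `b` and keeps leading coefficients, the Puiseux series that it fixes
are the constants. Hence `y` has a single component `e_λ p` and is determined by `u` up to a
constant (`exists_single_of_mahler_eq`, `exists_smul_of_mahler_eq`).

Ramification is bounded by `q_λ` (`hasRamification_ramBound`). The equation itself removes from the
ramification of `p` every factor shared with `b`. The part of `p` with exponents of a fixed
denominator is then again a solution, and the leading term of a solution lies on an admissible edge
of slope minus its order (`exists_isAdmissible`).

The class of `e_λ p`, with `0`, is therefore `e_λ V p` for a space `V` of rational functions in
`x^(1/q_λ)` (`simClass_eq_map`), of finite dimension. Write a basis of `V` as a common factor times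
coprime polynomials, and put that factor into `p`. Once its leading monomial is removed, the new
cofactor `w` has `Mw/w = g(x^(1/q_λ))` with `g(0) = 1`, so it is the infinite product. The
numerators have a unique reduced echelon basis (`exists_represents`). Two cofactors of the same
class differ by a rational function that coprimality forces to be a monomial, and normalisation
forces to be `1` (`ClassData.Represents.unique`).

A Casoratian argument shows that `F`-independent solutions `e_λ p` number at most `r`
(`card_le_of_linearIndependent`). Dissimilar hypergeometric elements are independent over the
ramified rational functions (`smul_eq_zero_of_sum_eq_zero`), so the bases of all classes together
are independent. This gives both the finiteness of `I` and the bound (3). Finally `y ↦ My/y`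
identifies lines of the solution space `H ∪ {0}` with elements of its image, whence the
parametrisation by a projective space. -/

theorem puiseux_ext {y z : Puiseux F} (h : ∀ a, y.1.coeff a = z.1.coeff a) : y = z :=
  Subtype.ext (HahnSeries.ext (funext h))

theorem coeff_hahnSubst (m q : ℕ+) (y : HahnSeries ℚ F) (a : ℚ) :
    (hahnSubst F m q y).coeff a = y.coeff (a * q / m) := by
  have hm : (m : ℚ) ≠ 0 := by exact_mod_cast m.ne_zero
  have hq : (q : ℚ) ≠ 0 := by exact_mod_cast q.ne_zero
  have h : (hahnSubst F m q y).coeff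
      (AddMonoidHom.mulLeft ((m : ℚ) / (q : ℚ)) (a * q / m)) = y.coeff (a * q / m) :=
    HahnSeries.embDomain_mk_coeff _ _
  rw [← h]
  congr 1
  change a = (m : ℚ) / q * (a * q / m)
  field_simp

theorem coeff_subst (m q : ℕ+) (y : Puiseux F) (a : ℚ) :
    (subst F m q y).1.coeff a = y.1.coeff (a * q / m) :=
  coeff_hahnSubst m q y.1 a

theorem coeff_mahlerP (b : ℕ+) (y : Puiseux F) (a : ℚ) :
    (mahlerP F b y).1.coeff a = y.1.coeff (a / b) := by
  simp [mahlerP, coeff_subst]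

theorem coeff_laurentToHahn (f : LaurentSeries F) (n : ℤ) :
    (laurentToHahn F f).coeff (n : ℚ) = f.coeff n :=
  HahnSeries.embDomain_mk_coeff (f := (Int.castAddHom ℚ)) Int.cast_injective
    (fun _ _ => Int.cast_le)

theorem coeff_ofLaurent (f : LaurentSeries F) (n : ℤ) :
    (ofLaurent F f).1.coeff (n : ℚ) = f.coeff n := coeff_laurentToHahn f n

theorem coeff_ofLaurent_eq_zero (f : LaurentSeries F) {a : ℚ} (ha : ∀ n : ℤ, a ≠ n) :
    (ofLaurent F f).1.coeff a = 0 := by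
  by_contra h
  obtain ⟨n, rfl⟩ := laurentToHahn_support f h
  exact ha n rfl

theorem subst_mahlerP (b m q : ℕ+) (y : Puiseux F) :
    mahlerP F b (subst F m q y) = subst F (b * m) q y := by
  refine puiseux_ext fun a => ?_
  rw [coeff_mahlerP, coeff_subst, coeff_subst]
  congr 1
  push_cast
  field_simp

/-- The monomial `c * x^a`. -/
def monomialP (a : ℚ) (c : F) : Puiseux F :=
  ⟨HahnSeries.single a c, a.pnatDen, fun e he => by
    obtain rfl := HahnSeries.eq_of_mem_support_single he
    exact ⟨e.num, by simp [Rat.num_div_den]⟩⟩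

theorem coeff_monomialP (a e : ℚ) (c : F) :
    (monomialP a c).1.coeff e = if e = a then c else 0 := by
  change (HahnSeries.single a c).coeff e = _
  split_ifs with h
  · rw [h, HahnSeries.coeff_single_same]
  · exact HahnSeries.coeff_single_of_ne h

theorem monomialP_mul (a a' : ℚ) (c c' : F) :
    monomialP a c * monomialP a' c' = monomialP (a + a') (c * c') :=
  Subtype.ext HahnSeries.single_mul_single

theorem algebraMap_eq_monomialP (c : F) : algebraMap F (Puiseux F) c = monomialP 0 c := rfl

theorem monomialP_ne_zero {a : ℚ} {c : F} (hc : c ≠ 0) : monomialP a c ≠ 0 := by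
  intro h
  have := congrArg (fun y : Puiseux F => y.1.coeff a) h
  simp [coeff_monomialP] at this
  exact hc this

theorem coeff_monomialP_mul (a e : ℚ) (c : F) (y : Puiseux F) :
    (monomialP a c * y).1.coeff e = c * y.1.coeff (e - a) := by
  have := HahnSeries.coeff_single_mul_add (r := c) (x := y.1) (a := e - a) (b := a)
  rw [sub_add_cancel] at this
  exact this

theorem coeff_algebraMap_mul (c : F) (y : Puiseux F) (e : ℚ) :
    (algebraMap F (Puiseux F) c * y).1.coeff e = c * y.1.coeff e := by
  rw [algebraMap_eq_monomialP, coeff_monomialP_mul, sub_zero]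

theorem coeff_smul (c : F) (y : Puiseux F) (e : ℚ) : (c • y).1.coeff e = c * y.1.coeff e := by
  rw [Algebra.smul_def, coeff_algebraMap_mul]

theorem subst_monomialP (m q : ℕ+) (a : ℚ) (c : F) :
    subst F m q (monomialP a c) = monomialP (m / q * a) c := by
  have hm : (m : ℚ) ≠ 0 := by exact_mod_cast m.ne_zero
  have hq : (q : ℚ) ≠ 0 := by exact_mod_cast q.ne_zero
  refine puiseux_ext fun e => ?_
  rw [coeff_subst, coeff_monomialP, coeff_monomialP]
  congr 1
  rw [eq_iff_iff]
  constructor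
  · rintro rfl; field_simp
  · rintro rfl; field_simp

theorem subst_algebraMap (m q : ℕ+) (c : F) :
    subst F m q (algebraMap F _ c) = algebraMap F _ c := by
  rw [algebraMap_eq_monomialP, subst_monomialP, mul_zero]

theorem mahlerP_algebraMap (b : ℕ+) (c : F) :
    mahlerP F b (algebraMap F _ c) = algebraMap F _ c := subst_algebraMap b 1 c

theorem mahlerP_smul (b : ℕ+) (c : F) (y : Puiseux F) :
    mahlerP F b (c • y) = c • mahlerP F b y := by
  rw [Algebra.smul_def, map_mul, mahlerP_algebraMap, Algebra.smul_def]

/-! ### Order and leading coefficient -/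

/-- The order of a Puiseux series. -/
def ordP (y : Puiseux F) : ℚ := y.1.order

/-- The leading coefficient of a Puiseux series. -/
def lcP (y : Puiseux F) : F := y.1.coeff (ordP y)

theorem lcP_ne_zero {y : Puiseux F} (hy : y ≠ 0) : lcP y ≠ 0 := by
  intro h
  exact hy (Subtype.ext (HahnSeries.coeff_order_eq_zero.1 h))

theorem coeff_eq_zero_of_lt {y : Puiseux F} {a : ℚ} (h : a < ordP y) : y.1.coeff a = 0 :=
  HahnSeries.coeff_eq_zero_of_lt_order h

theorem ordP_le {y : Puiseux F} {a : ℚ} (h : y.1.coeff a ≠ 0) : ordP y ≤ a :=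
  HahnSeries.order_le_of_coeff_ne_zero h

theorem ordP_eq {y : Puiseux F} {a : ℚ} (h : y.1.coeff a ≠ 0) (h' : ∀ e < a, y.1.coeff e = 0) :
    ordP y = a := by
  refine le_antisymm (ordP_le h) (le_of_not_gt fun hlt => ?_)
  have hy : y ≠ 0 := by rintro rfl; exact h rfl
  exact lcP_ne_zero hy (h' _ hlt)

theorem ordP_mul {y z : Puiseux F} (hy : y ≠ 0) (hz : z ≠ 0) : ordP (y * z) = ordP y + ordP z :=
  HahnSeries.order_mul (fun h => hy (Subtype.ext h)) (fun h => hz (Subtype.ext h))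

theorem lcP_mul (y z : Puiseux F) : lcP (y * z) = lcP y * lcP z := by
  have := HahnSeries.leadingCoeff_mul y.1 z.1
  rw [HahnSeries.leadingCoeff_eq, HahnSeries.leadingCoeff_eq, HahnSeries.leadingCoeff_eq] at this
  exact this

theorem ordP_subst (m q : ℕ+) {y : Puiseux F} (hy : y ≠ 0) :
    ordP (subst F m q y) = m / q * ordP y := by
  have hm : (0 : ℚ) < m := by exact_mod_cast m.pos
  have hq : (0 : ℚ) < q := by exact_mod_cast q.pos
  apply ordP_eq
  · rw [coeff_subst]
    have : (m : ℚ) / q * ordP y * q / m = ordP y := by field_simp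
    rw [this]
    exact lcP_ne_zero hy
  · intro e he
    rw [coeff_subst]
    apply coeff_eq_zero_of_lt
    rw [div_lt_iff₀ hm]
    rw [div_mul_eq_mul_div, lt_div_iff₀ hq] at he
    linarith

theorem lcP_subst (m q : ℕ+) {y : Puiseux F} (hy : y ≠ 0) :
    lcP (subst F m q y) = lcP y := by
  have hm : (0 : ℚ) < m := by exact_mod_cast m.pos
  have hq : (0 : ℚ) < q := by exact_mod_cast q.pos
  rw [lcP, ordP_subst m q hy, coeff_subst, lcP]
  have : (m : ℚ) / q * ordP y * q / m = ordP y := by field_simp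
  rw [this]

theorem ordP_mahlerP (b : ℕ+) {y : Puiseux F} (hy : y ≠ 0) :
    ordP (mahlerP F b y) = b * ordP y := by
  rw [mahlerP, ordP_subst b 1 hy]; simp

theorem lcP_mahlerP (b : ℕ+) {y : Puiseux F} (hy : y ≠ 0) : lcP (mahlerP F b y) = lcP y :=
  lcP_subst b 1 hy

theorem ordP_algebraMap {c : F} (hc : c ≠ 0) : ordP (algebraMap F (Puiseux F) c) = 0 :=
  HahnSeries.order_single hc

theorem lcP_algebraMap (c : F) : lcP (algebraMap F (Puiseux F) c) = c := by
  rcases eq_or_ne c 0 with rfl | hc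
  · simp [lcP]
  · rw [lcP, ordP_algebraMap hc, algebraMap_eq_monomialP, coeff_monomialP, if_pos rfl]

/-- Subtract the constant term: a nonzero remainder would still be fixed, so its order `v` satisfies
`v = b v`, that is `v = 0`, where its coefficient vanishes. -/
theorem eq_algebraMap_of_mahlerP_eq {b : ℕ+} (hb : 2 ≤ b) {y : Puiseux F}
    (h : mahlerP F b y = y) : ∃ c, y = algebraMap F _ c := by
  refine ⟨y.1.coeff 0, ?_⟩
  by_contra hne
  have hz : y - algebraMap F _ (y.1.coeff 0) ≠ 0 := sub_ne_zero.2 hne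
  have h1 := ordP_mahlerP b hz
  rw [map_sub, h, mahlerP_algebraMap] at h1
  have hb' : (2 : ℚ) ≤ b := by exact_mod_cast hb
  have h0 : ordP (y - algebraMap F _ (y.1.coeff 0)) = 0 := by nlinarith
  apply lcP_ne_zero hz
  rw [lcP, h0]
  change y.1.coeff 0 - (algebraMap F (Puiseux F) (y.1.coeff 0)).1.coeff 0 = 0
  rw [algebraMap_eq_monomialP, coeff_monomialP, if_pos rfl, sub_self]

/-- `M` preserves leading coefficients, which forces `c = c'`; what remains is a fixed point of `M`.
-/
theorem eq_algebraMap_of_mahlerP_eq_mul {b : ℕ+} (hb : 2 ≤ b) {y : Puiseux F} (hy : y ≠ 0)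
    {c c' : F} (hc : c ≠ 0)
    (h : algebraMap F _ c * mahlerP F b y = algebraMap F _ c' * y) :
    c = c' ∧ ∃ e, y = algebraMap F _ e := by
  have hl := congrArg lcP h
  rw [lcP_mul, lcP_mul, lcP_algebraMap, lcP_algebraMap, lcP_mahlerP b hy] at hl
  obtain rfl := mul_right_cancel₀ (lcP_ne_zero hy) hl
  refine ⟨rfl, eq_algebraMap_of_mahlerP_eq hb (mul_left_cancel₀ ?_ h)⟩
  simpa using hc

end Coefficients

/-! ### Linear Mahler operators on Puiseux series -/

section Operator

variable {K : Type*} [Field K] {F : Type*} [Field F] [Algebra K F]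
  (b : ℕ+) (r : ℕ) (l : ℕ → Polynomial K)

theorem coeff_mahler (y : DRing F) (lam : Fˣ) :
    (mahler F b y).coeff lam = algebraMap F _ (lam : F) * mahlerP F b (y.coeff lam) := by
  classical
  induction y using MonoidAlgebra.induction_linear with
  | zero => simp
  | add y z hy hz => simp [hy, hz, mul_add]
  | single m p =>
    rw [mahler_single, MonoidAlgebra.coeff_single, MonoidAlgebra.coeff_single, Finsupp.single_apply,
      Finsupp.single_apply]
    split_ifs with h
    · rw [h]
    · simp

theorem mahler_iterate_single (k : ℕ) (lam : Fˣ) (p : Puiseux F) :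
    (mahler F b)^[k] (MonoidAlgebra.single lam p)
      = MonoidAlgebra.single lam (algebraMap F _ (lam : F) ^ k * (mahlerP F b)^[k] p) := by
  induction k with
  | zero => simp
  | succ k ih =>
    rw [Function.iterate_succ_apply', ih, mahler_single, map_mul, map_pow, mahlerP_algebraMap,
      Function.iterate_succ_apply', pow_succ']
    ring_nf

/-- The operator `∑ k, l_k lam^k M^k` on Puiseux series, conjugate to `L` by `e_lam`. -/
def twistedOp (lam : F) : Puiseux F →ₗ[F] Puiseux F where
  toFun p := ∑ k ∈ Finset.range (r + 1),
    polyCoeff F (l k) * (algebraMap F _ lam ^ k * (mahlerP F b)^[k] p)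
  map_add' p p' := by
    simp only [iterate_map_add, mul_add, Finset.sum_add_distrib]
  map_smul' c p := by
    have h : ∀ k, (mahlerP F b)^[k] (c • p) = c • (mahlerP F b)^[k] p := by
      intro k
      induction k with
      | zero => rfl
      | succ k ih => simp only [Function.iterate_succ_apply', ih, mahlerP_smul]
    simp only [h, mul_smul_comm, Finset.smul_sum, RingHom.id_apply]

theorem twistedOp_apply (lam : F) (p : Puiseux F) :
    twistedOp b r l lam p = ∑ k ∈ Finset.range (r + 1),
      polyCoeff F (l k) * (algebraMap F _ lam ^ k * (mahlerP F b)^[k] p) := rfl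

theorem applyL_single (lam : Fˣ) (p : Puiseux F) :
    applyL F b r l (MonoidAlgebra.single lam p)
      = MonoidAlgebra.single lam (twistedOp b r l (lam : F) p) := by
  simp only [applyL, mahler_iterate_single, MonoidAlgebra.smul_single, smul_eq_mul,
    twistedOp_apply]
  exact (map_sum (MonoidAlgebra.singleAddHom lam) _ _).symm

theorem applyL_single_eq_zero_iff (lam : Fˣ) (p : Puiseux F) :
    applyL F b r l (MonoidAlgebra.single lam p) = 0 ↔ twistedOp b r l (lam : F) p = 0 := by
  rw [applyL_single, MonoidAlgebra.single_eq_zero]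

end Operator

/-! ### Ring homomorphisms from rational functions and Laurent polynomials -/

section Hom

variable {F : Type*} [Field F]

open scoped RatFunc in
/-- `f ↦ f(x^(m/q))` as a ring homomorphism on rational functions. -/
def ratHom (F : Type*) [Field F] (m q : ℕ+) : RatFunc F →+* Puiseux F :=
  ((subst F m q).comp (ofLaurent F)).comp (algebraMap (RatFunc F) (LaurentSeries F))

theorem ratAt_eq (m q : ℕ+) (f : RatFunc F) : ratAt m q f = ratHom F m q f := rfl

theorem ofLaurent_single (n : ℤ) (c : F) :
    ofLaurent F (HahnSeries.single n c) = monomialP (n : ℚ) c := by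
  refine puiseux_ext fun a => ?_
  rw [coeff_monomialP]
  by_cases h : ∃ k : ℤ, a = k
  · obtain ⟨k, rfl⟩ := h
    rw [coeff_ofLaurent]
    split_ifs with hk
    · obtain rfl : k = n := by exact_mod_cast hk
      simp
    · exact HahnSeries.coeff_single_of_ne (by rintro rfl; exact hk rfl)
  · push Not at h
    rw [coeff_ofLaurent_eq_zero _ h, if_neg (h n)]

open scoped RatFunc in
theorem ratHom_X (m q : ℕ+) : ratHom F m q RatFunc.X = monomialP (m / q : ℚ) 1 := by
  have : algebraMap (RatFunc F) (LaurentSeries F) RatFunc.X = HahnSeries.single 1 1 :=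
    RatFunc.coe_X
  simp [ratHom, this, ofLaurent_single, subst_monomialP]

open scoped RatFunc in
theorem ratHom_polynomial (m q : ℕ+) (P : Polynomial F) :
    ratHom F m q (algebraMap _ _ P)
      = subst F m q (ofLaurent F (HahnSeries.ofPowerSeries ℤ F (P : PowerSeries F))) := by
  have : algebraMap (RatFunc F) (LaurentSeries F) (algebraMap _ _ P)
      = HahnSeries.ofPowerSeries ℤ F (P : PowerSeries F) := (RatFunc.coe_coe P).symm
  simp [ratHom, this]

theorem ratHom_C (m q : ℕ+) (c : F) : ratHom F m q (RatFunc.C c) = algebraMap F _ c := by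
  rw [← RatFunc.algebraMap_C, ratHom_polynomial, Polynomial.coe_C]
  have : HahnSeries.ofPowerSeries ℤ F (PowerSeries.C c) = HahnSeries.single 0 c := by
    rw [HahnSeries.ofPowerSeries_C]; rfl
  rw [this, ofLaurent_single, subst_monomialP]
  simp [algebraMap_eq_monomialP]

theorem ratHom_ext {φ ψ : RatFunc F →+* Puiseux F} (hC : ∀ c, φ (RatFunc.C c) = ψ (RatFunc.C c))
    (hX : φ RatFunc.X = ψ RatFunc.X) : φ = ψ := by
  refine IsLocalization.ringHom_ext (nonZeroDivisors (Polynomial F)) ?_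
  refine Polynomial.ringHom_ext (fun c => ?_) ?_
  · simpa using hC c
  · simpa using hX

theorem mahlerP_ratHom (b m q : ℕ+) (f : RatFunc F) :
    mahlerP F b (ratHom F m q f) = ratHom F (b * m) q f :=
  subst_mahlerP b m q _

theorem monomialP_pow (a : ℚ) (n : ℕ) : (monomialP a (1 : F)) ^ n = monomialP (n * a) 1 := by
  induction n with
  | zero => simp; rfl
  | succ n ih =>
    rw [pow_succ, ih, monomialP_mul, mul_one]
    congr 1
    push_cast; ring

/-- The homomorphism `f(x) ↦ f(x^n)` of rational functions. -/
def expandRat (F : Type*) [Field F] (n : ℕ+) : RatFunc F →+* RatFunc F :=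
  RatFunc.mapRingHom (Polynomial.expand F n).toRingHom (by
    intro P hP
    rw [mem_nonZeroDivisors_iff_ne_zero] at hP
    rw [Submonoid.mem_comap, mem_nonZeroDivisors_iff_ne_zero]
    exact (Polynomial.expand_ne_zero n.pos).2 hP)

theorem expandRat_algebraMap (n : ℕ+) (P : Polynomial F) :
    expandRat F n (algebraMap _ _ P) = algebraMap _ _ (Polynomial.expand F n P) := by
  have := RatFunc.map_apply_div (Polynomial.expand F n).toRingHom (by
    intro P hP
    rw [mem_nonZeroDivisors_iff_ne_zero] at hP
    rw [Submonoid.mem_comap, mem_nonZeroDivisors_iff_ne_zero]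
    exact (Polynomial.expand_ne_zero n.pos).2 hP) P 1
  simp only [map_one, div_one] at this
  exact this

theorem ratHom_expandRat (n m q : ℕ+) (f : RatFunc F) :
    ratHom F m q (expandRat F n f) = ratHom F (n * m) q f := by
  have : (ratHom F m q).comp (expandRat F n) = ratHom F (n * m) q := by
    refine ratHom_ext (fun c => ?_) ?_
    · have : expandRat F n (RatFunc.C c) = RatFunc.C c := by
        rw [← RatFunc.algebraMap_C, expandRat_algebraMap, Polynomial.expand_C]
      simp [this, ratHom_C]
    · have : expandRat F n RatFunc.X = RatFunc.X ^ (n : ℕ) := by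
        rw [← RatFunc.algebraMap_X, expandRat_algebraMap, Polynomial.expand_X, map_pow]
      rw [RingHom.comp_apply, this, map_pow, ratHom_X, ratHom_X, monomialP_pow]
      congr 1
      push_cast; ring
  exact DFunLike.congr_fun this f

/-- Used to bring two ramified rational functions to a common ramification. -/
theorem ratHom_mul_left (n m q : ℕ+) (f : RatFunc F) :
    ratHom F (n * m) (n * q) f = ratHom F m q f := by
  have : ratHom F (n * m) (n * q) = ratHom F m q := by
    refine ratHom_ext (fun c => by rw [ratHom_C, ratHom_C]) ?_
    rw [ratHom_X, ratHom_X]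
    congr 1
    have hn : (n : ℚ) ≠ 0 := by exact_mod_cast n.ne_zero
    have hq : (q : ℚ) ≠ 0 := by exact_mod_cast q.ne_zero
    push_cast
    field_simp
  rw [this]

theorem ratHom_mem (m q : ℕ+) (f : RatFunc F) : ratHom F m q f ∈ ramRat F :=
  ⟨q, expandRat F m f, by rw [ratAt_eq, ratHom_expandRat, mul_one]⟩

/-- The field of ramified rational functions. -/
def ramRatField (F : Type*) [Field F] : Subfield (Puiseux F) where
  carrier := ramRat F
  mul_mem' := by
    rintro _ _ ⟨q, f, rfl⟩ ⟨q', f', rfl⟩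
    simp only [ratAt_eq]
    -- Both factors become rational functions of `x^(1/(q' q))`, where they can be multiplied.
    rw [← ratHom_mul_left q' 1 q, ← ratHom_mul_left q 1 q', mul_comm q' q,
      ← ratHom_expandRat, ← ratHom_expandRat q 1, ← map_mul]
    exact ratHom_mem _ _ _
  one_mem' := ⟨1, 1, by simp [ratAt_eq]⟩
  add_mem' := by
    rintro _ _ ⟨q, f, rfl⟩ ⟨q', f', rfl⟩
    simp only [ratAt_eq]
    rw [← ratHom_mul_left q' 1 q, ← ratHom_mul_left q 1 q', mul_comm q' q,
      ← ratHom_expandRat, ← ratHom_expandRat q 1, ← map_add]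
    exact ratHom_mem _ _ _
  zero_mem' := ⟨1, 0, by simp [ratAt_eq]⟩
  neg_mem' := by
    rintro _ ⟨q, f, rfl⟩
    exact ⟨q, -f, by simp [ratAt_eq]⟩
  inv_mem' := by
    rintro _ ⟨q, f, rfl⟩
    exact ⟨q, f⁻¹, by simp [ratAt_eq]⟩

theorem algebraMap_mem_ramRat (c : F) : algebraMap F _ c ∈ ramRatField F :=
  ⟨1, RatFunc.C c, by rw [ratAt_eq, ratHom_C]⟩

theorem mahlerP_mem_ramRat (b : ℕ+) {y : Puiseux F} (hy : y ∈ ramRatField F) :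
    mahlerP F b y ∈ ramRatField F := by
  obtain ⟨q, f, rfl⟩ := hy
  rw [ratAt_eq, mahlerP_ratHom]
  exact ratHom_mem _ _ _

/-! ### Laurent polynomials -/

theorem laurentPolyAt_single (m q : ℕ+) (n : ℤ) (c : F) :
    laurentPolyAt m q (AddMonoidAlgebra.single n c) = monomialP (m / q * n : ℚ) c := by
  have : HahnSeries.ofFinsupp (AddMonoidAlgebra.single n c : LaurentPolynomial F).coeff
      = HahnSeries.single n c := by
    ext a
    by_cases h : a = n
    · subst h
      rw [HahnSeries.coeff_ofFinsupp, HahnSeries.coeff_single_same, AddMonoidAlgebra.coeff_single,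
        Finsupp.single_eq_same]
    · rw [HahnSeries.coeff_ofFinsupp, HahnSeries.coeff_single_of_ne h,
        AddMonoidAlgebra.coeff_single, Finsupp.single_eq_of_ne h]
  rw [laurentPolyAt, this, ofLaurent_single, subst_monomialP]

theorem laurentPolyAt_add (m q : ℕ+) (p p' : LaurentPolynomial F) :
    laurentPolyAt m q (p + p') = laurentPolyAt m q p + laurentPolyAt m q p' := by
  have : HahnSeries.ofFinsupp (p + p').coeff
      = (HahnSeries.ofFinsupp p.coeff + HahnSeries.ofFinsupp p'.coeff : LaurentSeries F) := by
    ext a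
    simp [HahnSeries.coeff_ofFinsupp]
  rw [laurentPolyAt, this, map_add, map_add]; rfl

/-- `p ↦ p(x^(m/q))` as a ring homomorphism on Laurent polynomials. -/
def laurentHom (F : Type*) [Field F] (m q : ℕ+) : LaurentPolynomial F →+* Puiseux F where
  toFun := laurentPolyAt m q
  map_zero' := by
    have := laurentPolyAt_add m q (0 : LaurentPolynomial F) 0
    simpa using this
  map_add' := laurentPolyAt_add m q
  map_one' := by
    rw [AddMonoidAlgebra.one_def, laurentPolyAt_single]
    simp; rfl
  map_mul' p p' := by
    have h0 : laurentPolyAt m q (0 : LaurentPolynomial F) = 0 := by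
      have := laurentPolyAt_add m q (0 : LaurentPolynomial F) 0
      simpa using this
    induction p using AddMonoidAlgebra.induction_linear with
    | zero => simp [h0]
    | add x y hx hy => simp only [add_mul, laurentPolyAt_add, hx, hy]
    | single n c =>
      induction p' using AddMonoidAlgebra.induction_linear with
      | zero => simp [h0]
      | add x y hx hy => simp only [mul_add, laurentPolyAt_add, hx, hy]
      | single n' c' =>
        rw [AddMonoidAlgebra.single_mul_single, laurentPolyAt_single, laurentPolyAt_single,
          laurentPolyAt_single, monomialP_mul]
        congr 1
        push_cast; ring

theorem laurentPolyAt_eq (m q : ℕ+) (p : LaurentPolynomial F) :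
    laurentPolyAt m q p = laurentHom F m q p := rfl

theorem mahlerP_laurentHom (b m q : ℕ+) (p : LaurentPolynomial F) :
    mahlerP F b (laurentHom F m q p) = laurentHom F (b * m) q p :=
  subst_mahlerP b m q _

theorem coeff_laurentHom (q : ℕ+) (p : LaurentPolynomial F) (n : ℤ) :
    (laurentHom F 1 q p).1.coeff (n / q : ℚ) = p.coeff n := by
  change (subst F 1 q _).1.coeff _ = _
  have hq : (q : ℚ) ≠ 0 := by exact_mod_cast q.ne_zero
  rw [coeff_subst, show (n / q : ℚ) * q / ((1 : ℕ+) : ℚ) = n by simp, coeff_ofLaurent]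
  rfl

theorem laurentHom_injective (q : ℕ+) : Function.Injective (laurentHom F 1 q) := by
  intro p p' h
  ext n
  rw [← coeff_laurentHom q, h, coeff_laurentHom]

theorem laurentHom_toLaurent (m q : ℕ+) (P : Polynomial F) :
    laurentHom F m q (Polynomial.toLaurent P) = ratHom F m q (algebraMap _ _ P) := by
  have : (laurentHom F m q).comp Polynomial.toLaurent
      = (ratHom F m q).comp (algebraMap _ _) := by
    refine Polynomial.ringHom_ext (fun c => ?_) ?_
    · simp only [RingHom.comp_apply, Polynomial.toLaurent_C, RatFunc.algebraMap_C, ratHom_C]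
      rw [← LaurentPolynomial.single_eq_C, ← laurentPolyAt_eq, laurentPolyAt_single]
      simp [algebraMap_eq_monomialP]
    · simp only [RingHom.comp_apply, Polynomial.toLaurent_X, RatFunc.algebraMap_X, ratHom_X]
      rw [LaurentPolynomial.T, ← laurentPolyAt_eq, laurentPolyAt_single]
      simp
  exact DFunLike.congr_fun this P

theorem laurentHom_smul (m q : ℕ+) (c : F) (p : LaurentPolynomial F) :
    laurentHom F m q (c • p) = c • laurentHom F m q p := by
  rw [LaurentPolynomial.smul_eq_C_mul, map_mul, ← Polynomial.toLaurent_C, laurentHom_toLaurent,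
    RatFunc.algebraMap_C, ratHom_C, Algebra.smul_def]

end Hom

/-! ### Coefficients of the equation -/

section PolyCoeff

variable {K : Type*} [Field K] {F : Type*} [Field F] [Algebra K F]

theorem coeff_powerSeriesAt (q : ℕ+) (s : PowerSeries F) (n : ℕ) :
    (powerSeriesAt 1 q s).1.coeff ((n : ℚ) / q) = PowerSeries.coeff n s := by
  have hq : (q : ℚ) ≠ 0 := by exact_mod_cast q.ne_zero
  rw [powerSeriesAt, coeff_subst,
    show (n / q : ℚ) * q / ((1 : ℕ+) : ℚ) = ((n : ℤ) : ℚ) by simp [hq], coeff_ofLaurent]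
  exact HahnSeries.ofPowerSeries_apply_coeff s n

theorem coeff_powerSeriesAt_eq_zero (q : ℕ+) (s : PowerSeries F) {a : ℚ}
    (ha : ∀ n : ℕ, a ≠ (n : ℚ) / q) : (powerSeriesAt 1 q s).1.coeff a = 0 := by
  have hq : (q : ℚ) ≠ 0 := by exact_mod_cast q.ne_zero
  rw [powerSeriesAt, coeff_subst]
  by_cases h : ∃ k : ℤ, a * q = k
  · obtain ⟨k, hk⟩ := h
    simp only [PNat.val_ofNat, Nat.cast_one, div_one, hk]
    rw [coeff_ofLaurent, HahnSeries.ofPowerSeries_apply]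
    refine HahnSeries.embDomain_notin_image_support ?_
    rintro ⟨n, -, rfl⟩
    apply ha n
    rw [eq_div_iff hq, hk]
    simp
  · push Not at h
    apply coeff_ofLaurent_eq_zero
    simpa using h

theorem ratHom_polynomial_eq_powerSeriesAt (m q : ℕ+) (P : Polynomial F) :
    ratHom F m q (algebraMap _ _ P) = powerSeriesAt m q (P : PowerSeries F) :=
  ratHom_polynomial m q P

theorem coeff_ratHom_polynomial (q : ℕ+) (P : Polynomial F) (n : ℕ) :
    (ratHom F 1 q (algebraMap _ _ P)).1.coeff ((n : ℚ) / q) = P.coeff n := by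
  rw [ratHom_polynomial_eq_powerSeriesAt, coeff_powerSeriesAt, Polynomial.coeff_coe]

theorem coeff_ratHom_polynomial_eq_zero (q : ℕ+) (P : Polynomial F) {a : ℚ}
    (ha : ∀ n : ℕ, a ≠ (n : ℚ) / q) : (ratHom F 1 q (algebraMap _ _ P)).1.coeff a = 0 := by
  rw [ratHom_polynomial_eq_powerSeriesAt, coeff_powerSeriesAt_eq_zero q _ ha]

theorem ordP_ratHom_polynomial (q : ℕ+) {P : Polynomial F} (hP : P ≠ 0) :
    ordP (ratHom F 1 q (algebraMap _ _ P)) = P.natTrailingDegree / q := by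
  have hq : (0 : ℚ) < q := by exact_mod_cast q.pos
  apply ordP_eq
  · rw [coeff_ratHom_polynomial]
    simpa using hP
  · intro e he
    by_cases h : ∃ n : ℕ, e = (n : ℚ) / q
    · obtain ⟨n, rfl⟩ := h
      rw [div_lt_div_iff_of_pos_right hq] at he
      rw [coeff_ratHom_polynomial, Polynomial.coeff_eq_zero_of_lt_natTrailingDegree (by exact_mod_cast he)]
    · exact coeff_ratHom_polynomial_eq_zero q P (by simpa using h)

theorem lcP_ratHom_polynomial (q : ℕ+) {P : Polynomial F} (hP : P ≠ 0) :
    lcP (ratHom F 1 q (algebraMap _ _ P)) = P.trailingCoeff := by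
  rw [lcP, ordP_ratHom_polynomial q hP, coeff_ratHom_polynomial]; rfl

theorem coeff_polyCoeff (P : Polynomial K) (n : ℕ) :
    (polyCoeff F P).1.coeff (n : ℚ) = algebraMap K F (P.coeff n) := by
  have := coeff_ratHom_polynomial 1 (P.map (algebraMap K F)) n
  simpa [polyCoeff, ratAt_eq] using this

theorem coeff_polyCoeff_eq_zero (P : Polynomial K) {a : ℚ} (ha : ∀ n : ℕ, a ≠ n) :
    (polyCoeff F P).1.coeff a = 0 :=
  coeff_ratHom_polynomial_eq_zero 1 _ (by simpa using ha)

theorem polyCoeff_zero : polyCoeff F (0 : Polynomial K) = 0 := by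
  simp [polyCoeff, ratAt_eq]

theorem ordP_polyCoeff {P : Polynomial K} (hP : P ≠ 0) :
    ordP (polyCoeff F P) = P.natTrailingDegree := by
  apply ordP_eq
  · rw [coeff_polyCoeff]
    simpa using hP
  · intro e he
    by_cases h : ∃ n : ℕ, e = n
    · obtain ⟨n, rfl⟩ := h
      rw [coeff_polyCoeff, Polynomial.coeff_eq_zero_of_lt_natTrailingDegree (by exact_mod_cast he),
        map_zero]
    · exact coeff_polyCoeff_eq_zero P (by simpa using h)

theorem lcP_polyCoeff {P : Polynomial K} (hP : P ≠ 0) :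
    lcP (polyCoeff F P) = algebraMap K F P.trailingCoeff := by
  rw [lcP, ordP_polyCoeff hP, coeff_polyCoeff]; rfl

theorem polyCoeff_ne_zero {P : Polynomial K} (hP : P ≠ 0) : polyCoeff F P ≠ 0 := by
  intro h
  have := lcP_polyCoeff (F := F) hP
  rw [h] at this
  have h0 : algebraMap K F P.trailingCoeff = 0 := by rw [← this]; rfl
  exact hP (by simpa using h0)

end PolyCoeff

/-! ### The leading term of a solution -/

section Newton

variable {K : Type*} [Field K] {F : Type*} [Field F] [Algebra K F]
  {b : ℕ+} {r : ℕ} {l : ℕ → Polynomial K}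

theorem mahlerP_iterate_ne_zero {k : ℕ} {p : Puiseux F} (hp : p ≠ 0) :
    (mahlerP F b)^[k] p ≠ 0 := by
  induction k with
  | zero => exact hp
  | succ k ih => rw [Function.iterate_succ_apply']; exact (map_ne_zero _).2 ih

theorem ordP_mahlerP_iterate (k : ℕ) {p : Puiseux F} (hp : p ≠ 0) :
    ordP ((mahlerP F b)^[k] p) = (b : ℚ) ^ k * ordP p := by
  induction k with
  | zero => simp
  | succ k ih =>
    rw [Function.iterate_succ_apply', ordP_mahlerP b (mahlerP_iterate_ne_zero hp), ih, pow_succ]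
    ring

theorem lcP_mahlerP_iterate (k : ℕ) {p : Puiseux F} (hp : p ≠ 0) :
    lcP ((mahlerP F b)^[k] p) = lcP p := by
  induction k with
  | zero => simp
  | succ k ih =>
    rw [Function.iterate_succ_apply', lcP_mahlerP b (mahlerP_iterate_ne_zero hp), ih]

/-- The order of the product is the bound on `m`, so only the leading coefficient can be seen at or
below it. -/
theorem coeff_twistedOp_term {lam : F} (hlam : lam ≠ 0) {p : Puiseux F} (hp : p ≠ 0) {P : Polynomial K}
    (hP : P ≠ 0) (k : ℕ) {m : ℚ} (hm : m ≤ P.natTrailingDegree + (b : ℚ) ^ k * ordP p) :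
    (polyCoeff F P * (algebraMap F _ lam ^ k * (mahlerP F b)^[k] p)).1.coeff m
      = if m = P.natTrailingDegree + (b : ℚ) ^ k * ordP p
        then algebraMap K F P.trailingCoeff * lam ^ k * lcP p else 0 := by
  have h1 := polyCoeff_ne_zero (F := F) hP
  have h2 : algebraMap F (Puiseux F) (lam ^ k) ≠ 0 := by simpa using fun h => absurd h hlam
  have h3 := mahlerP_iterate_ne_zero (b := b) (k := k) hp
  have ho : ordP (polyCoeff F P * (algebraMap F _ lam ^ k * (mahlerP F b)^[k] p))
      = P.natTrailingDegree + (b : ℚ) ^ k * ordP p := by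
    rw [← map_pow, ordP_mul h1 (mul_ne_zero h2 h3), ordP_mul h2 h3, ordP_polyCoeff hP,
      ordP_mahlerP_iterate k hp, ordP_algebraMap (pow_ne_zero k hlam), zero_add]
  split_ifs with h
  · rw [h, ← ho]
    change lcP _ = _
    rw [← map_pow, lcP_mul, lcP_mul, lcP_algebraMap, lcP_polyCoeff hP, lcP_mahlerP_iterate k hp]
    ring
  · apply coeff_eq_zero_of_lt
    rw [ho]
    exact lt_of_le_of_ne hm h

theorem coeff_finset_sum {ι : Type*} (s : Finset ι) (f : ι → Puiseux F) (a : ℚ) :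
    (∑ i ∈ s, f i).1.coeff a = ∑ i ∈ s, (f i).1.coeff a := by
  classical
  induction s using Finset.induction_on with
  | empty => simp
  | insert i s hi ih => rw [Finset.sum_insert hi, Finset.sum_insert hi, ← ih]; rfl

/-- The Newton polygon argument. The `k`-th term has order `val(l_k) + b^k v` with `v = ordP p`. The
coefficients at the least of these orders must cancel; this needs at least two indices, and the
corresponding lowest points lie on a supporting line of slope `-v`. The cancellation is the
vanishing of the characteristic polynomial at `lam`. -/
theorem exists_isAdmissible (hb : 2 ≤ b) (hl0 : l 0 ≠ 0) {lam : F} (hlam : lam ≠ 0)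
    {p : Puiseux F} (hp : p ≠ 0) (h : twistedOp b r l lam p = 0) :
    ∃ k₁ k₂, IsAdmissible b r l lam k₁ k₂ ∧ edgeSlope b l k₁ k₂ = - ordP p := by
  classical
  have hb1 : (1 : ℚ) < b := by
    have : (2 : ℚ) ≤ b := by exact_mod_cast hb
    linarith
  set v := ordP p with hv
  let A := (Finset.range (r + 1)).filter (fun k => l k ≠ 0)
  have hA : A.Nonempty := ⟨0, by simp [A, hl0]⟩
  let val : ℕ → ℚ := fun k => (l k).natTrailingDegree + (b : ℚ) ^ k * v
  obtain ⟨k₀, hk₀, hmin⟩ := A.exists_min_image val hA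
  set m := val k₀ with hm
  let S := A.filter (fun k => m = val k)
  have hS : S.Nonempty := ⟨k₀, by simp [S, hk₀, hm]⟩
  -- The coefficient of `x^m` in the equation, with the common factor `lcP p` removed.
  have hsum : ∑ k ∈ S, algebraMap K F (l k).trailingCoeff * lam ^ k = 0 := by
    have h0 := congrArg (fun y : Puiseux F => y.1.coeff m) h
    simp only [twistedOp_apply, coeff_finset_sum] at h0
    have h1 : ∀ k ∈ Finset.range (r + 1), (polyCoeff F (l k) *
        (algebraMap F _ lam ^ k * (mahlerP F b)^[k] p)).1.coeff m
        = if k ∈ S then algebraMap K F (l k).trailingCoeff * lam ^ k * lcP p else 0 := by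
      intro k hk
      by_cases hlk : l k = 0
      · simp [hlk, polyCoeff_zero, S, A]
      · have hkA : k ∈ A := by simp only [A, Finset.mem_filter]; exact ⟨hk, hlk⟩
        rw [coeff_twistedOp_term hlam hp hlk k (hmin k hkA)]
        simp only [S, Finset.mem_filter, hkA, true_and]
        rfl
    rw [Finset.sum_congr rfl h1, ← Finset.sum_filter] at h0
    have h2 : (Finset.range (r + 1)).filter (fun k => k ∈ S) = S := by
      ext k; simp only [S, A, Finset.mem_filter]; tauto
    rw [h2, ← Finset.sum_mul] at h0
    exact (mul_eq_zero.1 h0).resolve_right (lcP_ne_zero hp)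
  have hmemS : ∀ {k}, k ∈ S → k ≤ r ∧ l k ≠ 0 ∧ m = val k := by
    intro k hk
    simp only [S, A, Finset.mem_filter, Finset.mem_range] at hk
    exact ⟨by omega, hk.1.2, hk.2⟩
  obtain ⟨hr1, hn1, hv1⟩ := hmemS (S.min'_mem hS)
  obtain ⟨hr2, hn2, hv2⟩ := hmemS (S.max'_mem hS)
  set k₁ := S.min' hS with hk₁
  set k₂ := S.max' hS with hk₂
  -- A single index in `S` would leave one nonzero term in `hsum`.
  have hlt : k₁ < k₂ := by
    refine lt_of_le_of_ne (S.min'_le _ (S.max'_mem hS)) fun heq => ?_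
    have hone : S = {k₁} := by
      refine Finset.eq_singleton_iff_unique_mem.2 ⟨S.min'_mem hS, fun k hk => ?_⟩
      exact le_antisymm (heq ▸ S.le_max' k hk) (S.min'_le k hk)
    rw [hone, Finset.sum_singleton] at hsum
    have : (l k₁).trailingCoeff ≠ 0 := by simpa using hn1
    exact (mul_ne_zero (by simpa using hn1) (pow_ne_zero _ hlam)) hsum
  have hslope : edgeSlope b l k₁ k₂ = -v := by
    have hpow : (b : ℚ) ^ k₂ - (b : ℚ) ^ k₁ ≠ 0 :=
      sub_ne_zero.2 (pow_lt_pow_right₀ hb1 hlt).ne'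
    rw [edgeSlope, div_eq_iff hpow]
    have : val k₁ = val k₂ := hv1.symm.trans hv2
    simp only [val] at this
    linarith
  have hline : ∀ k, lineAt b l k₁ k₂ k = m - (b : ℚ) ^ k * v := by
    intro k
    rw [lineAt, hslope, hv1]
    simp only [val]
    ring
  have hlow : ∀ k ≤ r, ∀ j, (l k).coeff j ≠ 0 →
      lineAt b l k₁ k₂ k ≤ (l k).natTrailingDegree ∧ ((l k).natTrailingDegree : ℚ) ≤ j := by
    intro k hk j hj
    have hlk : l k ≠ 0 := by rintro h; simp [h] at hj
    have hkA : k ∈ A := by simp only [A, Finset.mem_filter, Finset.mem_range]; exact ⟨by omega, hlk⟩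
    refine ⟨?_, by exact_mod_cast Polynomial.natTrailingDegree_le_of_ne_zero hj⟩
    have := hmin k hkA
    rw [hline]
    simp only [val] at this
    linarith
  -- A point of the polygon on the line is the lowest one of its abscissa, and its index belongs to
  -- `S`; so the edge carries exactly the terms of `hsum`.
  have hmem : ∀ k ≤ r, ∀ j, (l k).coeff j ≠ 0 → (j : ℚ) = lineAt b l k₁ k₂ k →
      k ∈ S ∧ j = (l k).natTrailingDegree := by
    intro k hk j hj hjl
    obtain ⟨h1, h2⟩ := hlow k hk j hj
    have hlk : l k ≠ 0 := by rintro h; simp [h] at hj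
    have h3 : ((l k).natTrailingDegree : ℚ) = j := le_antisymm h2 (hjl ▸ h1)
    refine ⟨?_, by exact_mod_cast h3.symm⟩
    simp only [S, A, Finset.mem_filter, Finset.mem_range]
    refine ⟨⟨by omega, hlk⟩, ?_⟩
    rw [hline] at hjl
    simp only [val]
    linarith
  refine ⟨k₁, k₂, ⟨⟨hlt, hr2, hn1, hn2, fun k hk j hj => (hlow k hk j hj).1.trans
    (hlow k hk j hj).2, fun k hk j hj hjl => ?_⟩, ?_⟩, hslope⟩
  · have := (hmem k hk j hj hjl).1
    exact ⟨S.min'_le _ this, S.le_max' _ this⟩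
  · have hcoef : ∀ k ∈ Finset.Icc k₁ k₂,
        (∑ j ∈ (l k).support with (((j : ℕ) : ℚ) = lineAt b l k₁ k₂ k), (l k).coeff j)
          = if k ∈ S then (l k).trailingCoeff else 0 := by
      intro k hk
      have hkr : k ≤ r := (Finset.mem_Icc.1 hk).2.trans hr2
      split_ifs with hkS
      · obtain ⟨-, hlk, hval⟩ := hmemS hkS
        rw [Finset.sum_eq_single (l k).natTrailingDegree]
        · rfl
        · intro j hj hne
          simp only [Finset.mem_filter, Polynomial.mem_support_iff] at hj
          exact absurd (hmem k hkr j hj.1 hj.2).2 hne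
        · intro hnot
          exfalso
          apply hnot
          simp only [Finset.mem_filter]
          refine ⟨Polynomial.natTrailingDegree_mem_support_of_nonzero hlk, ?_⟩
          rw [hline, hval]
          simp only [val]
          ring
      · apply Finset.sum_eq_zero
        intro j hj
        simp only [Finset.mem_filter, Polynomial.mem_support_iff] at hj
        exact absurd (hmem k hkr j hj.1 hj.2).1 hkS
    have hS' : (Finset.Icc k₁ k₂).filter (fun k => k ∈ S) = S := by
      ext k
      simp only [Finset.mem_filter, Finset.mem_Icc]
      exact ⟨fun h => h.2, fun h => ⟨⟨S.min'_le _ h, S.le_max' _ h⟩, h⟩⟩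
    -- The characteristic polynomial is shifted by `X^k₁`, which costs nothing as `lam ≠ 0`.
    have : lam ^ k₁ * Polynomial.aeval lam (edgePoly b l k₁ k₂) = 0 := by
      rw [edgePoly, map_sum, Finset.mul_sum, ← hsum]
      conv_rhs => rw [← hS']
      rw [Finset.sum_filter]
      refine Finset.sum_congr rfl fun k hk => ?_
      rw [map_mul, Polynomial.aeval_C, map_pow, Polynomial.aeval_X]
      have h2 : lam ^ k₁ * lam ^ (k - k₁) = lam ^ k := by
        rw [← pow_add, Nat.add_sub_cancel' (Finset.mem_Icc.1 hk).1]
      rw [mul_left_comm, h2]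
      refine (congrArg (fun c => algebraMap K F c * lam ^ k)
        (?_ : _ = if k ∈ S then (l k).trailingCoeff else 0)).trans ?_
      · convert hcoef k hk
      · split_ifs <;> simp
    exact (mul_eq_zero.1 this).resolve_left (pow_ne_zero _ hlam)

end Newton

/-! ### Ramification of the solutions -/

section Ramification

variable {F : Type*} [Field F]

/-- The part of a Puiseux series formed by the exponents of denominator `d`. -/
def denPart (F : Type*) [Field F] (d : ℕ) : Puiseux F →ₗ[F] Puiseux F where
  toFun y := ⟨{ coeff := fun a => if a.den = d then y.1.coeff a else 0
                isPWO_support' := y.1.isPWO_support.mono (by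
                  intro a ha h
                  apply ha
                  simp [h]) }, by
    obtain ⟨q, hq⟩ := y.2
    refine ⟨q, fun a ha => hq a fun h => ha ?_⟩
    simp [h]⟩
  map_add' y z := by
    refine puiseux_ext fun a => ?_
    change (if a.den = d then y.1.coeff a + z.1.coeff a else 0) = ite _ _ _ + ite _ _ _
    split_ifs <;> simp
  map_smul' c y := by
    refine puiseux_ext fun a => ?_
    rw [RingHom.id_apply, coeff_smul]
    change (if a.den = d then (c • y).1.coeff a else 0) = c * ite _ _ _
    rw [coeff_smul]
    split_ifs <;> simp

theorem coeff_denPart (d : ℕ) (y : Puiseux F) (a : ℚ) :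
    (denPart F d y).1.coeff a = if a.den = d then y.1.coeff a else 0 := rfl

theorem den_dvd_of_hasRamification {N : ℕ+} {y : HahnSeries ℚ F} (h : HasRamification N y) {a : ℚ}
    (ha : y.coeff a ≠ 0) : a.den ∣ N := by
  obtain ⟨n, rfl⟩ := h a ha
  have := Rat.den_dvd n N
  rw [Rat.divInt_eq_div] at this
  exact_mod_cast this

/-- Multiplying by `b` can only shrink the denominator, and dividing back by `b` can only restore a
factor of `b`, which is excluded by coprimality. -/
theorem den_mul_natCast_of_coprime {c : ℚ} {b : ℕ} (hb : b ≠ 0) (h : Nat.Coprime c.den b) :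
    (c * b).den = c.den := by
  apply Nat.dvd_antisymm
  · simpa using Rat.mul_den_dvd c b
  · have h1 := Rat.mul_den_dvd (c * b) (b : ℚ)⁻¹
    have hb' : (b : ℚ) ≠ 0 := by exact_mod_cast hb
    rw [mul_assoc, mul_inv_cancel₀ hb', mul_one] at h1
    rw [Rat.inv_natCast_den_of_pos (Nat.pos_of_ne_zero hb)] at h1
    exact h.dvd_of_dvd_mul_right h1

theorem HasRamification.mahlerP {N : ℕ+} {y : Puiseux F} (h : HasRamification N y.1) (b : ℕ+) :
    HasRamification N (mahlerP F b y).1 := by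
  intro a ha
  rw [HahnSeries.mem_support, coeff_mahlerP] at ha
  obtain ⟨n, hn⟩ := h _ ha
  have hb : (b : ℚ) ≠ 0 := by exact_mod_cast b.ne_zero
  refine ⟨b * n, ?_⟩
  rw [div_eq_iff hb] at hn
  rw [hn]
  push_cast
  ring

theorem HasRamification.mahlerP_iterate {N : ℕ+} {y : Puiseux F} (h : HasRamification N y.1)
    (b : ℕ+) (k : ℕ) : HasRamification N ((Mahler.mahlerP F b)^[k] y).1 := by
  induction k with
  | zero => exact h
  | succ k ih => rw [Function.iterate_succ_apply']; exact ih.mahlerP b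

/-- Coprimality is essential: `M` sends `x^(1/b)` to `x` and so changes denominators in general. -/
theorem denPart_mahlerP {N : ℕ+} {y : Puiseux F} (h : HasRamification N y.1) {b : ℕ+}
    (hN : Nat.Coprime N b) (d : ℕ) :
    denPart F d (mahlerP F b y) = mahlerP F b (denPart F d y) := by
  refine puiseux_ext fun a => ?_
  rw [coeff_mahlerP, coeff_denPart, coeff_denPart, coeff_mahlerP]
  by_cases h0 : y.1.coeff (a / b) = 0
  · simp [h0]
  · have h1 := hN.coprime_dvd_left (den_dvd_of_hasRamification h h0)
    have h2 := den_mul_natCast_of_coprime b.ne_zero h1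
    have hb : (b : ℚ) ≠ 0 := by exact_mod_cast b.ne_zero
    rw [div_mul_cancel₀ a hb] at h2
    rw [h2]

theorem denPart_mahlerP_iterate {N : ℕ+} {y : Puiseux F} (h : HasRamification N y.1) {b : ℕ+}
    (hN : Nat.Coprime N b) (d k : ℕ) :
    denPart F d ((mahlerP F b)^[k] y) = (mahlerP F b)^[k] (denPart F d y) := by
  induction k with
  | zero => rfl
  | succ k ih =>
    rw [Function.iterate_succ_apply', Function.iterate_succ_apply',
      denPart_mahlerP (h.mahlerP_iterate b k) hN, ih]

variable {K : Type*} [Field K] [Algebra K F]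

theorem polyCoeff_add (P Q : Polynomial K) :
    polyCoeff F (P + Q) = polyCoeff F P + polyCoeff F Q := by
  simp [polyCoeff, ratAt_eq]

theorem polyCoeff_monomial (n : ℕ) (c : K) :
    polyCoeff F (Polynomial.monomial n c) = monomialP (n : ℚ) (algebraMap K F c) := by
  rw [polyCoeff, ratAt_eq, Polynomial.map_monomial, ← laurentHom_toLaurent,
    ← Polynomial.C_mul_X_pow_eq_monomial, Polynomial.toLaurent_C_mul_X_pow,
    ← LaurentPolynomial.single_eq_C_mul_T, ← laurentPolyAt_eq, laurentPolyAt_single]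
  simp

/-- A polynomial shifts exponents by integers, which keeps their denominators. -/
theorem denPart_polyCoeff_mul (d : ℕ) (P : Polynomial K) (y : Puiseux F) :
    denPart F d (polyCoeff F P * y) = polyCoeff F P * denPart F d y := by
  induction P using Polynomial.induction_on' with
  | add P Q hP hQ => rw [polyCoeff_add, add_mul, map_add, hP, hQ, add_mul]
  | monomial n c =>
    rw [polyCoeff_monomial]
    refine puiseux_ext fun a => ?_
    rw [coeff_denPart, coeff_monomialP_mul, coeff_monomialP_mul, coeff_denPart]
    have : (a - n).den = a.den := by
      have := Rat.sub_natCast_den a n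
      exact this
    rw [this, mul_ite, mul_zero]

variable {b : ℕ+} {r : ℕ} {l : ℕ → Polynomial K}

theorem twistedOp_denPart {N : ℕ+} {y : Puiseux F} (h : HasRamification N y.1)
    (hN : Nat.Coprime N b) (lam : F) (d : ℕ) :
    twistedOp b r l lam (denPart F d y) = denPart F d (twistedOp b r l lam y) := by
  rw [twistedOp_apply, twistedOp_apply, map_sum]
  refine Finset.sum_congr rfl fun k _ => ?_
  rw [denPart_polyCoeff_mul, ← map_pow, ← Algebra.smul_def, ← Algebra.smul_def, map_smul,
    denPart_mahlerP_iterate h hN]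

theorem hasRamification_polyCoeff (P : Polynomial K) : HasRamification 1 (polyCoeff F P).1 := by
  intro a ha
  by_contra h
  push Not at h
  refine ha (coeff_polyCoeff_eq_zero P fun n hn => h n ?_)
  simp [hn]

theorem hasRamification_sum {N : ℕ+} {ι : Type*} (s : Finset ι) (f : ι → Puiseux F)
    (h : ∀ i ∈ s, HasRamification N (f i).1) : HasRamification N (∑ i ∈ s, f i).1 := by
  intro a ha
  rw [HahnSeries.mem_support, coeff_finset_sum] at ha
  obtain ⟨i, hi, hne⟩ := Finset.exists_ne_zero_of_sum_ne_zero ha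
  exact h i hi a hne

/-- If `g = gcd(N, b)`, then `M` turns exponents in `(1/N)ℤ` into exponents in `(g/N)ℤ`. The
equation expresses `p` through `M p, ..., M^r p`, because `l 0 ≠ 0`, so `p` itself has ramification
`N/g`; descend until `g = 1`. -/
theorem exists_coprime_hasRamification (hl0 : l 0 ≠ 0) {lam : F} {p : Puiseux F}
    (h : twistedOp b r l lam p = 0) (N : ℕ+) (hN : HasRamification N p.1) :
    ∃ N' : ℕ+, Nat.Coprime N' b ∧ HasRamification N' p.1 := by
  induction N using PNat.strongInductionOn with
  | _ N ih =>
    by_cases hg : Nat.Coprime N b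
    · exact ⟨N, hg, hN⟩
    · obtain ⟨N', hN'⟩ : ∃ N' : ℕ+, N = PNat.gcd N b * N' := PNat.gcd_dvd_left N b
      obtain ⟨b', hb'⟩ : ∃ b' : ℕ+, b = PNat.gcd N b * b' := PNat.gcd_dvd_right N b
      set g := PNat.gcd N b with hgdef
      have hg1 : g ≠ 1 := fun h1 => hg (by
        have : ((PNat.gcd N b : ℕ+) : ℕ) = 1 := by rw [← hgdef, h1]; rfl
        rwa [PNat.gcd_coe] at this)
      have hlt : N' < N := by
        have h2 : (1 : ℕ+) < g := lt_of_le_of_ne one_le (Ne.symm hg1)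
        calc N' = 1 * N' := (one_mul _).symm
          _ < g * N' := mul_lt_mul_left h2 N'
          _ = N := hN'.symm
      refine ih N' hlt ?_
      have hram : ∀ k, HasRamification N' ((mahlerP F b)^[k + 1] p).1 := by
        intro k
        rw [Function.iterate_succ_apply]
        refine HasRamification.mahlerP_iterate ?_ b k
        intro a ha
        rw [HahnSeries.mem_support, coeff_mahlerP] at ha
        obtain ⟨n, hn⟩ := hN _ ha
        refine ⟨b' * n, ?_⟩
        have hb : (b : ℚ) ≠ 0 := by exact_mod_cast b.ne_zero
        have hgq : (g : ℚ) ≠ 0 := by exact_mod_cast g.ne_zero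
        have hNq : (N' : ℚ) ≠ 0 := by exact_mod_cast N'.ne_zero
        have e1 : (N : ℚ) = g * N' := by exact_mod_cast congrArg (fun x : ℕ+ => (x : ℕ)) hN'
        have e2 : (b : ℚ) = g * b' := by exact_mod_cast congrArg (fun x : ℕ+ => (x : ℕ)) hb'
        rw [div_eq_iff hb, e1, e2] at hn
        rw [hn]
        push_cast
        field_simp
      -- The equation solved for its term of index `0`.
      have hmul : polyCoeff F (l 0) * p = - ∑ k ∈ Finset.range r,
          polyCoeff F (l (k + 1)) * (algebraMap F _ lam ^ (k + 1) * (mahlerP F b)^[k + 1] p) := by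
        rw [twistedOp_apply, Finset.sum_range_succ'] at h
        rw [eq_neg_iff_add_eq_zero, ← h, add_comm]
        simp
      have h0 := polyCoeff_ne_zero (F := F) hl0
      have hP : ∀ P : Polynomial K, HasRamification N' (polyCoeff F P).1 := fun P => by
        have := (hasRamification_polyCoeff (F := F) P).mono N'
        rwa [one_mul] at this
      have hp : p = (polyCoeff F (l 0))⁻¹ * (- ∑ k ∈ Finset.range r,
          polyCoeff F (l (k + 1)) * (algebraMap F _ lam ^ (k + 1) * (mahlerP F b)^[k + 1] p)) := by
        rw [← hmul, inv_mul_cancel_left₀ h0]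
      rw [hp, mul_neg, ← neg_mul]
      refine HasRamification.mul (y := (-(polyCoeff F (l 0))⁻¹ : Puiseux F).1) ?_
        (hasRamification_sum _ _ fun k _ => ?_)
      · intro a ha
        refine (hP (l 0)).inv a ?_
        exact (HahnSeries.support_neg (x := ((polyCoeff F (l 0))⁻¹ : Puiseux F).1)) ▸ ha
      · refine (hP _).mul ?_
        rw [← map_pow]
        intro a ha
        rw [HahnSeries.mem_support, coeff_algebraMap_mul] at ha
        exact hram k a (right_ne_zero_of_mul ha)

/-- With ramification coprime to `b`, taking the part of denominator `d` commutes with the operator.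
For every denominator `d` that occurs in `p`, this part is a nonzero solution whose order has
denominator `d`; by the Newton polygon, `d` is the denominator of an admissible slope, and it is
coprime to `b`. -/
theorem hasRamification_ramBound (hb : 2 ≤ b) (hl0 : l 0 ≠ 0) {lam : F} (hlam : lam ≠ 0)
    {p : Puiseux F} (h : twistedOp b r l lam p = 0) :
    HasRamification (ramBound b r l lam) p.1 := by
  obtain ⟨N₀, hN₀⟩ := p.2
  obtain ⟨N, hNb, hN⟩ := exists_coprime_hasRamification hl0 h N₀ hN₀
  intro a ha
  have hdN := den_dvd_of_hasRamification hN ha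
  have hcoeff : (denPart F a.den p).1.coeff a ≠ 0 := by
    rw [coeff_denPart, if_pos rfl]; exact ha
  have hne : denPart F a.den p ≠ 0 := by
    intro h0
    rw [h0] at hcoeff
    exact hcoeff rfl
  have hsol : twistedOp b r l lam (denPart F a.den p) = 0 := by
    rw [twistedOp_denPart hN hNb, h, map_zero]
  obtain ⟨k₁, k₂, hadm, hslope⟩ := exists_isAdmissible hb hl0 hlam hne hsol
  have hord : (ordP (denPart F a.den p)).den = a.den := by
    by_contra hcon
    have := lcP_ne_zero hne
    rw [lcP, coeff_denPart, if_neg hcon] at this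
    exact this rfl
  have hden : (edgeSlope b l k₁ k₂).den = a.den := by rw [hslope, Rat.neg_den, hord]
  have hdvd : a.den ∣ (ramBound b r l lam : ℕ) := by
    rw [← hden]
    refine Finset.dvd_lcm (f := fun k : ℕ × ℕ => (edgeSlope b l k.1 k.2).den) (b := (k₁, k₂)) ?_
    have h12 := hadm.1.1
    have h2r := hadm.1.2.1
    simp only [Finset.mem_filter, Finset.mem_product, Finset.mem_range]
    refine ⟨⟨by omega, by omega⟩, hadm, ?_⟩
    rw [hden]
    exact hNb.coprime_dvd_left hdN
  obtain ⟨e, he⟩ := hdvd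
  refine ⟨a.num * e, ?_⟩
  have he0 : (e : ℚ) ≠ 0 := by
    intro h0
    have : e = 0 := by exact_mod_cast h0
    rw [this, mul_zero] at he
    exact (ramBound b r l lam).ne_zero he
  have hd0 : (a.den : ℚ) ≠ 0 := by exact_mod_cast a.den_ne_zero
  rw [show ((ramBound b r l lam : ℕ+) : ℚ) = a.den * e by exact_mod_cast he]
  push_cast
  rw [mul_div_mul_right _ _ he0, Rat.num_div_den]

end Ramification

/-! ### The dimension bound by a Casoratian argument -/

section Casoratian

variable {K : Type*} [Field K] {F : Type*} [Field F] [Algebra K F]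
  {b : ℕ+} {r : ℕ} {l : ℕ → Polynomial K}

/-- More than `r` vectors `(λ_i^k M^k p_i)_{k < r}` are dependent over the Puiseux series. Take a
relation with fewest nonzero coefficients, one of them equal to `1`. Applying `M` and using the
equation gives another relation, and minimality of the difference forces the coefficients to be
constants attached to a single `λ`. This is a relation over `F` between the `e_{λ_i} p_i`. -/
theorem card_le_of_linearIndependent (hb : 2 ≤ b) (hl0 : l 0 ≠ 0) {ι : Type*} [Fintype ι]
    (lam : ι → Fˣ) (p : ι → Puiseux F)
    (hind : LinearIndependent F (fun i => (MonoidAlgebra.single (lam i) (p i) : DRing F)))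
    (hsol : ∀ i, twistedOp b r l (lam i : F) (p i) = 0) : Fintype.card ι ≤ r := by
  classical
  by_contra hcard
  push Not at hcard
  let c : ι → Puiseux F := fun i => algebraMap F _ (lam i : F)
  have hc : ∀ i, c i ≠ 0 := fun i => by simp [c]
  have hMc : ∀ i, mahlerP F b (c i) = c i := fun i => mahlerP_algebraMap b _
  let Rel : (ι → Puiseux F) → Prop := fun a =>
    ∀ k < r, ∑ i, a i * (c i ^ k * (mahlerP F b)^[k] (p i)) = 0
  have hex : ∃ n, ∃ a : ι → Puiseux F, a ≠ 0 ∧ Rel a ∧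
      (Finset.univ.filter (fun i => a i ≠ 0)).card = n := by
    let w : ι → (Fin r → Puiseux F) := fun i k => c i ^ (k : ℕ) * (mahlerP F b)^[(k : ℕ)] (p i)
    have hdep : ¬ LinearIndependent (Puiseux F) w := by
      intro h
      have := h.fintype_card_le_finrank
      simp at this
      omega
    rw [Fintype.not_linearIndependent_iff] at hdep
    obtain ⟨a, ha, i, hi⟩ := hdep
    refine ⟨_, a, fun h => hi (by rw [h]; rfl), fun k hk => ?_, rfl⟩
    have := congrFun ha ⟨k, hk⟩
    simpa [w] using this
  obtain ⟨a, ha0, harel, hacard⟩ := Nat.find_spec hex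
  have hmin := fun m hm => Nat.find_min (H := hex) (m := m) hm
  obtain ⟨i₀, hi₀⟩ := Function.ne_iff.1 ha0
  rw [Pi.zero_apply] at hi₀
  let a' : ι → Puiseux F := fun i => (a i₀)⁻¹ * a i
  have ha'1 : a' i₀ = 1 := inv_mul_cancel₀ hi₀
  have ha'rel : Rel a' := by
    intro k hk
    simp only [a', mul_assoc]
    rw [← Finset.mul_sum, harel k hk, mul_zero]
  -- The factor `c i₀` makes the coefficient of index `i₀` cancel.
  let a'' : ι → Puiseux F := fun i => c i₀ * (c i)⁻¹ * mahlerP F b (a' i) - a' i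
  -- `M` gives the relations of indices `1, ..., r`; substituting them in the equation gives index
  -- `0`, as `l 0 ≠ 0`. Index `0` is thus available also for `r = 0`, where `Rel` is empty.
  have hS : ∀ k ≤ r, ∑ i, (c i)⁻¹ * mahlerP F b (a' i) * (c i ^ k * (mahlerP F b)^[k] (p i)) = 0 := by
    have hpos : ∀ k < r, ∑ i, (c i)⁻¹ * mahlerP F b (a' i)
        * (c i ^ (k + 1) * (mahlerP F b)^[k + 1] (p i)) = 0 := by
      intro k hk
      have := congrArg (mahlerP F b) (ha'rel k hk)
      rw [map_sum, map_zero] at this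
      rw [← this]
      refine Finset.sum_congr rfl fun i _ => ?_
      rw [map_mul (mahlerP F b) (a' i), map_mul (mahlerP F b) (c i ^ k), map_pow, hMc, Function.iterate_succ_apply', pow_succ]
      have := hc i
      field_simp
    intro k hk
    rcases k with _ | k
    · have h1 : ∑ i, (c i)⁻¹ * mahlerP F b (a' i) * twistedOp b r l (lam i : F) (p i) = 0 := by
        simp [hsol]
      simp only [twistedOp_apply, Finset.mul_sum] at h1
      rw [Finset.sum_comm, Finset.sum_range_succ', Finset.sum_eq_zero, zero_add] at h1
      · have h2 : polyCoeff F (l 0) *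
            ∑ i, (c i)⁻¹ * mahlerP F b (a' i) * (c i ^ 0 * (mahlerP F b)^[0] (p i)) = 0 := by
          rw [← h1, Finset.mul_sum]
          exact Finset.sum_congr rfl fun i _ => by simp only [c]; ring
        exact (mul_eq_zero.1 h2).resolve_left (polyCoeff_ne_zero hl0)
      · intro k hk
        rw [← mul_zero (polyCoeff F (l (k + 1))), ← hpos k (Finset.mem_range.1 hk),
          Finset.mul_sum]
        exact Finset.sum_congr rfl fun i _ => by simp only [c]; ring
    · exact hpos k hk
  have ha''rel : Rel a'' := by
    intro k hk
    have h1 := hS k hk.le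
    have h2 := ha'rel k hk
    simp only [a'', sub_mul, Finset.sum_sub_distrib]
    rw [h2, sub_zero, ← mul_zero (c i₀), ← h1, Finset.mul_sum]
    exact Finset.sum_congr rfl fun i _ => by ring
  -- The support of `a''` lies in that of `a` and misses `i₀`.
  have ha'' : a'' = 0 := by
    by_contra hne
    refine hmin _ ?_ ⟨a'', hne, ha''rel, rfl⟩
    rw [← hacard]
    refine Finset.card_lt_card (Finset.ssubset_iff_of_subset ?_ |>.2 ⟨i₀, ?_, ?_⟩)
    · intro i hi
      simp only [Finset.mem_filter, Finset.mem_univ, true_and] at hi ⊢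
      intro h0
      apply hi
      simp [a'', a', h0]
    · simpa using hi₀
    · simp [a'', ha'1, hc]
  -- `a'' = 0` reads `λ_{i₀} M a'_i = λ_i a'_i`, a first-order equation with constant coefficients.
  have hconst : ∀ i, ∃ e : F, a' i = algebraMap F _ e ∧ (e ≠ 0 → lam i = lam i₀) := by
    intro i
    by_cases h0 : a' i = 0
    · exact ⟨0, by simp [h0], fun h => absurd rfl h⟩
    · have h1 : c i₀ * mahlerP F b (a' i) = c i * a' i := by
        have h2 := congrFun ha'' i
        have h3 := hc i
        simp only [a'', Pi.zero_apply] at h2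
        field_simp at h2
        rw [← sub_eq_zero]
        linear_combination h2
      obtain ⟨h2, e, he⟩ := eq_algebraMap_of_mahlerP_eq_mul hb h0 (lam i₀).ne_zero h1
      exact ⟨e, he, fun _ => (Units.ext h2).symm⟩
  choose e he hlam using hconst
  have hzero : ∑ i, e i • p i = 0 := by
    have h1 := hS 0 (Nat.zero_le r)
    have h2 : c i₀ * ∑ i, (c i)⁻¹ * mahlerP F b (a' i) * (c i ^ 0 * (mahlerP F b)^[0] (p i))
        = ∑ i, e i • p i := by
      rw [Finset.mul_sum]
      refine Finset.sum_congr rfl fun i _ => ?_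
      have h3 := congrFun ha'' i
      simp only [a'', Pi.zero_apply, sub_eq_zero] at h3
      rw [Algebra.smul_def, ← he]
      conv_rhs => rw [← h3]
      simp only [pow_zero, Function.iterate_zero, id]
      ring
    rw [← h2, h1, mul_zero]
  have hrel : ∑ i, e i • (MonoidAlgebra.single (lam i) (p i) : DRing F) = 0 := by
    have : ∀ i, e i • (MonoidAlgebra.single (lam i) (p i) : DRing F)
        = MonoidAlgebra.single (lam i₀) (e i • p i) := by
      intro i
      by_cases h0 : e i = 0
      · simp [h0]
      · rw [MonoidAlgebra.smul_single, hlam i h0]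
    rw [Finset.sum_congr rfl fun i _ => this i]
    have h1 := map_sum (MonoidAlgebra.singleAddHom (R := Puiseux F) (lam i₀))
      (fun i => e i • p i) Finset.univ
    rw [hzero, map_zero] at h1
    exact h1.symm
  have := Fintype.linearIndependent_iff.1 hind e hrel i₀
  have h1 := he i₀
  rw [this, ha'1, map_zero] at h1
  exact one_ne_zero h1

end Casoratian

/-! ### Rational functions of `x^(1/q)` -/

section RatFunc

variable {F : Type*} [Field F]

theorem ratHom_ne_zero (m q : ℕ+) {f : RatFunc F} (hf : f ≠ 0) : ratHom F m q f ≠ 0 :=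
  (map_ne_zero _).2 hf

/-- Group the monomials by their exponent modulo `N`. -/
theorem polynomial_eq_sum_expand (N : ℕ+) (P : Polynomial F) :
    ∃ c : ℕ → Polynomial F, P = ∑ i ∈ Finset.range N,
      Polynomial.X ^ i * Polynomial.expand F N (c i) := by
  classical
  induction P using Polynomial.induction_on' with
  | add P Q hP hQ =>
    obtain ⟨c, hc⟩ := hP
    obtain ⟨d, hd⟩ := hQ
    refine ⟨c + d, ?_⟩
    conv_lhs => rw [hc, hd]
    rw [← Finset.sum_add_distrib]
    exact Finset.sum_congr rfl fun i _ => by rw [Pi.add_apply, map_add, mul_add]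
  | monomial n a =>
    refine ⟨fun i => if i = n % N then Polynomial.monomial (n / N) a else 0, ?_⟩
    rw [Finset.sum_eq_single (n % N)]
    · dsimp only
      rw [if_pos rfl, Polynomial.expand_monomial, Polynomial.X_pow_mul_monomial]
      congr 1
      rw [mul_comm, Nat.div_add_mod]
    · intro i _ hi
      dsimp only
      rw [if_neg hi, map_zero, mul_zero]
    · intro h
      exact absurd (Finset.mem_range.2 (Nat.mod_lt n N.pos)) h

theorem hasRamification_ratHom (q : ℕ+) (f : RatFunc F) : HasRamification q (ratHom F 1 q f).1 :=
  hasRamification_laurent q _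

/-- The exponents of the `i`-th term lie in the coset `i/(qN) + (1/q)ℤ`; these cosets are disjoint
for `0 ≤ i < N`, so nothing cancels. -/
theorem eq_zero_of_sum_monomialP_mul_eq_zero (q N : ℕ+) (D : ℕ → Puiseux F)
    (hD : ∀ i, HasRamification q (D i).1)
    (h : ∑ i ∈ Finset.range N, monomialP ((i : ℚ) / (q * N)) 1 * D i = 0) :
    ∀ i < (N : ℕ), D i = 0 := by
  intro i hi
  have hq : (q : ℚ) ≠ 0 := by exact_mod_cast q.ne_zero
  have hN : (N : ℚ) ≠ 0 := by exact_mod_cast N.ne_zero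
  refine puiseux_ext fun a => ?_
  by_contra hne
  obtain ⟨n, hn⟩ := hD i a hne
  apply hne
  have h1 := congrArg (fun y : Puiseux F => y.1.coeff (a + (i : ℚ) / (q * N))) h
  simp only [coeff_finset_sum, coeff_monomialP_mul, one_mul] at h1
  rw [Finset.sum_eq_single i] at h1
  · rw [add_sub_cancel_right] at h1
    exact h1
  · intro j hj hji
    by_contra hne'
    obtain ⟨n', hn'⟩ := hD j _ hne'
    rw [hn] at hn'
    field_simp at hn'
    have h2 : n * (N : ℤ) + i - j = n' * N := by
      have h3 : (N : ℚ) * n + i - j = N * n' := by linarith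
      have h4 : (N : ℤ) * n + i - j = N * n' := by exact_mod_cast h3
      linarith
    have h3 : ((i : ℤ) - j) = (n' - n) * N := by linarith
    have hj' := Finset.mem_range.1 hj
    have h4 : (N : ℤ) ∣ (i : ℤ) - j := ⟨n' - n, by rw [h3, mul_comm]⟩
    have h5 := Int.eq_zero_of_abs_lt_dvd h4 (by rw [abs_lt]; constructor <;> omega)
    omega
  · intro hnot
    exact absurd (Finset.mem_range.2 hi) hnot

/-- Write `f` as a quotient of polynomials in `x^(1/(qN))` and sort both by exponent modulo `N`. As
`f` has exponents in `(1/q)ℤ`, the identity `f * denominator = numerator` holds class by class, and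
one class with nonzero denominator gives `f`. -/
theorem exists_ratHom_of_hasRamification {f : Puiseux F} (hf : f ∈ ramRatField F) {q : ℕ+}
    (hq : HasRamification q f.1) : ∃ g : RatFunc F, f = ratHom F 1 q g := by
  obtain ⟨N, f₀, hf₀⟩ := hf
  rw [ratAt_eq, ← ratHom_mul_left q, ← ratHom_expandRat] at hf₀
  set f₁ := expandRat F q f₀
  have hden := f₁.denom_ne_zero
  obtain ⟨A, hA⟩ := polynomial_eq_sum_expand N f₁.num
  obtain ⟨B, hB⟩ := polynomial_eq_sum_expand N f₁.denom
  have hsec : ∀ (P : Polynomial F) (c : ℕ → Polynomial F),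
      P = ∑ i ∈ Finset.range N, Polynomial.X ^ i * Polynomial.expand F N (c i) →
      ratHom F 1 (q * N) (algebraMap _ _ P) = ∑ i ∈ Finset.range N,
        monomialP ((i : ℚ) / (q * N)) 1 * ratHom F 1 q (algebraMap _ _ (c i)) := by
    intro P c hP
    rw [hP, map_sum, map_sum]
    refine Finset.sum_congr rfl fun i _ => ?_
    rw [map_mul, map_mul, map_pow, map_pow, RatFunc.algebraMap_X, ratHom_X, monomialP_pow,
      ← expandRat_algebraMap, ratHom_expandRat, mul_comm q N, ratHom_mul_left]
    congr 2
    push_cast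
    ring
  have hmul : f * ratHom F 1 (q * N) (algebraMap _ _ f₁.denom)
      = ratHom F 1 (q * N) (algebraMap _ _ f₁.num) := by
    rw [hf₀, ← map_mul]
    congr 1
    exact ((div_eq_iff (RatFunc.algebraMap_ne_zero hden)).1 (RatFunc.num_div_denom f₁)).symm
  rw [hsec _ _ hA, hsec _ _ hB, Finset.mul_sum] at hmul
  have hall := eq_zero_of_sum_monomialP_mul_eq_zero q N
    (fun i => ratHom F 1 q (algebraMap _ _ (A i)) - f * ratHom F 1 q (algebraMap _ _ (B i)))
    (fun i => by
      intro a ha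
      rw [sub_eq_add_neg, ← neg_mul] at ha
      refine HasRamification.add (hasRamification_ratHom q _) (HasRamification.mul
        (y := (-f).1) ?_ (hasRamification_ratHom q _)) a ha
      intro a ha
      exact hq a (HahnSeries.support_neg (x := f.1) ▸ ha))
    (by
      simp only [mul_sub, Finset.sum_sub_distrib]
      rw [← hmul, sub_eq_zero]
      exact Finset.sum_congr rfl fun i _ => by ring)
  obtain ⟨i, hi, hBi⟩ : ∃ i < (N : ℕ), B i ≠ 0 := by
    by_contra hcon
    push Not at hcon
    apply hden
    rw [hB]
    exact Finset.sum_eq_zero fun i hi => by rw [hcon i (Finset.mem_range.1 hi), map_zero, mul_zero]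
  refine ⟨algebraMap _ _ (A i) / algebraMap _ _ (B i), ?_⟩
  have hBi' : ratHom F 1 q (algebraMap _ _ (B i)) ≠ 0 :=
    ratHom_ne_zero 1 q (RatFunc.algebraMap_ne_zero hBi)
  rw [map_div₀, eq_div_iff hBi']
  exact (sub_eq_zero.1 (hall i hi)).symm

/-- `RatFunc.eval` is the quotient of the values at `0` of the reduced numerator and denominator, so
`X` must first be excluded as a factor of the denominator. -/
theorem eval_zero_eq_one {q : ℕ+} {f : RatFunc F} (hf : f ≠ 0)
    (ho : ordP (ratHom F 1 q f) = 0) (hl : lcP (ratHom F 1 q f) = 1) :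
    RatFunc.eval (RingHom.id F) 0 f = 1 := by
  have hq : (q : ℚ) ≠ 0 := by exact_mod_cast q.ne_zero
  have hden := f.denom_ne_zero
  have hnum := RatFunc.num_ne_zero hf
  have hmul : ratHom F 1 q f * ratHom F 1 q (algebraMap _ _ f.denom)
      = ratHom F 1 q (algebraMap _ _ f.num) := by
    rw [← map_mul]
    congr 1
    exact ((div_eq_iff (RatFunc.algebraMap_ne_zero hden)).1 (RatFunc.num_div_denom f)).symm
  have hl' := congrArg lcP hmul
  have ho' := congrArg ordP hmul
  rw [lcP_mul, hl, one_mul, lcP_ratHom_polynomial q hden, lcP_ratHom_polynomial q hnum] at hl'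
  rw [ordP_mul (ratHom_ne_zero 1 q hf) (ratHom_ne_zero 1 q (RatFunc.algebraMap_ne_zero hden)), ho,
    zero_add, ordP_ratHom_polynomial q hden, ordP_ratHom_polynomial q hnum,
    div_left_inj' hq] at ho'
  have ho'' : f.denom.natTrailingDegree = f.num.natTrailingDegree := by exact_mod_cast ho'
  -- Order `0` makes the two orders of vanishing equal; if they were positive, `X` would be a common
  -- factor.
  have hzero : f.denom.natTrailingDegree = 0 := by
    by_contra hne
    have h1 : Polynomial.X ∣ f.denom := Polynomial.X_dvd_iff.2
      (Polynomial.coeff_eq_zero_of_lt_natTrailingDegree (Nat.pos_of_ne_zero hne))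
    have h2 : Polynomial.X ∣ f.num := Polynomial.X_dvd_iff.2
      (Polynomial.coeff_eq_zero_of_lt_natTrailingDegree (Nat.pos_of_ne_zero (ho'' ▸ hne)))
    exact Polynomial.not_isUnit_X ((RatFunc.isCoprime_num_denom f).isUnit_of_dvd' h2 h1)
  have hd0 : f.denom.coeff 0 ≠ 0 := by
    have : f.denom.trailingCoeff ≠ 0 := by simpa using hden
    rwa [Polynomial.trailingCoeff, hzero] at this
  rw [Polynomial.trailingCoeff, Polynomial.trailingCoeff, ← ho'', hzero] at hl'
  rw [RatFunc.eval, Polynomial.eval₂_id, Polynomial.eval₂_id, ← Polynomial.coeff_zero_eq_eval_zero,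
    ← Polynomial.coeff_zero_eq_eval_zero, hl', div_self (hl' ▸ hd0)]

/-! ### The functional equation of the infinite product -/

theorem constantCoeff_infProd {b : ℕ+} {g : RatFunc F}
    (hg : RatFunc.eval (RingHom.id F) 0 g = 1) :
    PowerSeries.coeff 0 (infProd b g) = 1 := by
  simp [infProd, partialProd, constantCoeff_invSeries hg]

/-- The factor `k = 0` is split off; the others are those of the shorter product after `x ↦ x^b`. -/
theorem partialProd_succ (b : ℕ+) (g : RatFunc F) (N : ℕ) :
    partialProd b g (N + 1)
      = invSeries g * PowerSeries.expand b b.ne_zero (partialProd b g N) := by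
  rw [partialProd, Finset.prod_range_succ', mul_comm, partialProd, map_prod]
  congr 1
  · simp
  · refine Finset.prod_congr rfl fun k _ => ?_
    ext n
    simp only [PowerSeries.coeff_expand, PNat.pow_coe, pow_succ']
    have hb := b.pos
    by_cases h : (b : ℕ) ∣ n
    · obtain ⟨m, rfl⟩ := h
      simp [Nat.mul_div_mul_left, Nat.mul_dvd_mul_iff_left, hb]
    · rw [if_neg h, if_neg (fun h' => h (dvd_trans ⟨(b : ℕ) ^ k, by simp⟩ h'))]

theorem infProd_eq {b : ℕ+} (hb : 2 ≤ b) {g : RatFunc F}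
    (hg : RatFunc.eval (RingHom.id F) 0 g = 1) :
    infProd b g = invSeries g * PowerSeries.expand b b.ne_zero (infProd b g) := by
  ext n
  -- With `n + 2` factors, `n + 1` remain after splitting one off, enough for all coefficients up to
  -- `n` to have stabilised.
  rw [← coeff_partialProd hb hg (show n < n + 1 + 1 by omega), partialProd_succ,
    PowerSeries.coeff_mul, PowerSeries.coeff_mul]
  refine Finset.sum_congr rfl fun x hx => ?_
  congr 1
  rw [PowerSeries.coeff_expand, PowerSeries.coeff_expand]
  split_ifs with h
  · apply coeff_partialProd hb hg
    have h1 := Finset.HasAntidiagonal.mem_antidiagonal.1 hx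
    have h2 := Nat.div_le_self x.2 b
    omega
  · rfl

theorem mahlerP_powerSeriesAt (b q : ℕ+) (s : PowerSeries F) :
    mahlerP F b (powerSeriesAt 1 q s) = powerSeriesAt 1 q (PowerSeries.expand b b.ne_zero s) := by
  have hb : (b : ℚ) ≠ 0 := by exact_mod_cast b.ne_zero
  have hq : (q : ℚ) ≠ 0 := by exact_mod_cast q.ne_zero
  refine puiseux_ext fun a => ?_
  rw [coeff_mahlerP]
  by_cases h : ∃ n : ℕ, a / b = (n : ℚ) / q
  · obtain ⟨n, hn⟩ := h
    have ha : a = ((b * n : ℕ) : ℚ) / q := by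
      rw [div_eq_iff hb] at hn
      rw [hn]; push_cast; ring
    rw [hn, coeff_powerSeriesAt, ha, coeff_powerSeriesAt, PowerSeries.coeff_expand,
      if_pos (Dvd.intro _ rfl), Nat.mul_div_cancel_left _ b.pos]
  · push Not at h
    rw [coeff_powerSeriesAt_eq_zero q s h]
    by_cases h' : ∃ n : ℕ, a = (n : ℚ) / q
    · obtain ⟨n, rfl⟩ := h'
      rw [coeff_powerSeriesAt, PowerSeries.coeff_expand, if_neg]
      rintro ⟨m, rfl⟩
      apply h m
      push_cast
      field_simp
    · push Not at h'
      rw [coeff_powerSeriesAt_eq_zero q _ h']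

theorem powerSeriesAt_mul (m q : ℕ+) (s t : PowerSeries F) :
    powerSeriesAt m q (s * t) = powerSeriesAt m q s * powerSeriesAt m q t := by
  simp only [powerSeriesAt, map_mul]

theorem ratHom_mul_invSeries (q : ℕ+) {g : RatFunc F}
    (hg : RatFunc.eval (RingHom.id F) 0 g = 1) :
    ratHom F 1 q g * powerSeriesAt 1 q (invSeries g) = 1 := by
  have hn : PowerSeries.constantCoeff (g.num : PowerSeries F) ≠ 0 := by
    intro h0
    have := constantCoeff_invSeries hg
    simp [invSeries] at this
    simp at h0
    simp [h0] at this
  have h1 : (g.num : PowerSeries F) * (g.num : PowerSeries F)⁻¹ = 1 :=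
    PowerSeries.mul_inv_cancel _ hn
  have hden : ratHom F 1 q (algebraMap _ _ g.denom) ≠ 0 :=
    ratHom_ne_zero 1 q (RatFunc.algebraMap_ne_zero g.denom_ne_zero)
  have h2 : ratHom F 1 q g
      = powerSeriesAt 1 q (g.num : PowerSeries F) / powerSeriesAt 1 q (g.denom : PowerSeries F) := by
    conv_lhs => rw [← RatFunc.num_div_denom g]
    rw [map_div₀, ratHom_polynomial_eq_powerSeriesAt, ratHom_polynomial_eq_powerSeriesAt]
  rw [ratHom_polynomial_eq_powerSeriesAt] at hden
  rw [h2, invSeries, powerSeriesAt_mul, ← mul_assoc, div_mul_cancel₀ _ hden, ← powerSeriesAt_mul,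
    h1]
  simp [powerSeriesAt]

theorem mahlerP_infProd {b : ℕ+} (hb : 2 ≤ b) (q : ℕ+) {g : RatFunc F}
    (hg : RatFunc.eval (RingHom.id F) 0 g = 1) :
    mahlerP F b (powerSeriesAt 1 q (infProd b g))
      = ratHom F 1 q g * powerSeriesAt 1 q (infProd b g) := by
  conv_rhs => rw [infProd_eq hb hg]
  rw [powerSeriesAt_mul, ← mul_assoc, ratHom_mul_invSeries q hg, one_mul, mahlerP_powerSeriesAt]

theorem ordP_infProd {b : ℕ+} (q : ℕ+) {g : RatFunc F}
    (hg : RatFunc.eval (RingHom.id F) 0 g = 1) :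
    ordP (powerSeriesAt 1 q (infProd b g)) = 0 := by
  have hq : (0 : ℚ) < q := by exact_mod_cast q.pos
  apply ordP_eq
  · have := coeff_powerSeriesAt q (infProd b g) 0
    rw [Nat.cast_zero, zero_div] at this
    rw [this, constantCoeff_infProd hg]
    exact one_ne_zero
  · intro e he
    apply coeff_powerSeriesAt_eq_zero
    rintro n rfl
    exact absurd he (not_lt.2 (by positivity))

theorem lcP_infProd {b : ℕ+} (q : ℕ+) {g : RatFunc F}
    (hg : RatFunc.eval (RingHom.id F) 0 g = 1) :
    lcP (powerSeriesAt 1 q (infProd b g)) = 1 := by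
  have := coeff_powerSeriesAt q (infProd b g) 0
  rw [Nat.cast_zero, zero_div] at this
  rw [lcP, ordP_infProd q hg, this, constantCoeff_infProd hg]

theorem infProd_ne_zero {b : ℕ+} (q : ℕ+) {g : RatFunc F}
    (hg : RatFunc.eval (RingHom.id F) 0 g = 1) : powerSeriesAt 1 q (infProd b g) ≠ 0 := by
  intro h
  have := lcP_infProd (b := b) q hg
  rw [h] at this
  exact zero_ne_one this

theorem hasRamification_powerSeriesAt (q : ℕ+) (s : PowerSeries F) :
    HasRamification q (powerSeriesAt 1 q s).1 := hasRamification_laurent q _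

/-- The quotient of the two solutions is fixed by `M`, hence constant, and the leading coefficients
fix the constant. -/
theorem eq_infProd {b : ℕ+} (hb : 2 ≤ b) {q : ℕ+} {g : RatFunc F}
    (hg : RatFunc.eval (RingHom.id F) 0 g = 1) {w : Puiseux F} (hl : lcP w = 1)
    (hw : mahlerP F b w = ratHom F 1 q g * w) : w = powerSeriesAt 1 q (infProd b g) := by
  have hg0 : g ≠ 0 := by
    rintro rfl
    simp at hg
  have hw0 : powerSeriesAt 1 q (infProd b g) ≠ 0 := infProd_ne_zero q hg
  have h1 : mahlerP F b (w / powerSeriesAt 1 q (infProd b g))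
      = w / powerSeriesAt 1 q (infProd b g) := by
    rw [map_div₀, hw, mahlerP_infProd hb q hg, mul_div_mul_left _ _ (ratHom_ne_zero 1 q hg0)]
  obtain ⟨c, hc⟩ := eq_algebraMap_of_mahlerP_eq hb h1
  rw [div_eq_iff hw0] at hc
  have h2 := congrArg lcP hc
  rw [lcP_mul, hl, lcP_algebraMap, lcP_infProd q hg, mul_one] at h2
  rw [hc, ← h2, map_one, one_mul]

/-! ### First-order equations -/

theorem monomialP_zpow (a : ℚ) (n : ℤ) : (monomialP a (1 : F)) ^ n = monomialP (n * a) 1 := by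
  rcases n with n | n
  · simpa using monomialP_pow a n
  · rw [zpow_negSucc, monomialP_pow]
    refine inv_eq_of_mul_eq_one_right ?_
    rw [monomialP_mul, Int.cast_negSucc, neg_mul, add_neg_cancel, mul_one]
    rfl

/-- Write `u = c x^a f₁` with `f₁(0) = 1`. The three factors are accounted for by `e_c`, by
`x^(a/(b-1))`, since `b a/(b-1) = a + a/(b-1)`, and by the infinite product of `f₁`. -/
theorem exists_mahlerP_eq {b : ℕ+} (hb : 2 ≤ b) {u : Puiseux F} (hu : u ∈ ramRatField F)
    (hu0 : u ≠ 0) :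
    ∃ (lam : Fˣ) (p : Puiseux F), p ≠ 0 ∧ algebraMap F _ (lam : F) * mahlerP F b p = u * p := by
  obtain ⟨q, f, rfl⟩ := hu
  rw [ratAt_eq] at hu0 ⊢
  set u := ratHom F 1 q f with hu
  have hlc := lcP_ne_zero hu0
  obtain ⟨n, hn⟩ := hasRamification_ratHom q f _ (show u.1.coeff (ordP u) ≠ 0 from hlc)
  have hb' : (b : ℚ) - 1 ≠ 0 := by
    have : (2 : ℚ) ≤ b := by exact_mod_cast hb
    intro h
    linarith
  have hX : ∀ n : ℤ, ratHom F 1 q (RatFunc.X ^ n) = monomialP (n / q : ℚ) 1 := by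
    intro n
    rw [map_zpow₀, ratHom_X, monomialP_zpow]
    congr 1
    simp only [PNat.val_ofNat, Nat.cast_one]
    ring
  let f₁ := f * RatFunc.X ^ (-n) * RatFunc.C (lcP u)⁻¹
  have hf₁ : ratHom F 1 q f₁ = u * (monomialP (-ordP u) 1 * algebraMap F _ (lcP u)⁻¹) := by
    simp only [f₁]
    rw [map_mul, map_mul, hX, ratHom_C, hn, mul_assoc, ← hu]
    congr 4
    push_cast; ring
  have hm0 : monomialP (-ordP u) (1 : F) ≠ 0 := monomialP_ne_zero one_ne_zero
  have hl0 : algebraMap F (Puiseux F) (lcP u)⁻¹ ≠ 0 := by simpa using hlc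
  have hf₁0 : f₁ ≠ 0 := by
    intro h
    rw [h, map_zero] at hf₁
    exact mul_ne_zero hu0 (mul_ne_zero hm0 hl0) hf₁.symm
  have hmono : monomialP (-ordP u) 1 * algebraMap F _ (lcP u)⁻¹
      = monomialP (-ordP u) (lcP u)⁻¹ := by
    rw [algebraMap_eq_monomialP, monomialP_mul, add_zero, one_mul]
  have hinv : u = monomialP (ordP u) (lcP u) * ratHom F 1 q f₁ := by
    rw [hf₁, hmono, mul_left_comm, monomialP_mul, add_neg_cancel, mul_inv_cancel₀ hlc]
    exact (mul_one u).symm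
  have hmo : ordP (monomialP (-ordP u) (lcP u)⁻¹) = -ordP u :=
    HahnSeries.order_single (inv_ne_zero hlc)
  have hml : lcP (monomialP (-ordP u) (lcP u)⁻¹) = (lcP u)⁻¹ := by
    rw [lcP, hmo, coeff_monomialP, if_pos rfl]
  have heval := eval_zero_eq_one hf₁0 (q := q)
    (by rw [hf₁, hmono, ordP_mul hu0 (monomialP_ne_zero (inv_ne_zero hlc)), hmo, add_neg_cancel])
    (by rw [hf₁, hmono, lcP_mul, hml, mul_inv_cancel₀ hlc])
  refine ⟨Units.mk0 _ hlc, monomialP (ordP u / (b - 1)) 1 * powerSeriesAt 1 q (infProd b f₁),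
    mul_ne_zero (monomialP_ne_zero one_ne_zero) (infProd_ne_zero q heval), ?_⟩
  rw [map_mul, mahlerP_infProd hb q heval, mahlerP, subst_monomialP, Units.val_mk0]
  have e : algebraMap F _ (lcP u) * monomialP (((b : ℚ) / ((1 : ℕ+) : ℚ)) * (ordP u / (b - 1))) 1
      = monomialP (ordP u) (lcP u) * monomialP (ordP u / (b - 1)) 1 := by
    rw [algebraMap_eq_monomialP, monomialP_mul, monomialP_mul]
    congr 1
    simp only [PNat.val_ofNat, Nat.cast_one, div_one]
    field_simp
    ring
  have h : ∀ z, u * z = monomialP (ordP u) (lcP u) * ratHom F 1 q f₁ * z := fun z => by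
    rw [← hinv]
  rw [← mul_assoc, e, h]
  ring

end RatFunc

/-! ### Extension of the field of constants -/

section Extension

variable {F G : Type*} [Field F] [Field G] [Algebra F G]

/-- The inclusion of Puiseux series over `F` in those over an extension `G` of `F`. -/
def mapP (F G : Type*) [Field F] [Field G] [Algebra F G] : Puiseux F →+ Puiseux G where
  toFun y := ⟨y.1.map (algebraMap F G), by
    obtain ⟨q, hq⟩ := y.2
    refine ⟨q, fun a ha => hq a fun h => ha ?_⟩
    change algebraMap F G (y.1.coeff a) = 0
    rw [h, map_zero]⟩
  map_zero' := puiseux_ext fun a => map_zero (algebraMap F G)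
  map_add' y z := puiseux_ext fun a => map_add (algebraMap F G) (y.1.coeff a) (z.1.coeff a)

theorem coeff_mapP (y : Puiseux F) (a : ℚ) :
    (mapP F G y).1.coeff a = algebraMap F G (y.1.coeff a) := rfl

theorem mapP_mahlerP (b : ℕ+) (y : Puiseux F) :
    mapP F G (mahlerP F b y) = mahlerP G b (mapP F G y) :=
  puiseux_ext fun a => by rw [coeff_mapP, coeff_mahlerP, coeff_mahlerP, coeff_mapP]

theorem mapP_mahlerP_iterate (b : ℕ+) (k : ℕ) (y : Puiseux F) :
    mapP F G ((mahlerP F b)^[k] y) = (mahlerP G b)^[k] (mapP F G y) := by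
  induction k with
  | zero => rfl
  | succ k ih => rw [Function.iterate_succ_apply', mapP_mahlerP, ih, Function.iterate_succ_apply']

theorem mapP_monomialP_mul (a : ℚ) (c : F) (y : Puiseux F) :
    mapP F G (monomialP a c * y) = monomialP a (algebraMap F G c) * mapP F G y :=
  puiseux_ext fun e => by
    rw [coeff_mapP, coeff_monomialP_mul, map_mul, coeff_monomialP_mul, coeff_mapP]

variable {K : Type*} [Field K] [Algebra K F] [Algebra K G] [IsScalarTower K F G]

/-- `mapP` is defined as an additive map only; compatibility with multiplication is needed for
polynomial coefficients alone and is obtained monomial by monomial. -/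
theorem mapP_polyCoeff_mul (P : Polynomial K) (y : Puiseux F) :
    mapP F G (polyCoeff F P * y) = polyCoeff G P * mapP F G y := by
  induction P using Polynomial.induction_on' with
  | add P Q hP hQ => rw [polyCoeff_add, polyCoeff_add, add_mul, add_mul, map_add, hP, hQ]
  | monomial n c =>
    rw [polyCoeff_monomial, polyCoeff_monomial, mapP_monomialP_mul,
      ← IsScalarTower.algebraMap_apply K F G]

theorem mapP_twistedOp (b : ℕ+) (r : ℕ) (l : ℕ → Polynomial K) (lam : F) (p : Puiseux F) :
    mapP F G (twistedOp b r l lam p) = twistedOp b r l (algebraMap F G lam) (mapP F G p) := by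
  rw [twistedOp_apply, twistedOp_apply, map_sum]
  refine Finset.sum_congr rfl fun k _ => ?_
  rw [mapP_polyCoeff_mul, ← map_pow, ← map_pow, algebraMap_eq_monomialP, mapP_monomialP_mul,
    mapP_mahlerP_iterate, map_pow, algebraMap_eq_monomialP]

theorem mapP_ne_zero {y : Puiseux F} (hy : y ≠ 0) : mapP F G y ≠ 0 := by
  intro h
  apply lcP_ne_zero hy
  have := congrArg (fun z : Puiseux G => z.1.coeff (ordP y)) h
  simp only [coeff_mapP] at this
  exact (map_eq_zero (algebraMap F G)).1 this

/-- The set `Λ'` refers to solutions over the larger field, so a solution over `F` is carried there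
coefficientwise. -/
theorem algebraMap_mem_Lam' {b : ℕ+} (hb : 2 ≤ b) {r : ℕ} {l : ℕ → Polynomial K} (hl0 : l 0 ≠ 0)
    (lam : Fˣ) {p : Puiseux F} (hp : p ≠ 0) (h : twistedOp b r l (lam : F) p = 0) :
    algebraMap F G (lam : F) ∈ Lam' b r l G := by
  have hlam : algebraMap F G (lam : F) ≠ 0 := by simp
  have hsol : twistedOp b r l (algebraMap F G (lam : F)) (mapP F G p) = 0 := by
    rw [← mapP_twistedOp, h, map_zero]
  obtain ⟨k₁, k₂, hadm, -⟩ := exists_isAdmissible hb hl0 hlam (mapP_ne_zero hp) hsol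
  refine ⟨⟨k₁, k₂, hadm⟩, Units.mk0 _ hlam, rfl, mapP F G p, mapP_ne_zero hp, ?_⟩
  rw [applyL_single_eq_zero_iff]
  exact hsol

end Extension

/-! ### Reduced echelon bases of spaces of Laurent polynomials -/

section Echelon

variable {F : Type*} [Field F]

/-- The nonzero Laurent polynomial `f` has order `n`. -/
def HasOrder (f : LaurentPolynomial F) (n : ℤ) : Prop :=
  f.coeff n ≠ 0 ∧ ∀ m < n, f.coeff m = 0

theorem exists_hasOrder {f : LaurentPolynomial F} (hf : f ≠ 0) : ∃ n, HasOrder f n := by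
  have hne : f.coeff.support.Nonempty := by
    rw [Finsupp.support_nonempty_iff]
    exact fun h => hf (AddMonoidAlgebra.coeff_eq_zero.1 h)
  refine ⟨f.coeff.support.min' hne, Finsupp.mem_support_iff.1 (Finset.min'_mem _ hne), ?_⟩
  intro m hm
  by_contra h
  exact absurd (Finset.min'_le _ m (Finsupp.mem_support_iff.2 h)) (not_le.2 hm)

theorem HasOrder.unique {f : LaurentPolynomial F} {n m : ℤ} (hn : HasOrder f n)
    (hm : HasOrder f m) : n = m := by
  rcases lt_trichotomy n m with h | h | h
  · exact absurd (hm.2 n h) hn.1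
  · exact h
  · exact absurd (hn.2 m h) hm.1

/-- The coefficient of `x^n` as a linear form on Laurent polynomials. -/
def coeffForm (F : Type*) [Field F] (n : ℤ) : LaurentPolynomial F →ₗ[F] F where
  toFun f := f.coeff n
  map_add' f g := by simp
  map_smul' c f := by simp

theorem coeffForm_apply (n : ℤ) (f : LaurentPolynomial F) : coeffForm F n f = f.coeff n := rfl

theorem coeff_sum_smul {ι : Type*} (s : Finset ι) (c : ι → F) (f : ι → LaurentPolynomial F) (n : ℤ) :
    (∑ i ∈ s, c i • f i).coeff n = ∑ i ∈ s, c i * (f i).coeff n := by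
  rw [← coeffForm_apply, map_sum]
  exact Finset.sum_congr rfl fun i _ => by rw [map_smul, smul_eq_mul, coeffForm_apply]

/-- In a nontrivial relation the term of lowest order cannot cancel. -/
theorem linearIndependent_of_hasOrder {ι : Type*} [LinearOrder ι] [Fintype ι]
    (f : ι → LaurentPolynomial F) (n : ι → ℤ) (hn : StrictMono n)
    (hf : ∀ i, HasOrder (f i) (n i)) : LinearIndependent F f := by
  classical
  rw [Fintype.linearIndependent_iff]
  intro c hc
  by_contra hcon
  push Not at hcon
  have hne : (Finset.univ.filter fun i => c i ≠ 0).Nonempty := by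
    obtain ⟨i, hi⟩ := hcon
    exact ⟨i, by simpa using hi⟩
  set i₀ := (Finset.univ.filter fun i => c i ≠ 0).min' hne with hi₀
  have hci : c i₀ ≠ 0 := by
    have := Finset.min'_mem _ hne
    simpa using this
  have h1 := congrArg (fun g : LaurentPolynomial F => g.coeff (n i₀)) hc
  simp only [coeff_sum_smul] at h1
  rw [Finset.sum_eq_single i₀] at h1
  · exact mul_ne_zero hci (hf i₀).1 h1
  · intro j _ hj
    rcases lt_or_gt_of_ne hj with h | h
    · have : c j = 0 := by
        by_contra hcj
        exact absurd (Finset.min'_le _ j (by simpa using hcj)) (not_le.2 h)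
      rw [this, zero_mul]
    · rw [(hf j).2 _ (hn h), mul_zero]
  · simp

theorem IsReducedEchelon.linearIndependent {s : ℕ} {p : Fin s → LaurentPolynomial F}
    (h : IsReducedEchelon p) : LinearIndependent F p := by
  obtain ⟨v, hv, hp⟩ := h
  refine linearIndependent_of_hasOrder p v hv fun i => ⟨?_, (hp i).1⟩
  rw [(hp i).2.1]
  exact one_ne_zero

/-- The pivots are the orders of the nonzero elements of `V`. There are at most `dim V` of them, and
a nonzero element has a nonzero coefficient at its own order, so reading the coefficients at the
pivots is an isomorphism. The preimage of the standard basis is the echelon basis. -/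
theorem exists_isReducedEchelon (V : Submodule F (LaurentPolynomial F)) [FiniteDimensional F V] :
    ∃ (s : ℕ) (p : Fin s → LaurentPolynomial F),
      IsReducedEchelon p ∧ Submodule.span F (Set.range p) = V := by
  classical
  let S : Set ℤ := {n | ∃ f ∈ V, HasOrder f n}
  have hbound : ∀ T : Finset ℤ, (T : Set ℤ) ⊆ S → T.card ≤ Module.finrank F V := by
    intro T hT
    choose f hfV hf using fun n : T => hT n.2
    have h1 : LinearIndependent F f :=
      linearIndependent_of_hasOrder f (fun n => (n : ℤ)) (fun _ _ h => h) hf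
    have h2 : LinearIndependent F (fun n : T => (⟨f n, hfV n⟩ : V)) :=
      LinearIndependent.of_comp V.subtype h1
    simpa using h2.fintype_card_le_finrank
  have hfin : S.Finite := by
    by_contra hinf
    obtain ⟨T, hTS, hT⟩ := (show S.Infinite from hinf).exists_subset_card_eq
      (Module.finrank F V + 1)
    have := hbound T hTS
    omega
  let T := hfin.toFinset
  have hT : ∀ n, n ∈ T ↔ n ∈ S := fun n => hfin.mem_toFinset
  let Φ : V →ₗ[F] (T → F) := LinearMap.pi fun n => (coeffForm F (n : ℤ)).comp V.subtype
  have hΦ : ∀ (f : V) (n : T), Φ f n = (f : LaurentPolynomial F).coeff n := fun f n => rfl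
  have hinj : Function.Injective Φ := by
    rw [← LinearMap.ker_eq_bot, LinearMap.ker_eq_bot']
    intro f hf
    by_contra hne
    obtain ⟨n, hn⟩ := exists_hasOrder (fun h => hne (Subtype.ext h) : (f : LaurentPolynomial F) ≠ 0)
    have := congrFun hf ⟨n, (hT n).2 ⟨f, f.2, hn⟩⟩
    exact hn.1 this
  have hdim : Module.finrank F V = Module.finrank F (T → F) := by
    apply le_antisymm (LinearMap.finrank_le_finrank_of_injective hinj)
    rw [Module.finrank_fintype_fun_eq_card, Fintype.card_coe]
    exact hbound T fun n hn => (hT n).1 hn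
  have hsurj : Function.Surjective Φ :=
    (LinearMap.injective_iff_surjective_of_finrank_eq_finrank hdim).1 hinj
  choose e he using fun n : T => hsurj (Pi.single n 1)
  have hcoef : ∀ n m : T, (e n : LaurentPolynomial F).coeff m = if m = n then 1 else 0 := by
    intro n m
    rw [← hΦ, he, Pi.single_apply]
  let v := T.orderIsoOfFin rfl
  refine ⟨T.card, fun i => (e (v i) : LaurentPolynomial F),
    ⟨fun i => (v i : ℤ), fun i j h => (v.strictMono h : _), fun i => ⟨?_, ?_, ?_⟩⟩, ?_⟩
  -- The order of `e (v i)` is a pivot at which it does not vanish, and `v i` is the only one.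
  · have hne : (e (v i) : LaurentPolynomial F) ≠ 0 := by
      intro h
      have := hcoef (v i) (v i)
      rw [h, if_pos rfl] at this
      exact zero_ne_one this
    obtain ⟨n, hn⟩ := exists_hasOrder hne
    have h1 := hcoef (v i) ⟨n, (hT n).2 ⟨_, (e (v i)).2, hn⟩⟩
    have h2 : (⟨n, (hT n).2 ⟨_, (e (v i)).2, hn⟩⟩ : T) = v i := by
      by_contra h
      rw [if_neg h] at h1
      exact hn.1 h1
    have h3 : n = v i := congrArg Subtype.val h2
    intro m hm
    exact hn.2 m (h3 ▸ hm)
  · rw [hcoef, if_pos rfl]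
  · intro j hj
    rw [hcoef, if_neg]
    intro h
    exact hj (v.injective h).symm
  · apply le_antisymm
    · rw [Submodule.span_le]
      rintro _ ⟨i, rfl⟩
      exact (e (v i)).2
    · intro f hf
      have : (⟨f, hf⟩ : V) = ∑ n : T, f.coeff n • e n := by
        apply hinj
        rw [map_sum]
        funext m
        rw [Finset.sum_apply, Finset.sum_eq_single m]
        · rw [map_smul, he, hΦ]; simp
        · intro n _ hn
          rw [map_smul, he, Pi.smul_apply, Pi.single_eq_of_ne (Ne.symm hn), smul_zero]
        · simp
      have h2 := congrArg V.subtype this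
      rw [map_sum] at h2
      change f = _ at h2
      rw [h2]
      refine Submodule.sum_mem _ fun n _ => ?_
      rw [map_smul]
      refine Submodule.smul_mem _ _ (Submodule.subset_span ⟨v.symm n, ?_⟩)
      simp

theorem IsReducedEchelon.eq_sum {s : ℕ} {p : Fin s → LaurentPolynomial F} {v : Fin s → ℤ}
    (hp : ∀ i, (∀ n < v i, (p i).coeff n = 0) ∧ (p i).coeff (v i) = 1 ∧
      ∀ j ≠ i, (p j).coeff (v i) = 0) {f : LaurentPolynomial F}
    (hf : f ∈ Submodule.span F (Set.range p)) : f = ∑ i, f.coeff (v i) • p i := by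
  obtain ⟨c, rfl⟩ := (Submodule.mem_span_range_iff_exists_fun F).1 hf
  refine Finset.sum_congr rfl fun i _ => ?_
  congr 1
  rw [coeff_sum_smul, Finset.sum_eq_single i]
  · rw [(hp i).2.1, mul_one]
  · intro j _ hj
    rw [(hp i).2.2 j hj, mul_zero]
  · simp

/-- This makes the pivots depend on the span only, the key to uniqueness. -/
theorem IsReducedEchelon.range_eq {s : ℕ} {p : Fin s → LaurentPolynomial F} {v : Fin s → ℤ}
    (hp : ∀ i, (∀ n < v i, (p i).coeff n = 0) ∧ (p i).coeff (v i) = 1 ∧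
      ∀ j ≠ i, (p j).coeff (v i) = 0) :
    Set.range v = {n | ∃ f ∈ Submodule.span F (Set.range p), HasOrder f n} := by
  ext n
  constructor
  · rintro ⟨i, rfl⟩
    refine ⟨p i, Submodule.subset_span ⟨i, rfl⟩, ?_, (hp i).1⟩
    rw [(hp i).2.1]
    exact one_ne_zero
  · rintro ⟨f, hf, hn⟩
    have hsum := IsReducedEchelon.eq_sum hp hf
    by_contra hnot
    have hc : ∀ i, v i ≤ n → f.coeff (v i) = 0 := fun i hi =>
      hn.2 _ (lt_of_le_of_ne hi fun h => hnot ⟨i, h⟩)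
    apply hn.1
    rw [hsum, coeff_sum_smul]
    refine Finset.sum_eq_zero fun i _ => ?_
    rcases le_or_gt (v i) n with h | h
    · rw [hc i h, zero_mul]
    · rw [(hp i).1 n h, mul_zero]

theorem IsReducedEchelon.unique {s s' : ℕ} {p : Fin s → LaurentPolynomial F}
    {p' : Fin s' → LaurentPolynomial F} (h : IsReducedEchelon p) (h' : IsReducedEchelon p')
    (hspan : Submodule.span F (Set.range p) = Submodule.span F (Set.range p')) :
    s = s' ∧ HEq p p' := by
  obtain ⟨v, hv, hp⟩ := h
  obtain ⟨v', hv', hp'⟩ := h'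
  have hr : Set.range v = Set.range v' := by
    rw [IsReducedEchelon.range_eq hp, IsReducedEchelon.range_eq hp', hspan]
  have hs : s = s' := by
    have h1 := Set.ncard_range_of_injective hv.injective
    have h2 := Set.ncard_range_of_injective hv'.injective
    rw [hr, h2] at h1
    simpa using h1.symm
  subst hs
  refine ⟨rfl, heq_of_eq (funext fun i => ?_)⟩
  obtain rfl := (StrictMono.range_inj hv hv').1 hr
  have h1 := IsReducedEchelon.eq_sum hp
    (hspan ▸ Submodule.subset_span ⟨i, rfl⟩ : p' i ∈ Submodule.span F (Set.range p))
  rw [h1, Finset.sum_eq_single i]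
  · rw [(hp' i).2.1, one_smul]
  · intro j _ hj
    rw [(hp' j).2.2 i (Ne.symm hj), zero_smul]
  · simp

end Echelon

/-! ### Coprime families and their rational multiples -/

section Coprime

variable {F : Type*} [Field F]

/-- Clear denominators and divide by a generator of the ideal of the numerators; the Bézout
coefficients `a` witness coprimality and survive the passage to Laurent polynomials. -/
theorem exists_coprime_family {n : ℕ} (f : Fin n → RatFunc F) (hf : ∃ i, f i ≠ 0) :
    ∃ (c : RatFunc F) (m a : Fin n → Polynomial F), c ≠ 0 ∧
      (∀ i, f i = c * algebraMap _ _ (m i)) ∧ ∑ i, a i * m i = 1 := by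
  obtain ⟨⟨d, hd⟩, hint⟩ := IsLocalization.exist_integer_multiples_of_finite
    (nonZeroDivisors (Polynomial F)) f
  have hd0 : d ≠ 0 := nonZeroDivisors.ne_zero hd
  choose N hN using hint
  have hN' : ∀ i, algebraMap (Polynomial F) (RatFunc F) (N i) = algebraMap _ _ d * f i := by
    intro i
    rw [hN]
    exact Algebra.smul_def d (f i)
  have hd0' : algebraMap (Polynomial F) (RatFunc F) d ≠ 0 := RatFunc.algebraMap_ne_zero hd0
  let J := Ideal.span (Set.range N)
  obtain ⟨γ, hγ⟩ := (inferInstance : J.IsPrincipal)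
  have hγ' : J = Ideal.span {γ} := hγ
  have hγ0 : γ ≠ 0 := by
    rintro rfl
    obtain ⟨i, hi⟩ := hf
    have h1 : N i ∈ J := Ideal.subset_span ⟨i, rfl⟩
    rw [hγ', Ideal.mem_span_singleton, zero_dvd_iff] at h1
    have h2 := hN' i
    rw [h1, map_zero] at h2
    exact mul_ne_zero hd0' hi h2.symm
  have hdvd : ∀ i, ∃ m, N i = γ * m := fun i => by
    have h1 : N i ∈ J := Ideal.subset_span ⟨i, rfl⟩
    rwa [hγ', Ideal.mem_span_singleton] at h1
  choose m hm using hdvd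
  have hmem : γ ∈ J := by rw [hγ']; exact Ideal.mem_span_singleton_self γ
  obtain ⟨a, ha⟩ := (Ideal.mem_span_range_iff_exists_fun).1 hmem
  refine ⟨algebraMap _ _ γ / algebraMap _ _ d, m, a,
    div_ne_zero (RatFunc.algebraMap_ne_zero hγ0) hd0', fun i => ?_, ?_⟩
  · rw [div_mul_eq_mul_div, eq_div_iff hd0', ← map_mul, ← hm, hN', mul_comm]
  · apply mul_left_cancel₀ hγ0
    rw [mul_one, Finset.mul_sum]
    conv_rhs => rw [← ha]
    exact Finset.sum_congr rfl fun i _ => by rw [hm]; ring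

/-- After multiplication by powers of `T`, a unit and its inverse become polynomials whose product
is a power of the prime `X`. -/
theorem exists_monomialP_of_isUnit (q : ℕ+) {m : LaurentPolynomial F} (hm : IsUnit m) :
    ∃ (e : ℚ) (c : F), laurentHom F 1 q m = monomialP e c := by
  obtain ⟨m', hm'⟩ := hm.exists_right_inv
  obtain ⟨k, P, hP⟩ := m.exists_T_pow
  obtain ⟨k', P', hP'⟩ := m'.exists_T_pow
  have hmul : P * P' = Polynomial.X ^ (k + k') := by
    apply Polynomial.toLaurent_injective
    rw [map_mul, hP, hP', Polynomial.toLaurent_X_pow, mul_mul_mul_comm, hm', one_mul,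
      ← LaurentPolynomial.T_add]
    push_cast; rfl
  obtain ⟨j, -, hj⟩ := (dvd_prime_pow Polynomial.prime_X _).1 (Dvd.intro _ hmul)
  obtain ⟨u, hu⟩ := hj.symm
  obtain ⟨c, hc, hcu⟩ := Polynomial.isUnit_iff.1 u.isUnit
  have hm2 : m = LaurentPolynomial.C c * LaurentPolynomial.T ((j : ℤ) - k) := by
    have h1 : m = Polynomial.toLaurent P * LaurentPolynomial.T (-k) := by
      rw [hP, mul_assoc, ← LaurentPolynomial.T_add]
      simp
    rw [h1, ← hu, ← hcu, map_mul, Polynomial.toLaurent_C, Polynomial.toLaurent_X_pow,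
      sub_eq_add_neg, LaurentPolynomial.T_add]
    ring
  rw [hm2, ← LaurentPolynomial.single_eq_C_mul_T, ← laurentPolyAt_eq, laurentPolyAt_single]
  exact ⟨_, c, rfl⟩

/-- In lowest terms `ρ = A/B`, the hypothesis gives `B ∣ A p_j`, so `B` divides all `p_j` and is a
unit. -/
theorem exists_laurentHom_eq {q : ℕ+} {s : ℕ} {p : Fin s → LaurentPolynomial F}
    (hcop : ∀ c : LaurentPolynomial F, (∀ j, c ∣ p j) → IsUnit c) (ρ : RatFunc F)
    (h : ∀ j, ∃ m, laurentHom F 1 q m = ratHom F 1 q ρ * laurentHom F 1 q (p j)) :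
    ∃ μ, laurentHom F 1 q μ = ratHom F 1 q ρ := by
  set B := Polynomial.toLaurent ρ.denom with hB
  set A := Polynomial.toLaurent ρ.num with hA
  have hden : laurentHom F 1 q B ≠ 0 := by
    rw [hB, laurentHom_toLaurent]
    exact ratHom_ne_zero 1 q (RatFunc.algebraMap_ne_zero ρ.denom_ne_zero)
  have hρ : ratHom F 1 q ρ = laurentHom F 1 q A / laurentHom F 1 q B := by
    conv_lhs => rw [← RatFunc.num_div_denom ρ]
    rw [map_div₀, hA, hB, laurentHom_toLaurent, laurentHom_toLaurent]
  have hABcop : IsCoprime B A := (RatFunc.isCoprime_num_denom ρ).symm.map Polynomial.toLaurent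
  have hunit : IsUnit B := by
    apply hcop
    intro j
    obtain ⟨m, hm⟩ := h j
    refine hABcop.dvd_of_dvd_mul_left (Dvd.intro m (laurentHom_injective q ?_))
    rw [map_mul, map_mul, hm, hρ]
    field_simp
  obtain ⟨B', hB'⟩ := hunit.exists_right_inv
  refine ⟨A * B', ?_⟩
  have h1 : laurentHom F 1 q B * laurentHom F 1 q B' = 1 := by rw [← map_mul, hB', map_one]
  rw [hρ, map_mul, eq_div_iff hden, mul_assoc, mul_comm (laurentHom F 1 q B'), h1, mul_one]

/-- Both `ρ` and `ρ⁻¹` are Laurent polynomials, so `ρ` is a monomial, and its leading term is `1`.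
-/
theorem eq_one_of_coprime {q : ℕ+} {s s' : ℕ} {p : Fin s → LaurentPolynomial F}
    {p' : Fin s' → LaurentPolynomial F}
    (hcop : ∀ c : LaurentPolynomial F, (∀ j, c ∣ p j) → IsUnit c)
    (hcop' : ∀ c : LaurentPolynomial F, (∀ j, c ∣ p' j) → IsUnit c) {ρ : RatFunc F}
    (hρ : ρ ≠ 0)
    (h : ∀ j, ∃ m, laurentHom F 1 q m = ratHom F 1 q ρ * laurentHom F 1 q (p j))
    (h' : ∀ j, ∃ m, laurentHom F 1 q m = ratHom F 1 q ρ⁻¹ * laurentHom F 1 q (p' j))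
    (ho : ordP (ratHom F 1 q ρ) = 0) (hl : lcP (ratHom F 1 q ρ) = 1) : ratHom F 1 q ρ = 1 := by
  obtain ⟨μ, hμ⟩ := exists_laurentHom_eq hcop ρ h
  obtain ⟨μ', hμ'⟩ := exists_laurentHom_eq hcop' ρ⁻¹ h'
  have hunit : IsUnit μ := by
    refine IsUnit.of_mul_eq_one μ' (laurentHom_injective q ?_)
    rw [map_mul, hμ, hμ', ← map_mul, mul_inv_cancel₀ hρ, map_one, map_one]
  obtain ⟨e, c, hec⟩ := exists_monomialP_of_isUnit q hunit
  rw [hμ] at hec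
  have hc : c ≠ 0 := by
    rintro rfl
    have h0 := ratHom_ne_zero 1 q hρ
    rw [hec] at h0
    exact h0 (Subtype.ext (HahnSeries.single_eq_zero))
  have he : ordP (monomialP e c) = e := HahnSeries.order_single hc
  rw [hec, he] at ho
  rw [lcP, hec, he, coeff_monomialP, if_pos rfl] at hl
  rw [hec, ho, hl]
  rfl

end Coprime

/-! ### Hypergeometric elements and similarity -/

section Hypergeometric

variable {F : Type*} [Field F] {b : ℕ+}

theorem mahler_smul (f : Puiseux F) (y : DRing F) :
    mahler F b (f • y) = mahlerP F b f • mahler F b y := by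
  ext1
  ext1 lam
  rw [coeff_mahler, MonoidAlgebra.coeff_smul_apply, MonoidAlgebra.coeff_smul_apply, coeff_mahler,
    smul_eq_mul, smul_eq_mul, map_mul]
  ring

theorem mahler_single_eq_smul_iff (lam : Fˣ) (p u : Puiseux F) :
    mahler F b (MonoidAlgebra.single lam p) = u • MonoidAlgebra.single lam p
      ↔ algebraMap F _ (lam : F) * mahlerP F b p = u * p := by
  rw [mahler_single, MonoidAlgebra.smul_single, MonoidAlgebra.single_right_inj, smul_eq_mul]

/-- The quotient `p / p'` satisfies an equation with constant coefficients. -/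
theorem eq_smul_of_mahler_eq (hb : 2 ≤ b) {lam lam' : Fˣ} {p p' u : Puiseux F} (hp : p ≠ 0)
    (hp' : p' ≠ 0) (hu : algebraMap F _ (lam : F) * mahlerP F b p = u * p)
    (hu' : algebraMap F _ (lam' : F) * mahlerP F b p' = u * p') :
    lam = lam' ∧ ∃ c : F, p = c • p' := by
  have hM : mahlerP F b p' ≠ 0 := (map_ne_zero _).2 hp'
  have h : algebraMap F _ (lam : F) * mahlerP F b (p / p')
      = algebraMap F _ (lam' : F) * (p / p') := by
    rw [map_div₀]
    field_simp
    linear_combination p' * hu - p * hu'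
  obtain ⟨h1, c, hc⟩ := eq_algebraMap_of_mahlerP_eq_mul hb (div_ne_zero hp hp') lam.ne_zero h
  refine ⟨Units.ext h1, c, ?_⟩
  rw [Algebra.smul_def, ← hc, div_mul_cancel₀ _ hp']

/-- Every component of `y` solves a first-order equation with the same `u`, so two nonzero
components would have the same `λ`. -/
theorem exists_single_of_mahler_eq (hb : 2 ≤ b) {y : DRing F} (hy : y ≠ 0) {u : Puiseux F}
    (hu : mahler F b y = u • y) :
    ∃ (lam : Fˣ) (p : Puiseux F), p ≠ 0 ∧ y = MonoidAlgebra.single lam p := by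
  have hcoef : ∀ m : Fˣ, algebraMap F _ (m : F) * mahlerP F b (y.coeff m) = u * y.coeff m := by
    intro m
    rw [← coeff_mahler, hu, MonoidAlgebra.coeff_smul_apply, smul_eq_mul]
  obtain ⟨lam, hlam⟩ : ∃ lam, y.coeff lam ≠ 0 := by
    by_contra hcon
    push Not at hcon
    exact hy (MonoidAlgebra.coeff_eq_zero.1 (Finsupp.ext hcon))
  refine ⟨lam, y.coeff lam, hlam, ?_⟩
  ext1
  ext1 m
  rw [MonoidAlgebra.coeff_single]
  by_cases h : m = lam
  · subst h
    rw [Finsupp.single_eq_same]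
  · rw [Finsupp.single_eq_of_ne h]
    by_contra hm
    exact h (eq_smul_of_mahler_eq hb hm hlam (hcoef m) (hcoef lam)).1

theorem exists_smul_of_mahler_eq (hb : 2 ≤ b) {y z : DRing F} (hy : y ≠ 0) (hz : z ≠ 0)
    {u : Puiseux F} (hu : mahler F b y = u • y) (hu' : mahler F b z = u • z) :
    ∃ c : F, c ≠ 0 ∧ y = c • z := by
  obtain ⟨lam, p, hp, rfl⟩ := exists_single_of_mahler_eq hb hy hu
  obtain ⟨lam', p', hp', rfl⟩ := exists_single_of_mahler_eq hb hz hu'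
  rw [mahler_single_eq_smul_iff] at hu hu'
  obtain ⟨rfl, c, rfl⟩ := eq_smul_of_mahler_eq hb hp hp' hu hu'
  refine ⟨c, ?_, by rw [MonoidAlgebra.smul_single]⟩
  rintro rfl
  exact hp (zero_smul _ _)

theorem constant_smul_eq (c : F) (y : DRing F) : c • y = algebraMap F (Puiseux F) c • y := by
  ext1
  ext1 lam
  rw [MonoidAlgebra.coeff_smul_apply, MonoidAlgebra.coeff_smul_apply, Algebra.smul_def,
    smul_eq_mul]

theorem Similar.refl (y : DRing F) : Similar F y y :=
  ⟨1, (ramRatField F).one_mem, one_ne_zero, (one_smul _ _).symm⟩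

theorem Similar.symm {y z : DRing F} (h : Similar F y z) : Similar F z y := by
  obtain ⟨f, hf, hf0, rfl⟩ := h
  exact ⟨f⁻¹, (ramRatField F).inv_mem hf, inv_ne_zero hf0, (inv_smul_smul₀ hf0 _).symm⟩

theorem Similar.trans {x y z : DRing F} (h : Similar F x y) (h' : Similar F y z) :
    Similar F x z := by
  obtain ⟨f, hf, hf0, rfl⟩ := h
  obtain ⟨g, hg, hg0, rfl⟩ := h'
  exact ⟨f * g, (ramRatField F).mul_mem hf hg, mul_ne_zero hf0 hg0, smul_smul f g z⟩

theorem similar_constant_smul {c : F} (hc : c ≠ 0) (y : DRing F) : Similar F (c • y) y :=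
  ⟨algebraMap F _ c, algebraMap_mem_ramRat c, by simpa using hc, constant_smul_eq c y⟩

/-- Independence of dissimilar hypergeometric elements over the ramified rational functions, stated
so that zero elements are allowed. Normalise the coefficient of `z i₀` to `1` and compare the
relation with its image under `M`: a shorter relation results. By induction each remaining term
solves `My = u_{i₀} y`, so if nonzero it is proportional to `z i₀`, against dissimilarity. -/
theorem smul_eq_zero_of_sum_eq_zero (hb : 2 ≤ b) {ι : Type*} (T : Finset ι) (z : ι → DRing F)
    (hz : ∀ i ∈ T, IsHypergeometric F b (z i))
    (hsim : ∀ i ∈ T, ∀ j ∈ T, i ≠ j → z i ≠ 0 → z j ≠ 0 → ¬ Similar F (z i) (z j))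
    (f : ι → Puiseux F) (hf : ∀ i ∈ T, f i ∈ ramRatField F) (h : ∑ i ∈ T, f i • z i = 0) :
    ∀ i ∈ T, f i • z i = 0 := by
  classical
  induction T using Finset.induction_on generalizing f with
  | empty => simp
  | insert i₀ T hi₀ ih =>
    have ih' := ih (fun i hi => hz i (Finset.mem_insert_of_mem hi))
      (fun i hi j hj => hsim i (Finset.mem_insert_of_mem hi) j (Finset.mem_insert_of_mem hj))
    rw [Finset.sum_insert hi₀] at h
    have key : f i₀ • z i₀ = 0 := by
      by_contra hne
      have hf₀ : f i₀ ≠ 0 := fun h0 => hne (by rw [h0, zero_smul])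
      have hz₀ : z i₀ ≠ 0 := fun h0 => hne (by rw [h0, smul_zero])
      have hf₀' := hf i₀ (Finset.mem_insert_self _ _)
      choose! u hu hMu using hz
      let a : ι → Puiseux F := fun i => (f i₀)⁻¹ * f i
      have ha : ∀ i ∈ T, a i ∈ ramRatField F := fun i hi =>
        (ramRatField F).mul_mem ((ramRatField F).inv_mem hf₀') (hf i (Finset.mem_insert_of_mem hi))
      have hsum : z i₀ + ∑ i ∈ T, a i • z i = 0 := by
        have h1 := congrArg (fun y => (f i₀)⁻¹ • y) h
        simp only [smul_add, Finset.smul_sum, smul_smul, inv_mul_cancel₀ hf₀, one_smul,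
          smul_zero] at h1
        exact h1
      have hM : u i₀ • z i₀ + ∑ i ∈ T, (mahlerP F b (a i) * u i) • z i = 0 := by
        have h1 := congrArg (mahler F b) hsum
        rw [map_add, map_sum, map_zero, hMu i₀ (Finset.mem_insert_self _ _)] at h1
        rw [← h1]
        congr 1
        refine Finset.sum_congr rfl fun i hi => ?_
        rw [mahler_smul, hMu i (Finset.mem_insert_of_mem hi), smul_smul]
      have hdiff : ∑ i ∈ T, (mahlerP F b (a i) * u i - u i₀ * a i) • z i = 0 := by
        have h1 := congrArg (fun y => u i₀ • y) hsum
        simp only [smul_add, Finset.smul_sum, smul_smul, smul_zero] at h1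
        simp only [sub_smul, Finset.sum_sub_distrib]
        have h2 := sub_eq_zero.2 (hM.trans h1.symm)
        rwa [add_sub_add_left_eq_sub] at h2
      have hall := ih' _ (fun i hi => (ramRatField F).sub_mem ((ramRatField F).mul_mem
        (mahlerP_mem_ramRat b (ha i hi)) (hu i (Finset.mem_insert_of_mem hi)))
        ((ramRatField F).mul_mem (hu i₀ (Finset.mem_insert_self _ _)) (ha i hi))) hdiff
      have hzero : ∀ i ∈ T, a i • z i = 0 := by
        intro i hi
        by_contra hai
        have hi' := Finset.mem_insert_of_mem (b := i₀) hi
        have hMi : mahler F b (a i • z i) = u i₀ • (a i • z i) := by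
          have h1 := hall i hi
          rw [sub_smul, sub_eq_zero] at h1
          rw [mahler_smul, hMu i hi', smul_smul, smul_smul, h1]
        obtain ⟨c, hc, hcz⟩ := exists_smul_of_mahler_eq hb hai hz₀ hMi
          (hMu i₀ (Finset.mem_insert_self _ _))
        have hai0 : a i ≠ 0 := fun h0 => hai (by rw [h0, zero_smul])
        have hzi : z i ≠ 0 := fun h0 => hai (by rw [h0, smul_zero])
        have hs1 : Similar F (a i • z i) (z i) := ⟨a i, ha i hi, hai0, rfl⟩
        have hs2 : Similar F (a i • z i) (z i₀) := hcz ▸ similar_constant_smul hc _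
        exact hsim i hi' i₀ (Finset.mem_insert_self _ _) (fun h0 => hi₀ (h0 ▸ hi)) hzi hz₀
          (hs1.symm.trans hs2)
      rw [Finset.sum_eq_zero hzero, add_zero] at hsum
      exact hz₀ hsum
    intro i hi
    rcases Finset.mem_insert.1 hi with rfl | hi
    · exact key
    · rw [key, zero_add] at h
      exact ih' f (fun i hi => hf i (Finset.mem_insert_of_mem hi)) h i hi

end Hypergeometric

/-! ### Existence of the normal form of a similarity class -/

section Classes

variable {K : Type*} [Field K] {F : Type*} [Field F] [Algebra K F]
  {b : ℕ+} {r : ℕ} {l : ℕ → Polynomial K}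

theorem exists_single_of_mem_hypSolutions (hb : 2 ≤ b) {y : DRing F}
    (hy : y ∈ hypSolutions F b r l) :
    ∃ (lam : Fˣ) (p u : Puiseux F), p ≠ 0 ∧ y = MonoidAlgebra.single lam p ∧ u ∈ ramRatField F ∧
      algebraMap F _ (lam : F) * mahlerP F b p = u * p ∧ twistedOp b r l (lam : F) p = 0 := by
  obtain ⟨hy0, ⟨u, hu, hMu⟩, hL⟩ := hy
  obtain ⟨lam, p, hp, rfl⟩ := exists_single_of_mahler_eq hb hy0 hMu
  exact ⟨lam, p, u, hp, rfl, hu, (mahler_single_eq_smul_iff lam p u).1 hMu,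
    (applyL_single_eq_zero_iff b r l lam p).1 hL⟩

theorem mem_hypSolutions_single {lam : Fˣ} {p u : Puiseux F} (hp : p ≠ 0) (hu : u ∈ ramRatField F)
    (hM : algebraMap F _ (lam : F) * mahlerP F b p = u * p)
    (hL : twistedOp b r l (lam : F) p = 0) :
    MonoidAlgebra.single lam p ∈ hypSolutions F b r l :=
  ⟨MonoidAlgebra.single_ne_zero.2 hp, ⟨u, hu, (mahler_single_eq_smul_iff lam p u).2 hM⟩,
    (applyL_single_eq_zero_iff b r l lam p).2 hL⟩

theorem subset_hypSolutions {H : Set (DRing F)} (hH : H ∈ simClasses F b r l) :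
    H ⊆ hypSolutions F b r l := by
  obtain ⟨y, -, rfl⟩ := hH
  exact fun z hz => hz.1

theorem similar_of_mem {H : Set (DRing F)} (hH : H ∈ simClasses F b r l) {y z : DRing F}
    (hy : y ∈ H) (hz : z ∈ H) : Similar F y z := by
  obtain ⟨x, -, rfl⟩ := hH
  exact hy.2.trans hz.2.symm

theorem simClass_eq_of_similar {H H' : Set (DRing F)} (hH : H ∈ simClasses F b r l)
    (hH' : H' ∈ simClasses F b r l) {y z : DRing F} (hy : y ∈ H) (hz : z ∈ H')
    (h : Similar F y z) : H = H' := by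
  obtain ⟨x, -, rfl⟩ := hH
  obtain ⟨x', -, rfl⟩ := hH'
  have hxx' : Similar F x x' := hy.2.symm.trans (h.trans hz.2)
  ext w
  exact ⟨fun hw => ⟨hw.1, hw.2.trans hxx'⟩, fun hw => ⟨hw.1, hw.2.trans hxx'.symm⟩⟩

/-- The inclusion `p ↦ e_lam * p` of Puiseux series in the difference ring. -/
def eMul (lam : Fˣ) : Puiseux F →ₗ[F] DRing F where
  toFun p := MonoidAlgebra.single lam p
  map_add' p p' := MonoidAlgebra.single_add lam p p'
  map_smul' c p := (MonoidAlgebra.smul_single c lam p).symm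

theorem eMul_apply (lam : Fˣ) (p : Puiseux F) : eMul lam p = MonoidAlgebra.single lam p := rfl

/-- The map `m ↦ m(x^(1/q)) * w` on Laurent polynomials. -/
def laurentMul (q : ℕ+) (w : Puiseux F) : LaurentPolynomial F →ₗ[F] Puiseux F where
  toFun m := laurentHom F 1 q m * w
  map_add' m m' := by rw [map_add, add_mul]
  map_smul' c m := by rw [laurentHom_smul, smul_mul_assoc]; rfl

/-- The map `f ↦ f(x^(1/q)) * p` on rational functions. -/
def ratMul (q : ℕ+) (p : Puiseux F) : RatFunc F →ₗ[F] Puiseux F where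
  toFun f := ratHom F 1 q f * p
  map_add' m m' := by rw [map_add, add_mul]
  map_smul' c m := by
    rw [RatFunc.smul_eq_C_mul, map_mul, ratHom_C, ← Algebra.smul_def, smul_mul_assoc]; rfl

theorem ratMul_apply (q : ℕ+) (p : Puiseux F) (f : RatFunc F) :
    ratMul q p f = ratHom F 1 q f * p := rfl

theorem laurentMul_apply (q : ℕ+) (p : Puiseux F) (m : LaurentPolynomial F) :
    laurentMul q p m = laurentHom F 1 q m * p := rfl

theorem eMul_laurentMul_injective (lam : Fˣ) (q : ℕ+) {w : Puiseux F} (hw : w ≠ 0) :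
    Function.Injective ((eMul lam).comp (laurentMul q w)) := by
  intro m m' h
  rw [LinearMap.comp_apply, LinearMap.comp_apply, eMul_apply, eMul_apply,
    MonoidAlgebra.single_right_inj] at h
  exact laurentHom_injective q (mul_right_cancel₀ hw h)

theorem range_series (d : ClassData F) :
    d.series b r l = ((eMul d.lam).comp (laurentMul (ramBound b r l (d.lam : F))
      (powerSeriesAt 1 (ramBound b r l (d.lam : F)) (infProd b d.g)))) ∘ d.p := rfl

theorem span_series (d : ClassData F) :
    Submodule.span F (Set.range (d.series b r l))
      = (Submodule.span F (Set.range d.p)).map ((eMul d.lam).comp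
        (laurentMul (ramBound b r l (d.lam : F))
          (powerSeriesAt 1 (ramBound b r l (d.lam : F)) (infProd b d.g)))) := by
  rw [Submodule.map_span, ← Set.range_comp, ← range_series]

theorem finiteDimensional_ker_twistedOp (hb : 2 ≤ b) (hl0 : l 0 ≠ 0) (lam : Fˣ) :
    FiniteDimensional F (LinearMap.ker (twistedOp (F := F) b r l (lam : F))) := by
  have hrank : Module.rank F (LinearMap.ker (twistedOp (F := F) b r l (lam : F))) ≤ r := by
    refine rank_le fun s hs => ?_
    have h1 := card_le_of_linearIndependent (r := r) hb hl0 (ι := s) (fun _ => lam)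
      (fun i => (i : LinearMap.ker (twistedOp (F := F) b r l (lam : F))).1) ?_ (fun i => i.1.2)
    · simpa using h1
    · have h2 : LinearIndependent F (((eMul lam).comp (Submodule.subtype _)) ∘
          (fun i : s => (i : LinearMap.ker (twistedOp (F := F) b r l (lam : F))))) := by
        refine hs.map' _ (LinearMap.ker_eq_bot.2 ?_)
        intro x y hxy
        exact Subtype.ext (MonoidAlgebra.single_right_injective hxy)
      exact h2
  rw [FiniteDimensional, ← Module.rank_lt_aleph0_iff]
  exact hrank.trans_lt (Cardinal.natCast_lt_aleph0)

/-- A member of the class is `f e_λ p`, where `f = (f p)/p` is a quotient of two solutions of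
ramification `q_λ`; so `f` is a rational function of `x^(1/q_λ)`. Conversely, multiplication by such
an `f` keeps `e_λ p` hypergeometric, with `u` replaced by `(Mf/f) u`. -/
theorem simClass_eq_map (hb : 2 ≤ b) (hl0 : l 0 ≠ 0) {lam : Fˣ} {p u : Puiseux F} (hp : p ≠ 0)
    (hu : u ∈ ramRatField F) (hM : algebraMap F _ (lam : F) * mahlerP F b p = u * p)
    (hL : twistedOp b r l (lam : F) p = 0) :
    insert 0 {z | z ∈ hypSolutions F b r l ∧ Similar F z (MonoidAlgebra.single lam p)}
      = (((LinearMap.ker ((twistedOp b r l (lam : F)).comp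
        (ratMul (ramBound b r l (lam : F)) p))).map
          ((eMul lam).comp (ratMul (ramBound b r l (lam : F)) p)) : Submodule F (DRing F)) :
            Set (DRing F)) := by
  set q := ramBound b r l (lam : F) with hq
  ext z
  simp only [Set.mem_insert_iff, Set.mem_ofPred_eq, SetLike.mem_coe, Submodule.mem_map,
    LinearMap.mem_ker, LinearMap.comp_apply, ratMul_apply, eMul_apply]
  constructor
  · rintro (rfl | ⟨hz, f, hf, hf0, rfl⟩)
    · exact ⟨0, by simp⟩
    · rw [MonoidAlgebra.smul_single, smul_eq_mul] at hz ⊢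
      have hLf := (applyL_single_eq_zero_iff b r l lam _).1 hz.2.2
      have h1 := hasRamification_ramBound hb hl0 lam.ne_zero hLf
      have h2 := hasRamification_ramBound hb hl0 lam.ne_zero hL
      have h3 : HasRamification q f.1 := by
        have h4 : f = (f * p) * p⁻¹ := by field_simp
        rw [h4]
        exact h1.mul h2.inv
      obtain ⟨g, rfl⟩ := exists_ratHom_of_hasRamification hf h3
      exact ⟨g, hLf, rfl⟩
  · rintro ⟨g, hg, rfl⟩
    by_cases hg0 : ratHom F 1 q g = 0
    · left
      rw [hg0, zero_mul, MonoidAlgebra.single_zero]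
    · right
      refine ⟨mem_hypSolutions_single (u := mahlerP F b (ratHom F 1 q g) / ratHom F 1 q g * u)
        (mul_ne_zero hg0 hp) ?_ ?_ hg, ratHom F 1 q g, ratHom_mem 1 q g, hg0, ?_⟩
      · exact (ramRatField F).mul_mem ((ramRatField F).div_mem
          (mahlerP_mem_ramRat b (ratHom_mem 1 q g)) (ratHom_mem 1 q g)) hu
      · rw [map_mul, mul_left_comm, hM]
        field_simp
      · rw [MonoidAlgebra.smul_single, smul_eq_mul]

theorem exists_represents (hb : 2 ≤ b) (hl0 : l 0 ≠ 0) {H : Set (DRing F)}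
    (hH : H ∈ simClasses F b r l) : ∃ d : ClassData F, d.Represents b r l H := by
  obtain ⟨y, hy, rfl⟩ := hH
  obtain ⟨lam, p, u, hp, rfl, hu, hM, hL⟩ := exists_single_of_mem_hypSolutions hb hy
  set q := ramBound b r l (lam : F) with hq
  have hmap := simClass_eq_map hb hl0 hp hu hM hL
  rw [← hq] at hmap
  set V := LinearMap.ker ((twistedOp b r l (lam : F)).comp (ratMul q p)) with hV
  have hinj : Function.Injective (ratMul q p) := fun f g h =>
    (ratHom F 1 q).injective (mul_right_cancel₀ hp h)
  have hfd : FiniteDimensional F V := by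
    have := finiteDimensional_ker_twistedOp (r := r) hb hl0 lam
    let j : V →ₗ[F] LinearMap.ker (twistedOp (F := F) b r l (lam : F)) :=
      ((ratMul q p).comp V.subtype).codRestrict _ (fun f => f.2)
    refine FiniteDimensional.of_injective j fun f g h => Subtype.ext (hinj ?_)
    exact congrArg Subtype.val h
  let e := Module.finBasis F V
  let f : Fin (Module.finrank F V) → RatFunc F := fun i => (e i : RatFunc F)
  have hfspan : Submodule.span F (Set.range f) = V := by
    have h1 : f = V.subtype ∘ e := rfl
    rw [h1, Set.range_comp, ← Submodule.map_span, e.span_eq, Submodule.map_top,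
      Submodule.range_subtype]
  -- The multiplier `1` gives `p` itself, so `V ≠ 0`.
  have hone : (1 : RatFunc F) ∈ V := by
    rw [hV, LinearMap.mem_ker, LinearMap.comp_apply, ratMul_apply, map_one, one_mul, hL]
  have hf0 : ∃ i, f i ≠ 0 := by
    by_contra hcon
    push Not at hcon
    have : V = ⊥ := by
      rw [← hfspan, Submodule.span_eq_bot]
      rintro _ ⟨i, rfl⟩
      exact hcon i
    rw [this, Submodule.mem_bot] at hone
    exact one_ne_zero hone
  obtain ⟨c, m, a, hc, hfm, ham⟩ := exists_coprime_family f hf0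
  -- the normalised cofactor
  set w₀ := ratHom F 1 q c * p with hw₀
  have hc0 := ratHom_ne_zero 1 q hc
  have hw₀0 : w₀ ≠ 0 := mul_ne_zero hc0 hp
  have hpram := hasRamification_ramBound hb hl0 lam.ne_zero hL
  have hw₀ram : HasRamification q w₀.1 := (hasRamification_ratHom q c).mul hpram
  set κ := lcP w₀ with hκ
  have hκ0 : κ ≠ 0 := lcP_ne_zero hw₀0
  obtain ⟨n, hn⟩ := hw₀ram (ordP w₀) hκ0
  -- The leading monomial of `w₀` moves from the cofactor to the numerators. It is a unit there, so
  -- coprimality is unaffected.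
  let ε : LaurentPolynomial F := AddMonoidAlgebra.single n κ
  have hε : laurentHom F 1 q ε = monomialP (ordP w₀) κ := by
    rw [← laurentPolyAt_eq, laurentPolyAt_single, hn]
    congr 1
    simp only [PNat.val_ofNat, Nat.cast_one]
    ring
  have hεunit : IsUnit ε := by
    refine IsUnit.of_mul_eq_one (AddMonoidAlgebra.single (-n) κ⁻¹) ?_
    rw [AddMonoidAlgebra.single_mul_single, add_neg_cancel, mul_inv_cancel₀ hκ0]
    rfl
  have hmon0 : monomialP (ordP w₀) κ ≠ 0 := monomialP_ne_zero hκ0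
  have hmon_ord : ordP (monomialP (ordP w₀) κ) = ordP w₀ := HahnSeries.order_single hκ0
  have hmon_lc : lcP (monomialP (ordP w₀) κ) = κ := by
    rw [lcP, hmon_ord, coeff_monomialP, if_pos rfl]
  set w := w₀ / monomialP (ordP w₀) κ with hw
  have hw0 : w ≠ 0 := div_ne_zero hw₀0 hmon0
  have hww : monomialP (ordP w₀) κ * w = w₀ := mul_div_cancel₀ _ hmon0
  have hword : ordP w = 0 := by
    have h1 := congrArg ordP hww
    rw [ordP_mul hmon0 hw0, hmon_ord] at h1
    linarith
  have hwlc : lcP w = 1 := by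
    have h1 := congrArg lcP hww
    rw [lcP_mul, hmon_lc, ← hκ] at h1
    exact mul_left_cancel₀ hκ0 (h1.trans (mul_one κ).symm)
  have hwram : HasRamification q w.1 := by
    have h1 : w = w₀ * (laurentHom F 1 q ε)⁻¹ := by rw [hε, hw, div_eq_mul_inv]
    rw [h1]
    exact hw₀ram.mul (hasRamification_laurent q _).inv
  have hMw0 : mahlerP F b w ≠ 0 := (map_ne_zero _).2 hw0
  set G := mahlerP F b w / w with hG
  have hGw : mahlerP F b w = G * w := (div_mul_cancel₀ _ hw0).symm
  have hGram : HasRamification q G.1 := by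
    rw [hG, div_eq_mul_inv]
    exact (hwram.mahlerP b).mul hwram.inv
  have hlam0 : algebraMap F (Puiseux F) (lam : F) ≠ 0 := by simp
  -- With `w = γ p` and `γ` rational, `Mw/w = (Mγ/γ) λ⁻¹ u`.
  have hGrat : G ∈ ramRatField F := by
    have hεr : monomialP (ordP w₀) κ ∈ ramRatField F := by
      have h1 : monomialP (ordP w₀) κ
          = algebraMap F _ κ * ratHom F 1 q (RatFunc.X ^ n) := by
        rw [map_zpow₀, ratHom_X, monomialP_zpow, algebraMap_eq_monomialP, monomialP_mul, hn]
        congr 1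
        · simp only [PNat.val_ofNat, Nat.cast_one]; ring
        · rw [mul_one]
      rw [h1]
      exact (ramRatField F).mul_mem (algebraMap_mem_ramRat κ) (ratHom_mem 1 q _)
    have hγ : ratHom F 1 q c / monomialP (ordP w₀) κ ∈ ramRatField F :=
      (ramRatField F).div_mem (ratHom_mem 1 q c) hεr
    have hMp : mahlerP F b p = (algebraMap F _ (lam : F))⁻¹ * u * p := by
      rw [mul_assoc, ← hM, inv_mul_cancel_left₀ hlam0]
    have hwp : w = ratHom F 1 q c / monomialP (ordP w₀) κ * p := by
      rw [hw, hw₀]; ring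
    have hγ0 : ratHom F 1 q c / monomialP (ordP w₀) κ ≠ 0 := div_ne_zero hc0 hmon0
    have hGeq : G = mahlerP F b (ratHom F 1 q c / monomialP (ordP w₀) κ)
        / (ratHom F 1 q c / monomialP (ordP w₀) κ) * ((algebraMap F _ (lam : F))⁻¹ * u) := by
      rw [hG, hwp, map_mul, hMp]
      generalize ratHom F 1 q c / monomialP (ordP w₀) κ = γ at hγ0
      field_simp
    rw [hGeq]
    exact (ramRatField F).mul_mem ((ramRatField F).div_mem (mahlerP_mem_ramRat b hγ) hγ)
      ((ramRatField F).mul_mem ((ramRatField F).inv_mem (algebraMap_mem_ramRat _)) hu)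
  obtain ⟨g, hg⟩ := exists_ratHom_of_hasRamification hGrat hGram
  have hG0 : G ≠ 0 := div_ne_zero hMw0 hw0
  have hg0 : g ≠ 0 := by
    rintro rfl
    exact hG0 (by rw [hg, map_zero])
  have hGord : ordP G = 0 := by
    have h1 := congrArg ordP hGw
    rw [ordP_mahlerP b hw0, ordP_mul hG0 hw0, hword] at h1
    linarith
  have hGlc : lcP G = 1 := by
    have h1 := congrArg lcP hGw
    rw [lcP_mahlerP b hw0, lcP_mul, hwlc, mul_one] at h1
    exact h1.symm
  have hgeval := eval_zero_eq_one (q := q) hg0 (hg ▸ hGord) (hg ▸ hGlc)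
  have hwprod : w = powerSeriesAt 1 q (infProd b g) :=
    eq_infProd hb hgeval hwlc (by rw [← hg]; exact hGw)
  -- the normalised numerators
  let m' : Fin (Module.finrank F V) → LaurentPolynomial F := fun i => Polynomial.toLaurent (m i) * ε
  have hm' : ∀ i, laurentHom F 1 q (m' i) * w = ratHom F 1 q (f i) * p := by
    intro i
    simp only [m']
    rw [map_mul, laurentHom_toLaurent, hε, mul_assoc, hww, hw₀, hfm, map_mul]
    ring
  have hfd' := FiniteDimensional.span_of_finite F (Set.finite_range m')
  obtain ⟨s, P, hPech, hPspan⟩ := exists_isReducedEchelon (Submodule.span F (Set.range m'))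
  have hspan : Submodule.span F (Set.range (ClassData.series b r l ⟨lam, g, s, P⟩))
      = V.map ((eMul lam).comp (ratMul q p)) := by
    rw [span_series]
    dsimp only
    rw [hPspan, ← hq, ← hwprod]
    refine Eq.trans ?_ (congrArg (Submodule.map _) hfspan)
    rw [Submodule.map_span, Submodule.map_span, ← Set.range_comp, ← Set.range_comp]
    congr 2
    funext i
    simp only [Function.comp_apply, LinearMap.comp_apply, laurentMul_apply, ratMul_apply, hm']
  refine ⟨⟨lam, g, s, P⟩, ⟨?_, hgeval, ?_, ?_, hPech, ?_⟩⟩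
  · rcases Nat.eq_zero_or_pos s with rfl | hs
    · exfalso
      obtain ⟨i, hi⟩ := hf0
      have h1 : m' i ∈ Submodule.span F (Set.range P) := hPspan ▸ Submodule.subset_span ⟨i, rfl⟩
      rw [Set.range_eq_empty, Submodule.span_empty, Submodule.mem_bot] at h1
      have h2 := hm' i
      rw [h1, map_zero, zero_mul] at h2
      exact mul_ne_zero (ratHom_ne_zero 1 q hi) hp h2.symm
    · exact hs
  · rw [range_series]
    refine hPech.linearIndependent.map' _ (LinearMap.ker_eq_bot.2
      (eMul_laurentMul_injective lam q ?_))
    exact infProd_ne_zero q hgeval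
  · rw [hspan, hmap]
  · intro t ht
    have h1 : ∀ x ∈ Submodule.span F (Set.range P), t ∣ x := by
      intro x hx
      obtain ⟨c', rfl⟩ := (Submodule.mem_span_range_iff_exists_fun F).1 hx
      refine Finset.dvd_sum fun i _ => ?_
      rw [LaurentPolynomial.smul_eq_C_mul]
      exact Dvd.dvd.mul_left (ht i) _
    have h2 : t ∣ ε := by
      -- The Bézout relation of the `m i`, multiplied by `ε`: a common divisor of the numerators
      -- divides a unit.
      have h3 : ∑ i, Polynomial.toLaurent (a i) * m' i = ε := by
        simp only [m', ← mul_assoc, ← map_mul]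
        rw [← Finset.sum_mul, ← map_sum, ham, map_one, one_mul]
      rw [← h3]
      exact Finset.dvd_sum fun i _ =>
        (h1 _ (hPspan ▸ Submodule.subset_span ⟨i, rfl⟩)).mul_left _
    exact isUnit_of_dvd_unit h2 hεunit

end Classes

/-! ### Uniqueness of the normal form and the count of dimensions -/

section Data

variable {K : Type*} [Field K] {F : Type*} [Field F] [Algebra K F]
  {b : ℕ+} {r : ℕ} {l : ℕ → Polynomial K}

theorem laurentHom_mem (q : ℕ+) (m : LaurentPolynomial F) : laurentHom F 1 q m ∈ ramRatField F := by
  obtain ⟨k, P, hP⟩ := m.exists_T_pow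
  have h : m = Polynomial.toLaurent P * LaurentPolynomial.T (-k) := by
    rw [hP, mul_assoc, ← LaurentPolynomial.T_add]
    simp
  rw [h, map_mul, laurentHom_toLaurent]
  refine (ramRatField F).mul_mem (ratHom_mem 1 q _) ?_
  have h1 := ratHom_mem 1 q (RatFunc.X ^ (-(k : ℤ)) : RatFunc F)
  rw [map_zpow₀, ratHom_X, monomialP_zpow] at h1
  rw [LaurentPolynomial.T, ← laurentPolyAt_eq, laurentPolyAt_single, mul_comm]
  exact h1

theorem ClassData.Represents.series_mem {d : ClassData F} {H : Set (DRing F)}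
    (hd : d.Represents b r l H) (j : Fin d.s) : d.series b r l j ∈ H := by
  have h1 : d.series b r l j ∈ insert 0 H := by
    rw [← hd.span_eq]
    exact Submodule.subset_span ⟨j, rfl⟩
  exact h1.resolve_left (hd.linearIndependent.ne_zero j)

theorem lam_eq_of_similar {lam lam' : Fˣ} {p p' : Puiseux F} (hp : p ≠ 0)
    (h : Similar F (MonoidAlgebra.single lam p) (MonoidAlgebra.single lam' p')) : lam = lam' := by
  obtain ⟨f, -, -, h⟩ := h
  rw [MonoidAlgebra.smul_single, MonoidAlgebra.single_inj] at h
  exact h.elim (fun h => h.1) fun h => absurd h.1 hp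

theorem ClassData.Represents.series_ne_zero {d : ClassData F} {H : Set (DRing F)}
    (hd : d.Represents b r l H) (j : Fin d.s) :
    laurentPolyAt 1 (ramBound b r l (d.lam : F)) (d.p j)
      * powerSeriesAt 1 (ramBound b r l (d.lam : F)) (infProd b d.g) ≠ 0 :=
  MonoidAlgebra.single_ne_zero.1 (hd.linearIndependent.ne_zero j)

theorem ClassData.Represents.lam_eq {d : ClassData F} {H : Set (DRing F)}
    (hH : H ∈ simClasses F b r l) (hd : d.Represents b r l H) {lam : Fˣ} {p : Puiseux F}
    (hp : MonoidAlgebra.single lam p ∈ H) : d.lam = lam :=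
  lam_eq_of_similar (hd.series_ne_zero ⟨0, hd.s_pos⟩)
    (similar_of_mem hH (hd.series_mem ⟨0, hd.s_pos⟩) hp)

/-- Similarity fixes `λ`. The two cofactors `w, w'` have a rational quotient `ρ`, and each family of
numerators is carried into Laurent polynomials, one by `ρ` and the other by `ρ⁻¹`; hence `ρ = 1`.
Then `g` is read off from `Mw/w`, and the numerators from the uniqueness of echelon bases. -/
theorem ClassData.Represents.unique (hb : 2 ≤ b) {d d' : ClassData F} {H : Set (DRing F)}
    (hH : H ∈ simClasses F b r l) (hd : d.Represents b r l H) (hd' : d'.Represents b r l H) :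
    d = d' := by
  have hlam : d.lam = d'.lam := hd.lam_eq hH (hd'.series_mem ⟨0, hd'.s_pos⟩)
  have hspan : Submodule.span F (Set.range (d.series b r l))
      = Submodule.span F (Set.range (d'.series b r l)) :=
    SetLike.coe_injective (hd.span_eq.trans hd'.span_eq.symm)
  rw [span_series, span_series] at hspan
  have hs := hd.s_pos
  have hne := hd.series_ne_zero
  obtain ⟨lam, g, s, p⟩ := d
  obtain ⟨lam', g', s', p'⟩ := d'
  obtain rfl : lam = lam' := hlam
  obtain ⟨-, hg, -, -, hech, hcop⟩ := hd
  obtain ⟨-, hg', -, -, hech', hcop'⟩ := hd'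
  dsimp only at hg hg' hech hech' hcop hcop' hspan hs hne
  set q := ramBound b r l (lam : F)
  set w := powerSeriesAt 1 q (infProd b g) with hw
  set w' := powerSeriesAt 1 q (infProd b g') with hw'
  have hw0 : w ≠ 0 := infProd_ne_zero q hg
  have hw'0 : w' ≠ 0 := infProd_ne_zero q hg'
  have hinto : ∀ j, ∃ m, laurentHom F 1 q m * w' = laurentHom F 1 q (p j) * w := by
    intro j
    have h1 : (eMul lam).comp (laurentMul q w) (p j) ∈
        (Submodule.span F (Set.range p)).map ((eMul lam).comp (laurentMul q w)) :=
      Submodule.mem_map_of_mem (Submodule.subset_span ⟨j, rfl⟩)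
    rw [hspan] at h1
    obtain ⟨m, -, hm⟩ := h1
    exact ⟨m, MonoidAlgebra.single_right_injective hm⟩
  have hinto' : ∀ j, ∃ m, laurentHom F 1 q m * w = laurentHom F 1 q (p' j) * w' := by
    intro j
    have h1 : (eMul lam).comp (laurentMul q w') (p' j) ∈
        (Submodule.span F (Set.range p')).map ((eMul lam).comp (laurentMul q w')) :=
      Submodule.mem_map_of_mem (Submodule.subset_span ⟨j, rfl⟩)
    rw [← hspan] at h1
    obtain ⟨m, -, hm⟩ := h1
    exact ⟨m, MonoidAlgebra.single_right_injective hm⟩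
  have hratio : w / w' ∈ ramRatField F := by
    obtain ⟨m, hm⟩ := hinto ⟨0, hs⟩
    have hp0 : laurentHom F 1 q (p ⟨0, hs⟩) ≠ 0 := left_ne_zero_of_mul (hne ⟨0, hs⟩)
    have h1 : w / w' = laurentHom F 1 q m / laurentHom F 1 q (p ⟨0, hs⟩) := by
      rw [div_eq_div_iff hw'0 hp0, hm, mul_comm]
    rw [h1]
    exact (ramRatField F).div_mem (laurentHom_mem q _) (laurentHom_mem q _)
  have hram : HasRamification q (w / w').1 := by
    rw [div_eq_mul_inv]
    exact (hasRamification_powerSeriesAt q _).mul (hasRamification_powerSeriesAt q _).inv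
  obtain ⟨ρ, hρ⟩ := exists_ratHom_of_hasRamification hratio hram
  have hρ0 : ρ ≠ 0 := by
    rintro rfl
    rw [map_zero] at hρ
    exact div_ne_zero hw0 hw'0 hρ
  have hmul : w / w' * w' = w := div_mul_cancel₀ _ hw'0
  have hone : ratHom F 1 q ρ = 1 := by
    refine eq_one_of_coprime hcop hcop' hρ0 (fun j => ?_) (fun j => ?_) ?_ ?_
    · obtain ⟨m, hm⟩ := hinto j
      refine ⟨m, ?_⟩
      rw [← hρ, div_mul_eq_mul_div, eq_div_iff hw'0, hm, mul_comm]
    · obtain ⟨m, hm⟩ := hinto' j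
      refine ⟨m, ?_⟩
      rw [map_inv₀, ← hρ, inv_div, div_mul_eq_mul_div, eq_div_iff hw0, hm, mul_comm]
    · have h1 := congrArg ordP hmul
      rw [ordP_mul (div_ne_zero hw0 hw'0) hw'0, ordP_infProd q hg, ordP_infProd q hg'] at h1
      rw [← hρ]
      linarith
    · have h1 := congrArg lcP hmul
      rw [lcP_mul, lcP_infProd q hg, lcP_infProd q hg', mul_one] at h1
      rw [← hρ, h1]
  have hww' : w = w' := by
    rw [← hmul, hρ, hone, one_mul]
  obtain rfl : g = g' := by
    apply (ratHom F 1 q).injective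
    apply mul_right_cancel₀ hw0
    rw [← mahlerP_infProd hb q hg]
    conv_rhs => rw [hww', ← mahlerP_infProd hb q hg', ← hw', ← hww']
  have hpspan : Submodule.span F (Set.range p) = Submodule.span F (Set.range p') :=
    Submodule.map_injective_of_injective (eMul_laurentMul_injective lam q hw0) hspan
  obtain ⟨rfl, hp⟩ := hech.unique hech' hpspan
  rw [eq_of_heq hp]

/-- With the same `λ` and `g`, two series differ by a quotient of Laurent polynomials in
`x^(1/q_λ)`, so they are similar. -/
theorem simClass_eq_of_represents {d d' : ClassData F} {H H' : Set (DRing F)}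
    (hH : H ∈ simClasses F b r l) (hH' : H' ∈ simClasses F b r l) (hd : d.Represents b r l H)
    (hd' : d'.Represents b r l H') (h : (d.lam, d.g) = (d'.lam, d'.g)) : H = H' := by
  refine simClass_eq_of_similar hH hH' (hd.series_mem ⟨0, hd.s_pos⟩)
    (hd'.series_mem ⟨0, hd'.s_pos⟩) ?_
  have hne := hd.series_ne_zero ⟨0, hd.s_pos⟩
  have hne' := hd'.series_ne_zero ⟨0, hd'.s_pos⟩
  rw [Prod.mk.injEq] at h
  obtain ⟨lam, g, s, p⟩ := d
  obtain ⟨lam', g', s', p'⟩ := d'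
  obtain ⟨rfl, rfl⟩ : lam = lam' ∧ g = g' := h
  dsimp only at hne hne'
  simp only [ClassData.series]
  set q := ramBound b r l (lam : F)
  have hP := left_ne_zero_of_mul hne
  have hP' := left_ne_zero_of_mul hne'
  have hmem : ∀ m : LaurentPolynomial F, laurentPolyAt 1 q m ∈ ramRatField F :=
    laurentHom_mem q
  refine ⟨_, (ramRatField F).div_mem (hmem (p ⟨0, hd.s_pos⟩)) (hmem (p' ⟨0, hd'.s_pos⟩)),
    div_ne_zero hP hP', ?_⟩
  rw [MonoidAlgebra.smul_single, smul_eq_mul, ← mul_assoc, div_mul_cancel₀ _ hP']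

theorem classOf_eq {d : ClassData F} {H : Set (DRing F)} (hH : H ∈ simClasses F b r l)
    (hd : d.Represents b r l H) : classOf b r l (d.lam, d.g) = H := by
  ext y
  constructor
  · rintro ⟨H', hH', hy, d', hd', heq⟩
    rwa [simClass_eq_of_represents hH hH' hd hd' heq.symm]
  · intro hy
    exact ⟨H, hH, hy, d, hd, rfl⟩

theorem exists_of_mem_classIndices {i : Fˣ × RatFunc F} (hi : i ∈ classIndices b r l F) :
    classOf b r l i ∈ simClasses F b r l ∧
      ∃ d : ClassData F, d.Represents b r l (classOf b r l i) ∧ (d.lam, d.g) = i := by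
  obtain ⟨H, hH, d, hd, rfl⟩ := hi
  rw [classOf_eq hH hd]
  exact ⟨hH, d, hd, rfl⟩

theorem exists_mem_classOf (hb : 2 ≤ b) (hl0 : l 0 ≠ 0) {y : DRing F}
    (hy : y ∈ hypSolutions F b r l) : ∃ i ∈ classIndices b r l F, y ∈ classOf b r l i := by
  have hH : {z | z ∈ hypSolutions F b r l ∧ Similar F z y} ∈ simClasses F b r l := ⟨y, hy, rfl⟩
  obtain ⟨d, hd⟩ := exists_represents hb hl0 hH
  refine ⟨(d.lam, d.g), ⟨_, hH, d, hd, rfl⟩, ?_⟩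
  rw [classOf_eq hH hd]
  exact ⟨hy, Similar.refl y⟩

theorem eq_of_similar_of_mem_classOf (hb : 2 ≤ b) {i i' : Fˣ × RatFunc F}
    (hi : i ∈ classIndices b r l F) (hi' : i' ∈ classIndices b r l F) {y z : DRing F}
    (hy : y ∈ classOf b r l i) (hz : z ∈ classOf b r l i') (h : Similar F y z) : i = i' := by
  obtain ⟨hH, d, hd, rfl⟩ := exists_of_mem_classIndices hi
  obtain ⟨hH', d', hd', rfl⟩ := exists_of_mem_classIndices hi'
  have heq := simClass_eq_of_similar hH hH' hy hz h
  rw [heq] at hd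
  rw [hd.unique hb hH' hd']

/-- Group a relation between the concatenated bases by class: each group sum is `0` or a member of
its class. Distinct classes are dissimilar, so all group sums vanish, and the Casoratian bound
applies. -/
theorem sum_dim_le (hb : 2 ≤ b) (hl0 : l 0 ≠ 0) (D : Fˣ × RatFunc F → ClassData F)
    (hD : ∀ i ∈ classIndices b r l F, (D i).Represents b r l (classOf b r l i))
    (T : Finset (Fˣ × RatFunc F)) (hT : ∀ i ∈ T, i ∈ classIndices b r l F) :
    ∑ i ∈ T, (D i).s ≤ r := by
  classical
  have h1 := card_le_of_linearIndependent (r := r) (l := l) hb hl0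
    (ι := Σ i : T, Fin (D i).s) (fun x => (D x.1).lam)
    (fun x => laurentPolyAt 1 (ramBound b r l ((D x.1).lam : F)) ((D x.1).p x.2)
      * powerSeriesAt 1 (ramBound b r l ((D x.1).lam : F)) (infProd b (D x.1).g)) ?_ ?_
  · rw [Fintype.card_sigma] at h1
    simp only [Fintype.card_fin] at h1
    rwa [← Finset.sum_coe_sort]
  · change LinearIndependent F (fun x : Σ i : T, Fin (D i).s => (D x.1).series b r l x.2)
    rw [Fintype.linearIndependent_iff]
    intro c hc
    rw [Fintype.sum_sigma] at hc
    let z : T → DRing F := fun i => ∑ j, c ⟨i, j⟩ • (D i).series b r l j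
    have hz : ∀ i, z i = 0 ∨ z i ∈ classOf b r l i.1 := by
      intro i
      have h2 : z i ∈ Submodule.span F (Set.range ((D i).series b r l)) :=
        (Submodule.mem_span_range_iff_exists_fun F).2 ⟨_, rfl⟩
      have h3 : z i ∈ insert 0 (classOf b r l i.1) := by
        rw [← (hD i (hT i i.2)).span_eq]
        exact h2
      exact h3
    have hzero := smul_eq_zero_of_sum_eq_zero hb Finset.univ z
      (fun i _ => by
        rcases hz i with h | h
        · rw [h]
          exact ⟨0, (ramRatField F).zero_mem, by simp⟩
        · exact (subset_hypSolutions (exists_of_mem_classIndices (hT i i.2)).1 h).2.1)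
      (fun i _ j _ hij hi0 hj0 hsim => hij (Subtype.ext (eq_of_similar_of_mem_classOf hb
        (hT i i.2) (hT j j.2) ((hz i).resolve_left hi0) ((hz j).resolve_left hj0) hsim)))
      (fun _ => 1) (fun _ _ => (ramRatField F).one_mem) (by simpa only [one_smul] using hc)
    rintro ⟨i, j⟩
    have h4 := hzero i (Finset.mem_univ i)
    rw [one_smul] at h4
    exact Fintype.linearIndependent_iff.1 (hD i (hT i i.2)).linearIndependent _ h4 j
  · rintro ⟨i, j⟩
    have h2 := (hD i (hT i i.2)).series_mem j
    exact (applyL_single_eq_zero_iff b r l _ _).1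
      (subset_hypSolutions (exists_of_mem_classIndices (hT i i.2)).1 h2).2.2

/-- Each class contributes at least one to a sum bounded by `r`. -/
theorem finite_classIndices (hb : 2 ≤ b) (hl0 : l 0 ≠ 0) :
    (classIndices b r l F).Finite := by
  classical
  have hex : ∀ i : Fˣ × RatFunc F, ∃ d : ClassData F, i ∈ classIndices b r l F →
      d.Represents b r l (classOf b r l i) := by
    intro i
    by_cases hi : i ∈ classIndices b r l F
    · obtain ⟨-, d, hd, -⟩ := exists_of_mem_classIndices hi
      exact ⟨d, fun _ => hd⟩
    · exact ⟨⟨1, 0, 0, fun _ => 0⟩, fun h => absurd h hi⟩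
  choose D hD using hex
  by_contra hinf
  obtain ⟨T, hTS, hT⟩ := (show (classIndices b r l F).Infinite from hinf).exists_subset_card_eq
    (r + 1)
  have h1 := sum_dim_le hb hl0 D hD T hTS
  have h2 : T.card ≤ ∑ i ∈ T, (D i).s := by
    rw [Finset.card_eq_sum_ones]
    exact Finset.sum_le_sum fun i hi => (hD i (hTS hi)).s_pos
  omega

/-! ### The Riccati equation -/

theorem pow_mul_mahlerP_iterate {lam : F} {p u : Puiseux F}
    (hM : algebraMap F _ lam * mahlerP F b p = u * p) (k : ℕ) :
    algebraMap F _ lam ^ k * (mahlerP F b)^[k] p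
      = (∏ i ∈ Finset.range k, (mahlerP F b)^[i] u) * p := by
  induction k with
  | zero => simp
  | succ k ih =>
    have h1 : (mahlerP F b)^[k] (algebraMap F _ lam * mahlerP F b p) = (mahlerP F b)^[k] (u * p) := by
      rw [hM]
    have h2 : ∀ c : F, (mahlerP F b)^[k] (algebraMap F _ c) = algebraMap F _ c := fun c =>
      Function.iterate_fixed (mahlerP_algebraMap b c) k
    rw [iterate_map_mul, iterate_map_mul, h2, ← Function.iterate_succ_apply] at h1
    rw [pow_succ, mul_assoc, h1, mul_left_comm, ih, Finset.prod_range_succ]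
    ring

/-- By iteration `λ^k M^k p = u (Mu) ⋯ (M^(k-1) u) p`, so on such a `p` the operator is
multiplication by the left side of (R). -/
theorem twistedOp_eq_riccati_mul {lam : F} {p u : Puiseux F}
    (hM : algebraMap F _ lam * mahlerP F b p = u * p) :
    twistedOp b r l lam p = (∑ k ∈ Finset.range (r + 1),
      polyCoeff F (l k) * ∏ i ∈ Finset.range k, (mahlerP F b)^[i] u) * p := by
  rw [twistedOp_apply, Finset.sum_mul]
  exact Finset.sum_congr rfl fun k _ => by rw [pow_mul_mahlerP_iterate hM, mul_assoc]

/-- At `u = 0` the left side of (R) reduces to `l 0`. -/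
theorem ne_zero_of_mem_riccatiSolutions (hl0 : l 0 ≠ 0) {u : Puiseux F}
    (hu : u ∈ riccatiSolutions F b r l) : u ≠ 0 := by
  rintro rfl
  have h := hu.2
  rw [Finset.sum_range_succ', Finset.sum_eq_zero, zero_add, Finset.prod_range_zero, mul_one] at h
  · exact polyCoeff_ne_zero hl0 h
  · intro k _
    rw [Finset.prod_range_succ', Function.iterate_zero, id, mul_zero, mul_zero]

theorem isUnit_single {lam : Fˣ} {p : Puiseux F} (hp : p ≠ 0) :
    IsUnit (MonoidAlgebra.single lam p : DRing F) := by
  refine IsUnit.of_mul_eq_one (MonoidAlgebra.single lam⁻¹ p⁻¹) ?_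
  rw [MonoidAlgebra.single_mul_single, mul_inv_cancel, mul_inv_cancel₀ hp]
  rfl

theorem riccatiSolutions_eq (hb : 2 ≤ b) (hl0 : l 0 ≠ 0) :
    riccatiSolutions F b r l
      = ⋃ i ∈ classIndices b r l F, quotImage F b (classOf b r l i) := by
  ext u
  simp only [Set.mem_iUnion]
  constructor
  · intro hu
    -- Every solution `u` comes from some generalized series, which is then a solution of (L) and
    -- lies in a class.
    obtain ⟨lam, p, hp, hM⟩ := exists_mahlerP_eq hb hu.1 (ne_zero_of_mem_riccatiSolutions hl0 hu)
    have hL : twistedOp b r l (lam : F) p = 0 := by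
      rw [twistedOp_eq_riccati_mul hM, hu.2, zero_mul]
    obtain ⟨i, hi, hy⟩ := exists_mem_classOf hb hl0 (mem_hypSolutions_single hp hu.1 hM hL)
    exact ⟨i, hi, _, hy, isUnit_single hp, (mahler_single_eq_smul_iff lam p u).2 hM⟩
  · rintro ⟨i, hi, y, hy, -, hM⟩
    obtain ⟨lam, p, u', hp, rfl, hu', hM', hL⟩ := exists_single_of_mem_hypSolutions hb
      (subset_hypSolutions (exists_of_mem_classIndices hi).1 hy)
    rw [mahler_single_eq_smul_iff] at hM
    obtain rfl : u = u' := mul_right_cancel₀ hp (hM.symm.trans hM')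
    rw [twistedOp_eq_riccati_mul hM] at hL
    exact ⟨hu', (mul_eq_zero.1 hL).resolve_right hp⟩

theorem disjoint_quotImage (hb : 2 ≤ b) {i i' : Fˣ × RatFunc F} (hi : i ∈ classIndices b r l F)
    (hi' : i' ∈ classIndices b r l F) (hne : i ≠ i') :
    Disjoint (quotImage F b (classOf b r l i)) (quotImage F b (classOf b r l i')) := by
  rw [Set.disjoint_left]
  rintro u ⟨y, hy, -, hM⟩ ⟨z, hz, -, hM'⟩
  have hy0 := (subset_hypSolutions (exists_of_mem_classIndices hi).1 hy).1
  have hz0 := (subset_hypSolutions (exists_of_mem_classIndices hi').1 hz).1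
  obtain ⟨c, hc, rfl⟩ := exists_smul_of_mahler_eq hb hy0 hz0 hM hM'
  exact hne (eq_of_similar_of_mem_classOf hb hi hi' hy hz (similar_constant_smul hc z))

theorem disjoint_classOf (hb : 2 ≤ b) {i i' : Fˣ × RatFunc F} (hi : i ∈ classIndices b r l F)
    (hi' : i' ∈ classIndices b r l F) (hne : i ≠ i') :
    Disjoint (classOf b r l i) (classOf b r l i') := by
  rw [Set.disjoint_left]
  intro y hy hy'
  exact hne (eq_of_similar_of_mem_classOf hb hi hi' hy hy' (Similar.refl y))

theorem hypSolutions_single_eq (hb : 2 ≤ b) (hl0 : l 0 ≠ 0) (lam : Fˣ) :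
    {y | y ∈ hypSolutions F b r l ∧ ∃ p : Puiseux F, y = MonoidAlgebra.single lam p}
      = ⋃ i ∈ {i | i ∈ classIndices b r l F ∧ i.1 = lam}, classOf b r l i := by
  ext y
  simp only [Set.mem_iUnion, Set.mem_ofPred_eq, exists_prop]
  constructor
  · rintro ⟨hy, p, rfl⟩
    obtain ⟨i, hi, hyi⟩ := exists_mem_classOf hb hl0 hy
    refine ⟨i, ⟨hi, ?_⟩, hyi⟩
    obtain ⟨hH, d, hd, rfl⟩ := exists_of_mem_classIndices hi
    exact hd.lam_eq hH hyi
  · rintro ⟨i, ⟨hi, rfl⟩, hyi⟩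
    obtain ⟨hH, d, hd, rfl⟩ := exists_of_mem_classIndices hi
    have hy := subset_hypSolutions hH hyi
    refine ⟨hy, ?_⟩
    obtain ⟨lam', p, -, -, rfl, -⟩ := exists_single_of_mem_hypSolutions hb hy
    exact ⟨p, by rw [hd.lam_eq hH hyi]⟩

/-! ### The parametrisation of the solutions -/

theorem ClassData.combination_eq (d : ClassData F) (m : ℕ+) (c : Fin d.s → F) :
    d.combination b r l m c
      = laurentHom F m (ramBound b r l (d.lam : F)) (∑ j, c j • d.p j) := by
  rw [ClassData.combination, map_sum]
  exact Finset.sum_congr rfl fun j _ => by rw [laurentHom_smul]; rfl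

theorem ClassData.sum_series (d : ClassData F) (c : Fin d.s → F) :
    ∑ j, c j • d.series b r l j = MonoidAlgebra.single d.lam (d.combination b r l 1 c
      * powerSeriesAt 1 (ramBound b r l (d.lam : F)) (infProd b d.g)) := by
  rw [ClassData.combination_eq, ← laurentMul_apply, ← eMul_apply, ← LinearMap.comp_apply, map_sum]
  exact Finset.sum_congr rfl fun j _ => by rw [map_smul, range_series]; rfl

/-- The solution of the Riccati equation with parameters `c`. -/
def ClassData.riccati (b : ℕ+) (r : ℕ) (l : ℕ → Polynomial K) (d : ClassData F)
    (c : Fin d.s → F) : Puiseux F :=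
  algebraMap F (Puiseux F) (d.lam : F) * (d.combination b r l b c / d.combination b r l 1 c)
    * ratAt 1 (ramBound b r l (d.lam : F)) d.g

theorem ClassData.Represents.sum_series_ne_zero {d : ClassData F} {H : Set (DRing F)}
    (hd : d.Represents b r l H) {c : Fin d.s → F} (hc : c ≠ 0) :
    ∑ j, c j • d.series b r l j ≠ 0 := fun h =>
  hc (funext (Fintype.linearIndependent_iff.1 hd.linearIndependent c h))

theorem ClassData.Represents.combination_ne_zero {d : ClassData F} {H : Set (DRing F)}
    (hd : d.Represents b r l H) {c : Fin d.s → F} (hc : c ≠ 0) :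
    d.combination b r l 1 c ≠ 0 := by
  intro h
  apply hd.sum_series_ne_zero hc
  rw [ClassData.sum_series, h, zero_mul, MonoidAlgebra.single_zero]

/-- `M` turns `p_j(x^(1/q))` into `p_j(x^(b/q))` and multiplies the infinite product by
`g(x^(1/q))`. -/
theorem ClassData.Represents.mahler_sum_series (hb : 2 ≤ b) {d : ClassData F} {H : Set (DRing F)}
    (hd : d.Represents b r l H) {c : Fin d.s → F} (hc : c ≠ 0) :
    mahler F b (∑ j, c j • d.series b r l j)
      = d.riccati b r l c • ∑ j, c j • d.series b r l j := by
  have h0 := hd.combination_ne_zero hc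
  rw [ClassData.sum_series, mahler_single_eq_smul_iff, map_mul, mahlerP_infProd hb _ hd.g_zero,
    ClassData.riccati, ratAt_eq]
  have h1 : mahlerP F b (d.combination b r l 1 c) = d.combination b r l b c := by
    rw [ClassData.combination_eq, ClassData.combination_eq, mahlerP_laurentHom, mul_one]
  rw [h1]
  field_simp

/-- The map is `c ↦ My/y` for `y = ∑ c_j y_j`. It is injective because solutions of `My = uy` are
unique up to a constant and the `y_j` are independent, and its image is full because the `y_j` span
`H ∪ {0}`. -/
theorem ClassData.Represents.exists_parametrisation (hb : 2 ≤ b) {d : ClassData F}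
    {H : Set (DRing F)} (hH : H ∈ simClasses F b r l) (hd : d.Represents b r l H) :
    ∃ φ : Projectivization F (Fin d.s → F) → Puiseux F,
      Function.Injective φ ∧ Set.range φ = quotImage F b H ∧
      ∀ (c : Fin d.s → F) (hc : c ≠ 0), φ (Projectivization.mk F c hc) = d.riccati b r l c := by
  have hscale : ∀ (t : F) (c : Fin d.s → F), t ≠ 0 →
      d.riccati b r l (t • c) = d.riccati b r l c := by
    intro t c ht
    have h1 : ∀ m, d.combination b r l m (t • c) = algebraMap F _ t * d.combination b r l m c := by
      intro m
      rw [ClassData.combination, ClassData.combination, ← Algebra.smul_def, Finset.smul_sum]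
      exact Finset.sum_congr rfl fun j _ => by rw [Pi.smul_apply, smul_eq_mul, mul_smul]
    rw [ClassData.riccati, ClassData.riccati, h1, h1, mul_div_mul_left]
    simpa using ht
  let φ : Projectivization F (Fin d.s → F) → Puiseux F :=
    Projectivization.lift (fun c => d.riccati b r l c.1) (by
      rintro ⟨c, hc⟩ ⟨c', hc'⟩ t (rfl : c = t • c')
      refine hscale t c' ?_
      rintro rfl
      exact hc (zero_smul _ _))
  have hφ : ∀ (c : Fin d.s → F) (hc : c ≠ 0),
      φ (Projectivization.mk F c hc) = d.riccati b r l c := fun c hc => rfl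
  refine ⟨φ, ?_, ?_, hφ⟩
  · intro x y
    induction x using Projectivization.ind with
    | h c hc =>
      induction y using Projectivization.ind with
      | h c' hc' =>
        intro h
        rw [hφ, hφ] at h
        have h1 := hd.mahler_sum_series hb hc
        rw [h] at h1
        obtain ⟨t, ht, htc⟩ := exists_smul_of_mahler_eq hb (hd.sum_series_ne_zero hc)
          (hd.sum_series_ne_zero hc') h1 (hd.mahler_sum_series hb hc')
        rw [Projectivization.mk_eq_mk_iff']
        refine ⟨t, ?_⟩
        rw [Finset.smul_sum, ← sub_eq_zero, ← Finset.sum_sub_distrib] at htc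
        have h2 := Fintype.linearIndependent_iff.1 hd.linearIndependent (c - t • c') (by
          rw [← htc]
          refine Finset.sum_congr rfl fun j _ => ?_
          rw [Pi.sub_apply, Pi.smul_apply, sub_smul, smul_smul, smul_eq_mul])
        funext j
        exact (sub_eq_zero.1 (h2 j)).symm
  · ext u
    constructor
    · rintro ⟨x, rfl⟩
      induction x using Projectivization.ind with
      | h c hc =>
        have h1 : ∑ j, c j • d.series b r l j ∈ insert 0 H := by
          rw [← hd.span_eq]
          exact (Submodule.mem_span_range_iff_exists_fun F).2 ⟨c, rfl⟩
        refine ⟨_, h1.resolve_left (hd.sum_series_ne_zero hc), ?_, hd.mahler_sum_series hb hc⟩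
        have h2 := hd.sum_series_ne_zero hc
        rw [ClassData.sum_series] at h2 ⊢
        exact isUnit_single (MonoidAlgebra.single_ne_zero.1 h2)
    · rintro ⟨y, hy, -, hM⟩
      have h1 : y ∈ Submodule.span F (Set.range (d.series b r l)) := by
        rw [← SetLike.mem_coe, hd.span_eq]
        exact Or.inr hy
      obtain ⟨c, rfl⟩ := (Submodule.mem_span_range_iff_exists_fun F).1 h1
      have hc : c ≠ 0 := by
        rintro rfl
        exact (subset_hypSolutions hH hy).1 (by simp)
      refine ⟨Projectivization.mk F c hc, ?_⟩
      rw [hφ]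
      have h2 := hM.symm.trans (hd.mahler_sum_series hb hc)
      have h3 := hd.sum_series_ne_zero hc
      rw [ClassData.sum_series, MonoidAlgebra.smul_single, MonoidAlgebra.smul_single,
        MonoidAlgebra.single_right_inj, smul_eq_mul, smul_eq_mul] at h2
      rw [ClassData.sum_series, MonoidAlgebra.single_ne_zero] at h3
      exact (mul_right_cancel₀ h3 h2).symm

end Data

end

end Mahler

/-! ### Assembly of the theorem -/

theorem mainTheorem4 {K Kbar : Type*} [Field K] [CharZero K] [Field Kbar] [Algebra K Kbar]
    [IsAlgClosure K Kbar] (𝕃 : IntermediateField K Kbar)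
    (b : ℕ+) (hb : 2 ≤ b) (r : ℕ) (l : ℕ → Polynomial K)
    (hl0 : l 0 ≠ 0) (hlr : l r ≠ 0)
    (hprim : ∀ c : Polynomial K, (∀ k ≤ r, c ∣ l k) → IsUnit c) :
    (∀ H ∈ Mahler.simClasses 𝕃 b r l,
      ∃! d : Mahler.ClassData 𝕃, d.Represents b r l H) ∧
    (∀ i ∈ Mahler.classIndices b r l 𝕃,
      Mahler.classOf b r l i ∈ Mahler.simClasses 𝕃 b r l) ∧
    ∃ (I : Finset (𝕃ˣ × RatFunc 𝕃)) (D : 𝕃ˣ × RatFunc 𝕃 → Mahler.ClassData 𝕃),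
      (I : Set (𝕃ˣ × RatFunc 𝕃)) = Mahler.classIndices b r l 𝕃 ∧
      (∀ i ∈ I,
        algebraMap 𝕃 Kbar (i.1 : 𝕃) ∈ Mahler.Lam' b r l Kbar ∧
        RatFunc.eval (RingHom.id 𝕃) 0 i.2 = 1) ∧
      Mahler.riccatiSolutions 𝕃 b r l
        = ⋃ i ∈ I, Mahler.quotImage 𝕃 b (Mahler.classOf b r l i) ∧
      (I : Set (𝕃ˣ × RatFunc 𝕃)).PairwiseDisjoint
        (fun i => Mahler.quotImage 𝕃 b (Mahler.classOf b r l i)) ∧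
      (∀ lam : 𝕃ˣ, algebraMap 𝕃 Kbar (lam : 𝕃) ∈ Mahler.Lam' b r l Kbar →
        {y | y ∈ Mahler.hypSolutions 𝕃 b r l ∧
            ∃ p : Mahler.Puiseux 𝕃, y = MonoidAlgebra.single lam p}
          = ⋃ i ∈ {i | i ∈ I ∧ i.1 = lam}, Mahler.classOf b r l i) ∧
      (I : Set (𝕃ˣ × RatFunc 𝕃)).PairwiseDisjoint (fun i => Mahler.classOf b r l i) ∧
      (∀ i ∈ I,
        ((D i).lam, (D i).g) = i ∧
        (D i).Represents b r l (Mahler.classOf b r l i) ∧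
        ∃ φ : Projectivization 𝕃 (Fin (D i).s → 𝕃) → Mahler.Puiseux 𝕃,
          Function.Injective φ ∧
          Set.range φ = Mahler.quotImage 𝕃 b (Mahler.classOf b r l i) ∧
          ∀ (c : Fin (D i).s → 𝕃) (hc : c ≠ 0),
            (D i).combination b r l 1 c ≠ 0 ∧
            φ (Projectivization.mk 𝕃 c hc)
              = algebraMap 𝕃 (Mahler.Puiseux 𝕃) (i.1 : 𝕃)
                * ((D i).combination b r l b c / (D i).combination b r l 1 c)
                * Mahler.ratAt 1 (Mahler.ramBound b r l (i.1 : 𝕃)) i.2) ∧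
      ∑ i ∈ I, (((D i).s : ℤ) - 1) ≤ (r : ℤ) - (I.card : ℤ) := by
  have hcls : ∀ i ∈ Mahler.classIndices b r l 𝕃, _ :=
    fun i hi => Mahler.exists_of_mem_classIndices (b := b) (r := r) (l := l) (F := 𝕃) hi
  have hfin := Mahler.finite_classIndices (r := r) (F := 𝕃) hb hl0
  refine ⟨fun H hH => ?_, fun i hi => (hcls i hi).1, ?_⟩
  · obtain ⟨d, hd⟩ := Mahler.exists_represents hb hl0 hH
    exact ⟨d, hd, fun d' hd' => hd'.unique hb hH hd⟩
  have hex : ∀ i : 𝕃ˣ × RatFunc 𝕃, ∃ d : Mahler.ClassData 𝕃, i ∈ Mahler.classIndices b r l 𝕃 →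
      d.Represents b r l (Mahler.classOf b r l i) ∧ (d.lam, d.g) = i := by
    intro i
    by_cases hi : i ∈ Mahler.classIndices b r l 𝕃
    · obtain ⟨d, hd⟩ := (hcls i hi).2
      exact ⟨d, fun _ => hd⟩
    · exact ⟨⟨1, 0, 0, fun _ => 0⟩, fun h => absurd h hi⟩
  choose D hD using hex
  have hmem : ∀ i, i ∈ hfin.toFinset ↔ i ∈ Mahler.classIndices b r l 𝕃 := fun i =>
    hfin.mem_toFinset
  refine ⟨hfin.toFinset, D, hfin.coe_toFinset, ?_, ?_, ?_, ?_, ?_, ?_, ?_⟩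
  · intro i hi
    rw [hmem] at hi
    obtain ⟨hd, hdi⟩ := hD i hi
    have hy := Mahler.subset_hypSolutions (hcls i hi).1 (hd.series_mem ⟨0, hd.s_pos⟩)
    have hL := (Mahler.applyL_single_eq_zero_iff b r l _ _).1 hy.2.2
    have h1 := Mahler.algebraMap_mem_Lam' (G := Kbar) hb hl0 (D i).lam
      (hd.series_ne_zero ⟨0, hd.s_pos⟩) hL
    have h2 := hd.g_zero
    rw [← hdi]
    exact ⟨h1, h2⟩
  · rw [Mahler.riccatiSolutions_eq hb hl0]
    simp only [hmem]
  · intro i hi i' hi' hne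
    rw [hfin.coe_toFinset] at hi hi'
    exact Mahler.disjoint_quotImage hb hi hi' hne
  · intro lam _
    rw [Mahler.hypSolutions_single_eq hb hl0 lam]
    simp only [hmem]
  · intro i hi i' hi' hne
    rw [hfin.coe_toFinset] at hi hi'
    exact Mahler.disjoint_classOf hb hi hi' hne
  · intro i hi
    rw [hmem] at hi
    obtain ⟨hd, hdi⟩ := hD i hi
    obtain ⟨φ, hinj, hrange, hφ⟩ := hd.exists_parametrisation hb (hcls i hi).1
    refine ⟨hdi, hd, φ, hinj, hrange, fun c hc => ⟨hd.combination_ne_zero hc, ?_⟩⟩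
    rw [hφ, Mahler.ClassData.riccati]
    have h1 : (D i).lam = i.1 := congrArg Prod.fst hdi
    have h2 : (D i).g = i.2 := congrArg Prod.snd hdi
    rw [h1, h2]
  -- The bound `∑ s ≤ r`, with `1` subtracted for each index.
  · have h1 := Mahler.sum_dim_le hb hl0 D (fun i hi => (hD i hi).1) hfin.toFinset
      (fun i hi => (hmem i).1 hi)
    have h2 : ((∑ i ∈ hfin.toFinset, (D i).s : ℕ) : ℤ) ≤ r := by exact_mod_cast h1
    rw [Finset.sum_sub_distrib, Finset.sum_const, nsmul_eq_mul, mul_one]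
    push_cast at h2
    linarith
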